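/- **Setting.** Let $0\le c<1<d\le 2$, $\Omega=(c,d)$, and let $a:[c,d]\to\mathbb R$ satisfy: (i) $a(1)=0$, $a>0$ on $[c,d]\setminus\{1\}$, and there are $x_1^*\in[c,1)$ and $x_2^*\in(1,d]$ such that $a$ is decreasing on $(x_1^*,1)$, increasing on $(1,x_2^*)$, and $$\mu_{1,a}:=\sup_{x\in[x_1^*,1)}\frac{(1-x)|a'(x)|}{a(x)}=\lim_{x\nearrow1}\frac{(1-x)|a'(x)|}{a(x)}>0,\qquad \mu_{2,a}:=\sup_{x\in(1,x_2^*]}\frac{(x-1)|a'(x)|}{a(x)}=\lim_{x\searrow1}\frac{(x-1)|a'(x)|}{a(x)}>0,$$ both being finite; (ii) $a\in C([c,d])\cap C^1([c,d]\setminus\{1\})$; (iii) $(\sqrt a)_x\notin L^\infty(\Omega)$, whereas $(\sqrt a)_x\neq0$ a.e. and $1/(\sqrt a)_x\in L^\infty(\Omega)$. Assume moreover $$\frac{d\ln a(x)}{dx}\ge\frac{d\ln(1-x)^{\mu_{1,a}}}{dx}\quad\forall x\in[c,x_1^*],\qquad \frac{d\ln a(x)}{dx}\le\frac{d\ln(x-1)^{\mu_{2,a}}}{dx}\quad\forall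 x\in[x_2^*,d].$$ Put $$C_a^2=4\max\left\{\frac{(1-c)^{\mu_{1,a}}}{\min_{[c,x_1^*]}a},\ \frac{(1-x_1^*)^{\mu_{1,a}}}{a(x_1^*)},\ \frac{(d-1)^{\mu_{2,a}}}{\min_{[x_2^*,d]}a},\ \frac{(x_2^*-1)^{\mu_{2,a}}}{a(x_2^*)}\right\},\qquad D_a^2=\max\{D_{1,a},D_{2,a}\},$$ $$D_{1,a}=\frac{(x_1^*-c)(2-x_1^*-c)}{2\min_{[c,x_1^*]}a}+\frac{(1-x_1^*)^2}{a(x_1^*)(2-\mu_{1,a})},\qquad D_{2,a}=\frac{(d-x_2^*)(d+x_2^*-2)}{2\min_{[x_2^*,d]}a}+\frac{(x_2^*-1)^2}{a(x_2^*)(2-\mu_{2,a})},$$ with $C_a,D_a\ge0$. (Under (i)--(iii) one has $\mu_{i,a}\le2$. If some $\mu_{i,a}$ equals $2$, read the fraction with $2-\mu_{i,a}$ in its denominator as $0$; the estimate below is then trivial, its right-hand side being $\le0$.) **Spaces.** Let $\|u\|_a^2=\int_\Omega(u^2+a u_x^2)\,dx$. $H^1_a(\Omega)$ and $H^1_{a,0}(\Omega)$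 are the closures of $C^\infty(\overline\Omega)$ and $C_c^\infty(\Omega)$ in $\|\cdot\|_a$. $W^1_a(\Omega)$ is the set of $u\in L^2(\Omega)$ with distributional derivative $u_x\in L^2(\Omega,a\,dx)$, where the derivative is taken on $\Omega$, with $u_x\in L^1(\Omega)$, if $1/a\in L^1(\Omega)$, and on $\Omega\setminus\{1\}$ if $1/a\notin L^1(\Omega)$. $W^1_{a,0}(\Omega)=\{u\in W^1_a(\Omega):u(c)=u(d)=0\}$. Let $V$ be any linear space with $H^1_{a,0}(\Omega)\subseteq V\subseteq W^1_{a,0}(\Omega)$. **Solutions.** On $V\times L^2(\Omega)$ (with the topology of $\|\cdot\|_a$ on $V$) let $\mathcal A(u,v)=(v,(au_x)_x)$. Its domain consists of the $(u,v)\in V\times V$ with $au_x\in W^{1,2}(\Omega)$ that satisfy the transmission conditions: if $1/a\in L^1(\Omega)$, the one-sided limits of $u$ at $1$ exist and agree, and so do those of $au_x$; if $1/a\notin L^1(\Omega)$, the one-sided limits of $au_x$ at $1$ are $0$, and so are those of $a\varphi_xu$ for every $\varphi\in H^1_a(\Omega)$ with $a\varphi_x\in W^{1,2}(\Omega)$.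 A *mild solution* of $$y_{tt}-(ay_x)_x=0,\qquad y(t,c)=y(t,d)=0,$$ with these transmission conditions is a continuous $U=(y,y_t):[0,\infty)\to V\times L^2(\Omega)$ such that, for all $t\ge0$, $\int_0^tU(s)\,ds\in D(\mathcal A)$ and $U(t)=U(0)+\mathcal A\int_0^tU(s)\,ds$ (that is, $U(t)=e^{\mathcal At}U(0)$). It is *classical* if $U\in C^1([0,\infty);V\times L^2(\Omega))$, $U(t)\in D(\mathcal A)$ and $U'(t)=\mathcal AU(t)$ for all $t\ge0$. Its energy is $E_y(t)=\frac12\int_\Omega[y_t^2+a y_x^2]\,dx$. For a mild solution and $z\in\{c,d\}$, $y_x(\cdot,z)\in L^2(0,T)$ denotes the common $L^2(0,T)$-limit of $y^k_x(\cdot,z)$ for all sequences of classical solutions $y^k$ whose initial data converge to those of $y$ in $V\times L^2(\Omega)$. **Theorem.** For every mild solution $y$ and every $T>0$, the normal derivatives $y_x(\cdot,c),\,y_x(\cdot,d)\in L^2(0,T)$ exist and $$(1-c)a(c)\int_0^Ty_x^2(t,c)\,dt+(d-1)a(d)\int_0^Ty_x^2(t,d)\,dt\ \ge\ \Big[(2-\max\{\mu_{1,a},\mu_{2,a}\})T-\max\{4,C_a^2\}-\min\{D_a,C_a\}\max\{\mu_{1,a},\mu_{2,a}\}\Big]E_y(0).$$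 Consequently, if $\max\{\mu_{1,a},\mu_{2,a}\}<2$ and $$T>T_a:=\frac{\max\{4,C_a^2\}+\min\{D_a,C_a\}\max\{\mu_{1,a},\mu_{2,a}\}}{2-\max\{\mu_{1,a},\mu_{2,a}\}},$$ the system is boundary observable in time $T$: there is a constant $C_T>0$ such that $\int_0^Ty_x^2(t,c)\,dt+\int_0^Ty_x^2(t,d)\,dt\ge C_TE_y(0)$ for every mild solution $y$. -/

import Mathlib

open MeasureTheory Set Filter Topology
open scoped ENNReal ContDiff

namespace DegenerateWave

noncomputable section

/-! ### The degenerate weight -/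

/-- The derivative `a'` on `[c,d]` (one-sided at the two end points). -/
def slope (c d : ℝ) (a : ℝ → ℝ) (x : ℝ) : ℝ := derivWithin a (Icc c d) x

/-- `μ_{1,a} = sup_{x ∈ [x₁,1)} (1-x)|a'(x)|/a(x)`. -/
def mu1 (c d : ℝ) (a : ℝ → ℝ) (x₁ : ℝ) : ℝ :=
  sSup ((fun x => (1 - x) * |slope c d a x| / a x) '' Ico x₁ 1)

/-- `μ_{2,a} = sup_{x ∈ (1,x₂]} (x-1)|a'(x)|/a(x)`. -/
def mu2 (c d : ℝ) (a : ℝ → ℝ) (x₂ : ℝ) : ℝ :=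
  sSup ((fun x => (x - 1) * |slope c d a x| / a x) '' Ioc 1 x₂)

/-- Weight functions on `[c,d]` that degenerate exactly at the interior point `1`. -/
structure IsDegenerateWeight (c d : ℝ) (a : ℝ → ℝ) (x₁ x₂ : ℝ) : Prop where
  zero_at_one : a 1 = 0
  pos : ∀ x ∈ Icc c d \ {1}, 0 < a x
  mem_left : x₁ ∈ Ico c 1
  mem_right : x₂ ∈ Ioc 1 d
  antitone_left : AntitoneOn a (Ioo x₁ 1)
  monotone_right : MonotoneOn a (Ioo 1 x₂)
  bdd_left : BddAbove ((fun x => (1 - x) * |slope c d a x| / a x) '' Ico x₁ 1)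
  lim_left : Tendsto (fun x => (1 - x) * |slope c d a x| / a x) (𝓝[<] 1) (𝓝 (mu1 c d a x₁))
  mu1_pos : 0 < mu1 c d a x₁
  bdd_right : BddAbove ((fun x => (x - 1) * |slope c d a x| / a x) '' Ioc 1 x₂)
  lim_right : Tendsto (fun x => (x - 1) * |slope c d a x| / a x) (𝓝[>] 1) (𝓝 (mu2 c d a x₂))
  mu2_pos : 0 < mu2 c d a x₂
  cont : ContinuousOn a (Icc c d)
  contDiff : ContDiffOn ℝ 1 a (Icc c d \ {1})
  sqrt_deriv_unbounded :
    ¬ MemLp (deriv fun x => √(a x)) ∞ (volume.restrict (Ioo c d))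
  sqrt_deriv_ne_zero : ∀ᵐ x ∂volume.restrict (Ioo c d), deriv (fun x => √(a x)) x ≠ 0
  inv_sqrt_deriv_bounded :
    MemLp (fun x => (deriv (fun x => √(a x)) x)⁻¹) ∞ (volume.restrict (Ioo c d))

/-- `D_{1,a}`. -/
def D1 (c d : ℝ) (a : ℝ → ℝ) (x₁ : ℝ) : ℝ :=
  (x₁ - c) * (2 - x₁ - c) / (2 * sInf (a '' Icc c x₁))
    + (1 - x₁) ^ 2 / (a x₁ * (2 - mu1 c d a x₁))

/-- `D_{2,a}`. -/
def D2 (c d : ℝ) (a : ℝ → ℝ) (x₂ : ℝ) : ℝ :=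
  (d - x₂) * (d + x₂ - 2) / (2 * sInf (a '' Icc x₂ d))
    + (x₂ - 1) ^ 2 / (a x₂ * (2 - mu2 c d a x₂))

/-- `D_a`, where `D_a² = max {D_{1,a}, D_{2,a}}`. -/
def Dconst (c d : ℝ) (a : ℝ → ℝ) (x₁ x₂ : ℝ) : ℝ := √(max (D1 c d a x₁) (D2 c d a x₂))

/-- `C_a²`. -/
def CconstSq (c d : ℝ) (a : ℝ → ℝ) (x₁ x₂ : ℝ) : ℝ :=
  4 * max
    (max ((1 - c) ^ mu1 c d a x₁ / sInf (a '' Icc c x₁)) ((1 - x₁) ^ mu1 c d a x₁ / a x₁))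
    (max ((d - 1) ^ mu2 c d a x₂ / sInf (a '' Icc x₂ d)) ((x₂ - 1) ^ mu2 c d a x₂ / a x₂))

/-- `C_a`. -/
def Cconst (c d : ℝ) (a : ℝ → ℝ) (x₁ x₂ : ℝ) : ℝ := √(CconstSq c d a x₁ x₂)

/-- `max {μ_{1,a}, μ_{2,a}}`. -/
def muMax (c d : ℝ) (a : ℝ → ℝ) (x₁ x₂ : ℝ) : ℝ := max (mu1 c d a x₁) (mu2 c d a x₂)

/-- The observability time `T_a` (meaningful when `max {μ_{1,a}, μ_{2,a}} < 2`). -/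
def Tobs (c d : ℝ) (a : ℝ → ℝ) (x₁ x₂ : ℝ) : ℝ :=
  1 / (2 - muMax c d a x₁ x₂) *
    (max 4 (CconstSq c d a x₁ x₂)
      + min (Dconst c d a x₁ x₂) (Cconst c d a x₁ x₂) * muMax c d a x₁ x₂)

/-! ### Weighted Sobolev spaces

An element `u` of a weighted Sobolev space is recorded together with its derivative, as the pair
`(u, u_x)` in `L²(Ω) × L²(Ω, a dx)`; the second entry is determined by the first one, and the
topology of the product is the one of the norm `‖u‖_a`. -/

/-- `L²(Ω)` for `Ω = (c,d)`. -/
abbrev L2 (c d : ℝ) := Lp ℝ 2 (volume.restrict (Ioo c d))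

/-- The measure `a dx` on `Ω = (c,d)`. -/
def weightMeasure (c d : ℝ) (a : ℝ → ℝ) : Measure ℝ :=
  (volume.restrict (Ioo c d)).withDensity fun x => ENNReal.ofReal (a x)

/-- `L²(Ω, a dx)`. -/
abbrev L2w (c d : ℝ) (a : ℝ → ℝ) := Lp ℝ 2 (weightMeasure c d a)

/-- Weak degeneration: `1/a ∈ L¹(Ω)`. -/
def WeaklyDegenerate (c d : ℝ) (a : ℝ → ℝ) : Prop :=
  IntegrableOn (fun x => (a x)⁻¹) (Ioo c d)

/-- `H¹_a(Ω)`: the closure of `C^∞([c,d])` in the norm `‖·‖_a`. -/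
def H1 (c d : ℝ) (a : ℝ → ℝ) : Set (L2 c d × L2w c d a) :=
  closure {q | ∃ φ : ℝ → ℝ, ContDiff ℝ ∞ φ ∧
    q.1 =ᵐ[volume.restrict (Ioo c d)] φ ∧ q.2 =ᵐ[volume.restrict (Ioo c d)] deriv φ}

/-- `H¹_{a,0}(Ω)`: the closure of `C_c^∞(Ω)` in the norm `‖·‖_a`. -/
def H10 (c d : ℝ) (a : ℝ → ℝ) : Set (L2 c d × L2w c d a) :=
  closure {q | ∃ φ : ℝ → ℝ, ContDiff ℝ ∞ φ ∧ HasCompactSupport φ ∧ tsupport φ ⊆ Ioo c d ∧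
    q.1 =ᵐ[volume.restrict (Ioo c d)] φ ∧ q.2 =ᵐ[volume.restrict (Ioo c d)] deriv φ}

open Classical in
/-- The open set on which the derivative of a function of `W¹_a` is a distributional derivative:
all of `Ω` if `1/a ∈ L¹(Ω)`, and `Ω \ {1}` otherwise (then a function of `L²(Ω, a dx)` need not be
integrable near `1`, so that it need not be a distribution on `Ω`). -/
def distDomain (c d : ℝ) (a : ℝ → ℝ) : Set ℝ :=
  if WeaklyDegenerate c d a then Ioo c d else Ioo c d \ {1}

/-- `W¹_a(Ω)`: the functions `u ∈ L²(Ω)` with distributional derivative in `L²(Ω, a dx)`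
(which is integrable if `1/a ∈ L¹(Ω)`). -/
def W1 (c d : ℝ) (a : ℝ → ℝ) : Set (L2 c d × L2w c d a) :=
  {q | (WeaklyDegenerate c d a → IntegrableOn q.2 (Ioo c d)) ∧
    ∀ φ : ℝ → ℝ, ContDiff ℝ ∞ φ → HasCompactSupport φ → tsupport φ ⊆ distDomain c d a →
      ∫ x in Ioo c d, q.1 x * deriv φ x = - ∫ x in Ioo c d, q.2 x * φ x}

/-- `y` is a representative of `u ∈ L²(Ω)` that is continuous on `[c,1) ∪ (1,d]`. -/
def IsContRep (c d : ℝ) (u : L2 c d) (y : ℝ → ℝ) : Prop :=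
  ContinuousOn y (Icc c d \ {1}) ∧ u =ᵐ[volume.restrict (Ioo c d)] y

/-- `W¹_{a,0}(Ω) = {y ∈ W¹_a(Ω) : y(c) = y(d) = 0}`. -/
def W10 (c d : ℝ) (a : ℝ → ℝ) : Set (L2 c d × L2w c d a) :=
  {q | q ∈ W1 c d a ∧ ∃ y, IsContRep c d q.1 y ∧ y c = 0 ∧ y d = 0}

/-- `V` is an intermediate space: `H¹_{a,0}(Ω) ⊆ V ⊆ W¹_{a,0}(Ω)`. -/
def IsIntermediate (c d : ℝ) (a : ℝ → ℝ) (V : Submodule ℝ (L2 c d × L2w c d a)) : Prop :=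
  H10 c d a ⊆ V ∧ (V : Set (L2 c d × L2w c d a)) ⊆ W10 c d a

/-! ### The operator and its mild and classical solutions -/

/-- `F = a u_x ∈ W^{1,2}(Ω)` (in its absolutely continuous representative) with `(a u_x)_x = f`,
for `q = (u, u_x)`. -/
def IsFlux (c d : ℝ) (a : ℝ → ℝ) (q : L2 c d × L2w c d a) (F : ℝ → ℝ) (f : L2 c d) : Prop :=
  (∀ᵐ x ∂volume.restrict (Ioo c d), F x = a x * q.2 x) ∧
    ∀ x ∈ Icc c d, F x = F c + ∫ s in c..x, f s

/-- The transmission conditions at `1` for a function `y` with flux `F = a y_x`. If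
`1/a ∈ L¹(Ω)`, both `y` and `F` have equal finite one-sided limits. If `1/a ∉ L¹(Ω)`, the one-sided
limits of `F`, and those of `a φ_x y` for all `φ ∈ H¹_a(Ω)` with `a φ_x ∈ W^{1,2}(Ω)`, are `0`. -/
def Transmission (c d : ℝ) (a : ℝ → ℝ) (y F : ℝ → ℝ) : Prop :=
  (WeaklyDegenerate c d a →
    (∃ L, Tendsto y (𝓝[<] 1) (𝓝 L) ∧ Tendsto y (𝓝[>] 1) (𝓝 L)) ∧
    (∃ L, Tendsto F (𝓝[<] 1) (𝓝 L) ∧ Tendsto F (𝓝[>] 1) (𝓝 L))) ∧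
  (¬ WeaklyDegenerate c d a →
    (∀ q ∈ H1 c d a, ∀ G g, IsFlux c d a q G g →
      Tendsto (fun x => G x * y x) (𝓝[<] 1) (𝓝 0) ∧
      Tendsto (fun x => G x * y x) (𝓝[>] 1) (𝓝 0)) ∧
    Tendsto F (𝓝[<] 1) (𝓝 0) ∧ Tendsto F (𝓝[>] 1) (𝓝 0))

/-- A state `((u, u_x), v)`; the energy space `V × L²(Ω)` consists of those with `(u, u_x) ∈ V`. -/
abbrev State (c d : ℝ) (a : ℝ → ℝ) := (L2 c d × L2w c d a) × L2 c d

/-- The graph of the operator `𝒜 (u, v) = (v, (a u_x)_x)`: `U = (u, v)` lies in the domain of `𝒜`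
and `𝒜 U = Z`. (The boundary conditions `u(c) = u(d) = 0` are contained in `U.1 ∈ V`.) -/
def OpGraph (c d : ℝ) (a : ℝ → ℝ) (V : Submodule ℝ (L2 c d × L2w c d a))
    (U Z : State c d a) : Prop :=
  U.1 ∈ V ∧ Z.1 ∈ V ∧ Z.1.1 = U.2 ∧
    ∃ y F, IsContRep c d U.1.1 y ∧ IsFlux c d a U.1 F Z.2 ∧ Transmission c d a y F

/-- `U = (y, y_t)` is the mild solution of `U' = 𝒜 U` on `[0,∞)` in `V × L²(Ω)`: it is continuous
and `U(t) = U(0) + 𝒜 ∫₀ᵗ U(s) ds` for all `t ≥ 0`. -/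
structure IsMildSolution (c d : ℝ) (a : ℝ → ℝ) (V : Submodule ℝ (L2 c d × L2w c d a))
    (U : ℝ → State c d a) : Prop where
  cont : ContinuousOn U (Ici 0)
  mem : ∀ t, 0 ≤ t → (U t).1 ∈ V
  eq : ∀ t, 0 ≤ t → OpGraph c d a V (∫ s in (0 : ℝ)..t, U s) (U t - U 0)

/-- `U` is a classical solution of `U' = 𝒜 U` on `[0,∞)`: it is of class `C¹` with values in
`V × L²(Ω)`, lies in the domain of `𝒜`, and the equation holds for all `t ≥ 0`. -/
def IsClassicalSolution (c d : ℝ) (a : ℝ → ℝ) (V : Submodule ℝ (L2 c d × L2w c d a))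
    (U : ℝ → State c d a) : Prop :=
  ∃ U' : ℝ → State c d a, ContinuousOn U' (Ici 0) ∧
    ∀ t, 0 ≤ t → HasDerivWithinAt U (U' t) (Ici 0) t ∧ OpGraph c d a V (U t) (U' t)

/-- `E_y = ½ ∫ [y_t² + a y_x²] dx` of the state `((y, y_x), y_t)`. -/
def energy (c d : ℝ) (a : ℝ → ℝ) (U : State c d a) : ℝ :=
  1 / 2 * ∫ x in Ioo c d, ((U.2 x) ^ 2 + a x * (U.1.2 x) ^ 2)

/-! ### Normal derivatives at the end points and observability -/

/-- The (one-sided) derivative at `z` of the continuous representative of `u` is `m`. -/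
def HasSlopeAt (c d : ℝ) (z : ℝ) (u : L2 c d) (m : ℝ) : Prop :=
  ∃ y, IsContRep c d u y ∧ HasDerivWithinAt y m (Icc c d) z

/-- `g k` is the normal derivative at `z`, on `[0,T]`, of the `k`-th member of a sequence of
classical solutions whose initial data converge to those of `U` in `V × L²(Ω)`. -/
def IsApproxSlope (c d : ℝ) (a : ℝ → ℝ) (V : Submodule ℝ (L2 c d × L2w c d a)) (z T : ℝ)
    (U : ℝ → State c d a) (g : ℕ → ℝ → ℝ) : Prop :=
  ∃ Y : ℕ → ℝ → State c d a, (∀ k, IsClassicalSolution c d a V (Y k)) ∧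
    Tendsto (fun k => Y k 0) atTop (𝓝 (U 0)) ∧
    ∀ k, ∀ t ∈ Icc 0 T, HasSlopeAt c d z (Y k t).1.1 (g k t)

/-- `g = y_x(·,z)` in `L²(0,T)` for a mild solution `U = (y, y_t)`: the limit in `L²(0,T)` of the
normal derivatives of approximating classical solutions. There is an approximating sequence, and
every one has this limit. -/
def IsNormalDerivative (c d : ℝ) (a : ℝ → ℝ) (V : Submodule ℝ (L2 c d × L2w c d a)) (z T : ℝ)
    (U : ℝ → State c d a) (g : ℝ → ℝ) : Prop :=
  MemLp g 2 (volume.restrict (Ioo 0 T)) ∧ (∃ h, IsApproxSlope c d a V z T U h) ∧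
    ∀ h, IsApproxSlope c d a V z T U h →
      Tendsto (fun k => eLpNorm (h k - g) 2 (volume.restrict (Ioo 0 T))) atTop (𝓝 0)

/-- Boundary observability in time `T` via the normal derivatives at `c` and `d`. -/
def IsObservable (c d : ℝ) (a : ℝ → ℝ) (V : Submodule ℝ (L2 c d × L2w c d a)) (T : ℝ) : Prop :=
  ∃ K : ℝ, 0 < K ∧ ∀ U, IsMildSolution c d a V U →
    ∃ gc gd, IsNormalDerivative c d a V c T U gc ∧ IsNormalDerivative c d a V d T U gd ∧
      K * energy c d a (U 0) ≤ (∫ t in (0 : ℝ)..T, gc t ^ 2) + ∫ t in (0 : ℝ)..T, gd t ^ 2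

end

end DegenerateWave

/-!
# Boundary observability of a wave equation degenerating at an interior point

The proof is the multiplier method with the multiplier `(x - 1) y_x`. For a state in the domain of
the operator, with flux `F = a y_x`, integrating `((x - 1) F² / a)'` and `((x - 1) y_t²)'` gives
`d/dt 2 ∫ y_t (x - 1) y_x = B - ∫ y_t² - ∫ (1 - (x - 1) a' / a) a y_x²`, where
`B = (1 - c) a(c) y_x(c)² + (d - 1) a(d) y_x(d)²`. Since `(x - 1) a' / a ≤ max {μ₁, μ₂}`, adding a
multiple of the equipartition identity `d/dt ∫ y y_t = ∫ y_t² - ∫ a y_x²` and using conservation of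
energy bounds `∫ B` from below; the time-boundary terms are controlled by `(x - 1)² ≤ (C_a² / 4) a`
and by a Poincaré inequality, whose constant is `C_a` by Hardy's inequality and `D_a` by the
Cauchy-Schwarz inequality (`IsDegenerateWeight.exists_classical_estimates`). As
`(x - 1) a' / a` is bounded, the same identity bounds `∫ B` from above by the energy.

No boundary term arises at the degenerate point. If `G` has a limit at `1` and `G / (1 - x)` is
integrable then the limit is `0` (`limit_eq_zero_of_integrableOn_div`); this applies to
`G = (x - 1) F² / a`, to `G = (x - 1) y²` and, when `F(1) = 0`, to `G = (F v)²`. The last one is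
needed for conservation of energy if `1/a` is not integrable; if `1/a` is integrable, the elements
of the form domain are absolutely continuous across `1`. The order of degeneration is at most `2`,
because `1 / (√a)'` is bounded (`IsLeftDegenerate.mu_le_two`). All estimates near `1` are proved on
the left of `1` and transferred to the right by the reflection `x ↦ 2 - x`.

The means `ε⁻¹ ∫_t^{t+ε} U` of a mild solution are classical solutions whose data converge to those
of `U`. By the upper bound for `∫ B`, applied to differences of classical solutions, their normal
derivatives converge in `L²(0, T)` and the limit does not depend on the approximating sequence, so
the lower bound passes to mild solutions (`IsDegenerateWeight.exists_normalDerivatives`).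
-/

namespace DegenerateWave

/-! ### Absolutely continuous functions -/

/-- `F` is absolutely continuous on `[α, β]` with derivative `f`, in the form of the fundamental
theorem of calculus. -/
structure IsPrimitiveOn (F f : ℝ → ℝ) (α β : ℝ) : Prop where
  le : α ≤ β
  integrable : IntegrableOn f (Ioo α β)
  eq : ∀ x ∈ Icc α β, F x = F α + ∫ s in α..x, f s

namespace IsPrimitiveOn

variable {F f G g : ℝ → ℝ} {α β : ℝ}

lemma intervalIntegrable (h : IsPrimitiveOn F f α β) : IntervalIntegrable f volume α β := by
  rw [intervalIntegrable_iff_integrableOn_Ioo_of_le h.le]; exact h.integrable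

lemma mono (h : IsPrimitiveOn F f α β) {x : ℝ} (hx : x ∈ Icc α β) : IsPrimitiveOn F f α x where
  le := hx.1
  integrable := h.integrable.mono_set (Ioo_subset_Ioo_right hx.2)
  eq z hz := h.eq z ⟨hz.1, hz.2.trans hx.2⟩

lemma absolutelyContinuous (h : IsPrimitiveOn F f α β) :
    AbsolutelyContinuousOnInterval (fun x => F α + ∫ s in α..x, f s) α β := by
  have h1 := h.intervalIntegrable.absolutelyContinuousOnInterval_intervalIntegral
    (c := α) (by simp)
  have h2 : AbsolutelyContinuousOnInterval (fun _ : ℝ => F α) α β :=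
    ContDiffOn.absolutelyContinuousOnInterval contDiffOn_const
  exact h2.add h1

lemma continuousOn (h : IsPrimitiveOn F f α β) : ContinuousOn F (Icc α β) := by
  have := h.absolutelyContinuous.continuousOn
  rw [uIcc_of_le h.le] at this
  exact this.congr fun x hx => h.eq x hx

lemma integral_eq (h : IsPrimitiveOn F f α β) : ∫ s in α..β, f s = F β - F α := by
  rw [h.eq β ⟨h.le, le_rfl⟩]; ring

lemma ae_hasDerivAt (h : IsPrimitiveOn F f α β) :
    ∀ᵐ x, x ∈ uIcc α β → HasDerivAt (fun x => F α + ∫ s in α..x, f s) (f x) x := by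
  filter_upwards [h.intervalIntegrable.ae_hasDerivAt_integral] with x hx hx'
  exact (hx hx' α (by simp)).const_add _

/-- The product rule. -/
lemma mul (hF : IsPrimitiveOn F f α β) (hG : IsPrimitiveOn G g α β) :
    IsPrimitiveOn (fun x => F x * G x) (fun x => f x * G x + F x * g x) α β where
  le := hF.le
  integrable := by
    have h1 : IntervalIntegrable (fun x => f x * G x + F x * g x) volume α β := by
      refine (hF.intervalIntegrable.mul_continuousOn ?_).add
        (hG.intervalIntegrable.continuousOn_mul ?_)
      · rw [uIcc_of_le hF.le]; exact hG.continuousOn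
      · rw [uIcc_of_le hF.le]; exact hF.continuousOn
    rwa [intervalIntegrable_iff_integrableOn_Ioo_of_le hF.le] at h1
  eq x hx := by
    have hF' := hF.mono hx
    have hG' := hG.mono hx
    have h1 := hF'.absolutelyContinuous.integral_deriv_mul_eq_sub hG'.absolutelyContinuous
    have h2 : ∫ s in α..x, (f s * G s + F s * g s) = F x * G x - F α * G α := by
      rw [hF.eq x hx, hG.eq x hx]
      simp only [intervalIntegral.integral_same, add_zero] at h1
      rw [← h1]
      refine intervalIntegral.integral_congr_ae ?_
      filter_upwards [hF'.ae_hasDerivAt, hG'.ae_hasDerivAt] with s hs1 hs2 hs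
      have hs' : s ∈ uIcc α x := uIoc_subset_uIcc hs
      rw [(hs1 hs').deriv, (hs2 hs').deriv]
      rw [uIcc_of_le hx.1] at hs'
      rw [hF'.eq s hs', hG'.eq s hs']
    rw [h2]; ring

lemma of_hasDerivWithinAt (hαβ : α ≤ β) (hF : ∀ x ∈ Icc α β, HasDerivWithinAt F (f x) (Icc α β) x)
    (hf : ContinuousOn f (Icc α β)) : IsPrimitiveOn F f α β where
  le := hαβ
  integrable := hf.integrableOn_Icc.mono_set Ioo_subset_Icc_self
  eq x hx := by
    have hsub : Icc α x ⊆ Icc α β := Icc_subset_Icc_right hx.2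
    have h := intervalIntegral.integral_eq_sub_of_hasDeriv_right_of_le hx.1
      (f := F) (f' := f) (fun z hz => ((hF z (hsub hz)).continuousWithinAt.mono hsub))
      (fun z hz => by
        have hz' : z ∈ Ioo α β := ⟨hz.1, hz.2.trans_le hx.2⟩
        exact ((hF z (Ioo_subset_Icc_self hz')).hasDerivAt
          (Icc_mem_nhds hz'.1 hz'.2)).hasDerivWithinAt)
      ((hf.mono hsub).intervalIntegrable_of_Icc hx.1)
    rw [h]; ring

lemma neg (h : IsPrimitiveOn F f α β) : IsPrimitiveOn (fun x => -F x) (fun x => -f x) α β where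
  le := h.le
  integrable := h.integrable.neg
  eq x hx := by rw [intervalIntegral.integral_neg, h.eq x hx]; ring

end IsPrimitiveOn

/-- A function with a limit at the right end `1` of `(c, 1)` that is integrable against
`dx / (1 - x)` tends to `0`, as `1 / (1 - x)` is not integrable. -/
lemma limit_eq_zero_of_integrableOn_div {c L : ℝ} (hc : c < 1) {G : ℝ → ℝ}
    (hG : Tendsto G (𝓝[<] 1) (𝓝 L)) (hi : IntegrableOn (fun x => G x / (1 - x)) (Ioo c 1)) :
    L = 0 := by
  by_contra hL
  have h1 : ∀ᶠ x in 𝓝[<] (1 : ℝ), |L| / 2 ≤ |G x| := by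
    have h2 : Tendsto (fun x => |G x|) (𝓝[<] 1) (𝓝 |L|) := hG.abs
    have h3 : |L| / 2 < |L| := by have := abs_pos.2 hL; linarith
    exact (h2.eventually (lt_mem_nhds h3)).mono fun _ h => h.le
  obtain ⟨e, he, h4⟩ := (mem_nhdsLT_iff_exists_mem_Ico_Ioo_subset hc).1 h1
  have h5 : IntegrableOn (fun x => (x - 1)⁻¹) (Ioo e 1) := by
    have h6 : IntegrableOn (fun x => 2 / |L| * (G x / (1 - x))) (Ioo e 1) :=
      (hi.mono_set (Ioo_subset_Ioo_left he.1)).const_mul _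
    refine Integrable.mono h6
      (measurable_id.sub_const (1 : ℝ)).inv.aestronglyMeasurable ?_
    filter_upwards [ae_restrict_mem measurableSet_Ioo] with x hx
    have h7 : |L| / 2 ≤ |G x| := h4 hx
    have h8 : 0 < |L| := abs_pos.2 hL
    have h9 : 0 < 1 - x := by linarith [hx.2]
    rw [Real.norm_eq_abs, Real.norm_eq_abs, abs_mul, abs_div, abs_div, abs_inv, abs_abs,
      abs_of_pos (by norm_num : (0 : ℝ) < 2), abs_sub_comm x 1, abs_of_pos h9]
    have : 1 ≤ 2 / |L| * |G x| := by
      rw [div_mul_eq_mul_div, le_div_iff₀ h8]; linarith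
    calc (1 - x)⁻¹ = 1 * (1 - x)⁻¹ := by ring
      _ ≤ (2 / |L| * |G x|) * (1 - x)⁻¹ := by gcongr
      _ = _ := by ring
  rw [← intervalIntegrable_iff_integrableOn_Ioo_of_le he.2.le, intervalIntegrable_sub_inv_iff] at h5
  rcases h5 with h5 | h5
  · exact he.2.ne h5
  · exact h5 right_mem_uIcc

/-- The primitive of an integrable function tends to the full integral. -/
lemma IsPrimitiveOn.tendsto {c : ℝ} (hc : c < 1) {G r : ℝ → ℝ}
    (hG : ∀ β ∈ Ico c 1, IsPrimitiveOn G r c β) (hr : IntegrableOn r (Ioo c 1)) :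
    Tendsto G (𝓝[<] 1) (𝓝 (G c + ∫ s in c..1, r s)) := by
  have h1 : IsPrimitiveOn (fun x => G c + ∫ s in c..x, r s) r c 1 :=
    ⟨hc.le, hr, fun x hx => by simp⟩
  have h2 := (h1.continuousOn 1 ⟨hc.le, le_rfl⟩).mono Ioo_subset_Icc_self
  have h3 : Tendsto (fun x => G c + ∫ s in c..x, r s) (𝓝[<] 1) (𝓝 (G c + ∫ s in c..1, r s)) := by
    have h4 : 𝓝[Ioo c 1] (1 : ℝ) = 𝓝[<] 1 := nhdsWithin_Ioo_eq_nhdsLT hc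
    rw [← h4]; exact h2
  refine h3.congr' ?_
  filter_upwards [Ioo_mem_nhdsLT hc] with x hx
  exact ((hG x ⟨hx.1.le, hx.2⟩).eq x ⟨hx.1.le, le_rfl⟩).symm

/-- The fundamental theorem of calculus on `(c, 1)` for a function that vanishes at `1` in the
weak sense of `limit_eq_zero_of_integrableOn_div`. -/
lemma IsPrimitiveOn.integral_eq_neg {c : ℝ} (hc : c < 1) {G r : ℝ → ℝ}
    (hG : ∀ β ∈ Ico c 1, IsPrimitiveOn G r c β) (hr : IntegrableOn r (Ioo c 1))
    (hi : IntegrableOn (fun x => G x / (1 - x)) (Ioo c 1)) :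
    ∫ s in Ioo c 1, r s = - G c := by
  have := limit_eq_zero_of_integrableOn_div hc (IsPrimitiveOn.tendsto hc hG hr) hi
  rw [← integral_Ioc_eq_integral_Ioo, ← intervalIntegral.integral_of_le hc.le]
  linarith

lemma integrable_mul_of_sq {X : Type*} [MeasurableSpace X] {μ : Measure X} {f g : X → ℝ}
    (hf : AEStronglyMeasurable f μ) (hg : AEStronglyMeasurable g μ)
    (hf2 : Integrable (fun x => f x ^ 2) μ) (hg2 : Integrable (fun x => g x ^ 2) μ) :
    Integrable (fun x => f x * g x) μ :=
  ((memLp_two_iff_integrable_sq hf).2 hf2).integrable_mul ((memLp_two_iff_integrable_sq hg).2 hg2)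

/-- The Cauchy-Schwarz inequality. -/
lemma sq_integral_mul_le {X : Type*} [MeasurableSpace X] {μ : Measure X} {f g : X → ℝ}
    (hf : AEStronglyMeasurable f μ) (hg : AEStronglyMeasurable g μ)
    (hf2 : Integrable (fun x => f x ^ 2) μ) (hg2 : Integrable (fun x => g x ^ 2) μ) :
    (∫ x, f x * g x ∂μ) ^ 2 ≤ (∫ x, f x ^ 2 ∂μ) * ∫ x, g x ^ 2 ∂μ := by
  have hfg := integrable_mul_of_sq hf hg hf2 hg2
  have h : ∀ t : ℝ, 0 ≤ (∫ x, f x ^ 2 ∂μ) * (t * t) + (2 * ∫ x, f x * g x ∂μ) * t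
      + ∫ x, g x ^ 2 ∂μ := by
    intro t
    have h1 : 0 ≤ ∫ x, (t * f x + g x) ^ 2 ∂μ := integral_nonneg fun x => sq_nonneg _
    have h2 : ∫ x, (t * f x + g x) ^ 2 ∂μ
        = ∫ x, (t * t * f x ^ 2 + 2 * t * (f x * g x) + g x ^ 2) ∂μ := by
      congr 1; ext x; ring
    have h3 : Integrable (fun x => t * t * f x ^ 2 + 2 * t * (f x * g x)) μ :=
      (hf2.const_mul _).add (hfg.const_mul _)
    rw [h2, integral_add h3 hg2, integral_add (hf2.const_mul _) (hfg.const_mul _),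
      integral_const_mul, integral_const_mul] at h1
    linarith
  have := discrim_le_zero h
  rw [discrim] at this
  nlinarith

/-- A compact subset of an open interval lies in a compact subinterval. -/
lemma exists_Icc_of_isCompact {α β : ℝ} (hαβ : α < β) {K : Set ℝ} (hK : IsCompact K)
    (hsub : K ⊆ Ioo α β) : ∃ α' β', α < α' ∧ α' ≤ β' ∧ β' < β ∧ K ⊆ Icc α' β' := by
  have hm : (α + β) / 2 ∈ Ioo α β := ⟨by linarith, by linarith⟩
  have hK' : IsCompact (insert ((α + β) / 2) K) := hK.insert _
  have hne : (insert ((α + β) / 2) K).Nonempty := insert_nonempty _ _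
  have hsub' : insert ((α + β) / 2) K ⊆ Ioo α β := insert_subset hm hsub
  obtain ⟨p, hp⟩ := hK'.exists_isLeast hne
  obtain ⟨q, hq⟩ := hK'.exists_isGreatest hne
  exact ⟨p, q, (hsub' hp.1).1, hp.2 hq.1, (hsub' hq.1).2,
    fun x hx => ⟨hp.2 (mem_insert_of_mem _ hx), hq.2 (mem_insert_of_mem _ hx)⟩⟩

/-- A test function of mean zero on an interval is the derivative of a test function. -/
lemma exists_testFunction_deriv_eq {α β : ℝ} (hαβ : α < β) {θ : ℝ → ℝ} (hθ : ContDiff ℝ ∞ θ)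
    (hc : HasCompactSupport θ) (hs : tsupport θ ⊆ Ioo α β) (h0 : ∫ x in Ioo α β, θ x = 0) :
    ∃ φ : ℝ → ℝ, ContDiff ℝ ∞ φ ∧ HasCompactSupport φ ∧ tsupport φ ⊆ Ioo α β ∧ deriv φ = θ := by
  obtain ⟨p, q, hp, hpq, hq, hK⟩ := exists_Icc_of_isCompact hαβ hc hs
  have hz : ∀ x, x ∉ Icc p q → θ x = 0 := fun x hx => by
    by_contra h
    exact hx (hK (subset_tsupport _ h))
  have hd : ∀ x, HasDerivAt (fun x => ∫ s in α..x, θ s) (θ x) x := fun x =>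
    (hθ.continuous.integral_hasStrictDerivAt α x).hasDerivAt
  have hd' : deriv (fun x => ∫ s in α..x, θ s) = θ := funext fun x => (hd x).deriv
  have hsupp : Function.support (fun x => ∫ s in α..x, θ s) ⊆ Icc p q := by
    intro x hx
    by_contra hx'
    refine hx ?_
    rcases lt_or_ge x p with h | h
    · refine (intervalIntegral.integral_congr (g := fun _ => 0) fun s hs => hz s fun h' => ?_).trans
        (by simp)
      have h1 := h'.1
      rcases le_total α x with h2 | h2
      · rw [uIcc_of_le h2] at hs; linarith [hs.2]
      · rw [uIcc_of_ge h2] at hs; linarith [hs.2]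
    · have h3 : q < x := by by_contra h4; exact hx' ⟨h, not_lt.1 h4⟩
      have h4 : ∫ s in β..x, θ s = 0 := by
        refine (intervalIntegral.integral_congr (g := fun _ => 0)
          fun s hs => hz s fun h' => ?_).trans (by simp)
        have h1 := h'.2
        rcases le_total β x with h2 | h2
        · rw [uIcc_of_le h2] at hs; linarith [hs.1]
        · rw [uIcc_of_ge h2] at hs; linarith [hs.1]
      have h5 : ∫ s in α..β, θ s = 0 := by
        rw [intervalIntegral.integral_of_le hαβ.le, integral_Ioc_eq_integral_Ioo, h0]
      change ∫ s in α..x, θ s = 0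
      rw [← intervalIntegral.integral_add_adjacent_intervals
        (hθ.continuous.intervalIntegrable α β) (hθ.continuous.intervalIntegrable β x), h4, h5,
        add_zero]
  have hts : tsupport (fun x => ∫ s in α..x, θ s) ⊆ Icc p q := closure_minimal hsupp isClosed_Icc
  refine ⟨fun x => ∫ s in α..x, θ s, ?_, ?_, hts.trans fun x hx => ⟨hp.trans_le hx.1,
    hx.2.trans_lt hq⟩, hd'⟩
  · rw [contDiff_infty_iff_deriv, hd']
    exact ⟨fun x => (hd x).differentiableAt, hθ⟩
  · exact isCompact_Icc.of_isClosed_subset (isClosed_tsupport _) hts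

/-- The lemma of du Bois-Reymond: a function whose distributional derivative is `g` is a primitive
of `g`, up to a constant. -/
lemma exists_ae_eq_add_integral {α β : ℝ} (hαβ : α < β) {u g : ℝ → ℝ}
    (hu : IntegrableOn u (Ioo α β)) (hg : IntegrableOn g (Ioo α β))
    (h : ∀ φ : ℝ → ℝ, ContDiff ℝ ∞ φ → HasCompactSupport φ → tsupport φ ⊆ Ioo α β →
      ∫ x in Ioo α β, u x * deriv φ x = - ∫ x in Ioo α β, g x * φ x) :
    ∃ C, u =ᵐ[volume.restrict (Ioo α β)] fun x => C + ∫ s in α..x, g s := by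
  have hP : IsPrimitiveOn (fun x => ∫ s in α..x, g s) g α β := ⟨hαβ.le, hg, fun x hx => by simp⟩
  set P : ℝ → ℝ := fun x => ∫ s in α..x, g s with hPdef
  have hPi : IntegrableOn P (Ioo α β) :=
    hP.continuousOn.integrableOn_Icc.mono_set Ioo_subset_Icc_self
  have hw : IntegrableOn (fun x => u x - P x) (Ioo α β) := hu.sub hPi
  have hmul : ∀ {k φ : ℝ → ℝ}, IntegrableOn k (Ioo α β) → Continuous φ → HasCompactSupport φ →
      IntegrableOn (fun x => k x * φ x) (Ioo α β) := by
    intro k φ hk hφ hφc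
    obtain ⟨B, hB⟩ := hφc.exists_bound_of_continuous hφ
    exact hk.mul_bdd hφ.aestronglyMeasurable (ae_of_all _ hB)
  have key : ∀ φ : ℝ → ℝ, ContDiff ℝ ∞ φ → HasCompactSupport φ → tsupport φ ⊆ Ioo α β →
      ∫ x in Ioo α β, (u x - P x) * deriv φ x = 0 := by
    intro φ hφ hφc hφs
    have hφ' : Continuous (deriv φ) := hφ.continuous_deriv (by simp)
    have hφd : ∀ x, HasDerivAt φ (deriv φ x) x := fun x =>
      (hφ.differentiable (by simp) x).hasDerivAt
    have hφ0 : ∀ x, x ∉ Ioo α β → φ x = 0 := fun x hx => by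
      by_contra h'
      exact hx (hφs (subset_tsupport _ h'))
    have h1 := (hP.mul (IsPrimitiveOn.of_hasDerivWithinAt hαβ.le
      (fun x _ => (hφd x).hasDerivWithinAt) hφ'.continuousOn)).integral_eq
    rw [hφ0 α (by simp), hφ0 β (by simp), intervalIntegral.integral_of_le hαβ.le,
      integral_Ioc_eq_integral_Ioo, integral_add (hmul hg hφ.continuous hφc)
        (hmul hPi hφ' hφc.deriv)] at h1
    simp only [sub_mul]
    rw [integral_sub (hmul hu hφ' hφc.deriv) (hmul hPi hφ' hφc.deriv), h φ hφ hφc hφs]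
    linarith
  let bump : ContDiffBump ((α + β) / 2) :=
    ⟨(β - α) / 8, (β - α) / 4, by linarith, by linarith⟩
  set ψ : ℝ → ℝ := bump.normed volume with hψ
  have hψ1 : ContDiff ℝ ∞ ψ := bump.contDiff_normed
  have hψc : HasCompactSupport ψ := bump.hasCompactSupport_normed
  have hψs : tsupport ψ ⊆ Ioo α β := by
    rw [hψ, bump.tsupport_normed_eq, Real.closedBall_eq_Icc]
    intro x hx
    have h1 := hx.1
    have h2 := hx.2
    change (α + β) / 2 - (β - α) / 4 ≤ x at h1
    change x ≤ (α + β) / 2 + (β - α) / 4 at h2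
    exact ⟨by linarith, by linarith⟩
  have hset : ∀ {φ k : ℝ → ℝ}, tsupport φ ⊆ Ioo α β →
      ∫ x in Ioo α β, φ x * k x = ∫ x, φ x * k x := by
    intro φ k hφ
    refine setIntegral_eq_integral_of_forall_compl_eq_zero fun x hx => ?_
    have : φ x = 0 := by
      by_contra h'
      exact hx (hφ (subset_tsupport _ h'))
    simp [this]
  have hψi : ∫ x in Ioo α β, ψ x = 1 := by
    have := hset (φ := ψ) (k := fun _ => 1) hψs
    simp only [mul_one] at this
    rw [this]; exact bump.integral_normed
  refine ⟨∫ x in Ioo α β, (u x - P x) * ψ x, ?_⟩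
  set C := ∫ x in Ioo α β, (u x - P x) * ψ x with hC
  have hwC : IntegrableOn (fun x => u x - P x - C) (Ioo α β) := hw.sub (by simp)
  have h2 := isOpen_Ioo.ae_eq_zero_of_integral_contDiff_smul_eq_zero (μ := volume)
    hwC.locallyIntegrableOn (fun χ hχ hχc hχs => by
      set m := ∫ x in Ioo α β, χ x with hm
      have hsub : tsupport (fun x => χ x - m * ψ x) ⊆ tsupport χ ∪ tsupport ψ := by
        refine (tsupport_sub _ _).trans (union_subset_union_right _ ?_)
        exact tsupport_mul_subset_right
      have hθs : tsupport (fun x => χ x - m * ψ x) ⊆ Ioo α β :=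
        hsub.trans (union_subset hχs hψs)
      have hθc : HasCompactSupport (fun x => χ x - m * ψ x) :=
        (IsCompact.union hχc hψc).of_isClosed_subset (isClosed_tsupport _) hsub
      have hχi : IntegrableOn χ (Ioo α β) := (hχ.continuous.integrable_of_hasCompactSupport hχc).integrableOn
      have hψint : IntegrableOn ψ (Ioo α β) := (hψ1.continuous.integrable_of_hasCompactSupport hψc).integrableOn
      obtain ⟨φ, hφ, hφc, hφs, hφd⟩ := exists_testFunction_deriv_eq hαβ
        (hχ.sub (contDiff_const.mul hψ1)) hθc hθs (by
          rw [integral_sub hχi (hψint.const_mul m), integral_const_mul, hψi, ← hm]; ring)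
      have h3 := key φ hφ hφc hφs
      rw [hφd] at h3
      have h4 := hmul hw hχ.continuous hχc
      have h5 := hmul hw hψ1.continuous hψc
      have h6 : ∫ x in Ioo α β, ((u x - P x) * χ x - m * ((u x - P x) * ψ x)) = 0 := by
        rw [← h3]; congr 1; ext x; ring
      rw [integral_sub h4 (h5.const_mul m), integral_const_mul, ← hC] at h6
      simp only [smul_eq_mul]
      rw [← hset hχs]
      have h7 : ∫ x in Ioo α β, χ x * (u x - P x - C)
          = ∫ x in Ioo α β, ((u x - P x) * χ x - C * χ x) := by congr 1; ext x; ring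
      rw [h7, integral_sub h4 (hχi.const_mul C), integral_const_mul, ← hm]
      linarith)
  rw [Filter.EventuallyEq, ae_restrict_iff' measurableSet_Ioo]
  filter_upwards [h2] with x hx hx'
  have := hx hx'
  simp only [hPdef] at this
  linarith

/-! ### Integral identities on one side of the degenerate point -/

/-- A weight on `[c, 1)` that may degenerate at `1`, at most quadratically and with a logarithmic
derivative of order at most `1 / (1 - x)`; the function `b'` is the derivative of `b`. -/
structure IsLeftWeight (c : ℝ) (b b' : ℝ → ℝ) : Prop where
  lt : c < 1
  pos : ∀ x ∈ Ico c 1, 0 < b x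
  deriv : ∀ x ∈ Ico c 1, HasDerivWithinAt b (b' x) (Ico c 1) x
  cont' : ContinuousOn b' (Ico c 1)
  quad : ∃ κ, ∀ x ∈ Ico c 1, (1 - x) ^ 2 ≤ κ * b x
  log : ∃ K, ∀ x ∈ Ico c 1, |(1 - x) * b' x| ≤ K * b x

/-- `y` is the element of the weighted Sobolev space on `(c, 1)` with derivative `g` and
`y(c) = 0`. -/
structure IsLeftTrace (c : ℝ) (b g y : ℝ → ℝ) : Prop where
  meas : AEStronglyMeasurable g (volume.restrict (Ioo c 1))
  energy : IntegrableOn (fun x => b x * g x ^ 2) (Ioo c 1)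
  sq : IntegrableOn (fun x => y x ^ 2) (Ioo c 1)
  prim : ∀ β ∈ Ico c 1, IsPrimitiveOn y g c β
  zero : y c = 0

/-- `F = b g` is the flux of a function with derivative `g`, and `F' = f ∈ L²(c, 1)`. -/
structure IsLeftFlux (c : ℝ) (b g F f : ℝ → ℝ) : Prop where
  meas : AEStronglyMeasurable f (volume.restrict (Ioo c 1))
  sq : IntegrableOn (fun x => f x ^ 2) (Ioo c 1)
  prim : IsPrimitiveOn F f c 1
  eq : ∀ᵐ x ∂volume.restrict (Ioo c 1), F x = b x * g x

section OneSided

variable {c : ℝ} {b b' g y h v F f : ℝ → ℝ}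

namespace IsLeftWeight

lemma continuousOn (hb : IsLeftWeight c b b') : ContinuousOn b (Ico c 1) :=
  fun x hx => (hb.deriv x hx).continuousWithinAt

lemma aesm (hb : IsLeftWeight c b b') : AEStronglyMeasurable b (volume.restrict (Ioo c 1)) :=
  (hb.continuousOn.mono Ioo_subset_Ico_self).aestronglyMeasurable measurableSet_Ioo

lemma aesm' (hb : IsLeftWeight c b b') : AEStronglyMeasurable b' (volume.restrict (Ioo c 1)) :=
  (hb.cont'.mono Ioo_subset_Ico_self).aestronglyMeasurable measurableSet_Ioo

end IsLeftWeight

lemma IsLeftTrace.aesm (hy : IsLeftTrace c b g y) :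
    AEStronglyMeasurable y (volume.restrict (Ioo c 1)) := by
  refine ContinuousOn.aestronglyMeasurable (fun x hx => ?_) measurableSet_Ioo
  have hx' : (x + 1) / 2 ∈ Ico c 1 := ⟨by linarith [hx.1, hx.2], by linarith [hx.2]⟩
  exact ((hy.prim _ hx').continuousOn.continuousAt
    (Icc_mem_nhds hx.1 (by linarith [hx.2]))).continuousWithinAt

lemma aesm_sub_one {s : Set ℝ} : AEStronglyMeasurable (fun x : ℝ => x - 1) (volume.restrict s) := by
  fun_prop

/-- `(x - 1) g ∈ L²`, since the weight degenerates at most quadratically. -/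
lemma IsLeftTrace.integrable_hardy (hb : IsLeftWeight c b b') (hy : IsLeftTrace c b g y) :
    IntegrableOn (fun x => ((x - 1) * g x) ^ 2) (Ioo c 1) := by
  obtain ⟨κ, hκ⟩ := hb.quad
  refine Integrable.mono' (hy.energy.const_mul κ) ((aesm_sub_one.mul hy.meas).pow 2) ?_
  filter_upwards [ae_restrict_mem measurableSet_Ioo] with x hx
  have h1 := hκ x ⟨hx.1.le, hx.2⟩
  rw [Real.norm_eq_abs, abs_of_nonneg (sq_nonneg _)]
  calc ((x - 1) * g x) ^ 2 = (1 - x) ^ 2 * g x ^ 2 := by ring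
    _ ≤ κ * b x * g x ^ 2 := by gcongr
    _ = _ := by ring

lemma IsLeftTrace.integrable_mul (hb : IsLeftWeight c b b') (hy : IsLeftTrace c b g y)
    (hv : IsLeftTrace c b h v) : IntegrableOn (fun x => b x * g x * h x) (Ioo c 1) := by
  refine Integrable.mono' (hy.energy.add hv.energy) ((hb.aesm.mul hy.meas).mul hv.meas) ?_
  filter_upwards [ae_restrict_mem measurableSet_Ioo] with x hx
  have h1 := hb.pos x ⟨hx.1.le, hx.2⟩
  simp only [Pi.add_apply]
  rw [Real.norm_eq_abs, mul_assoc, abs_mul, abs_of_pos h1, ← mul_add]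
  gcongr
  rw [abs_le]
  constructor <;> nlinarith [sq_nonneg (g x + h x), sq_nonneg (g x - h x), sq_nonneg (g x),
    sq_nonneg (h x)]

lemma isPrimitiveOn_sub_one {α β : ℝ} (hαβ : α ≤ β) :
    IsPrimitiveOn (fun x => x - 1) (fun _ => 1) α β :=
  IsPrimitiveOn.of_hasDerivWithinAt hαβ
    (fun x _ => ((hasDerivAt_id x).sub_const 1).hasDerivWithinAt) continuousOn_const

/-- Integration by parts for `((x - 1) y²)'`; the term at `1` vanishes because `y ∈ L²`. -/
lemma IsLeftTrace.integral_mul_multiplier (hb : IsLeftWeight c b b') (hy : IsLeftTrace c b g y) :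
    ∫ x in Ioo c 1, y x * ((x - 1) * g x) = -(1 / 2) * ∫ x in Ioo c 1, y x ^ 2 := by
  have hI : IntegrableOn (fun x => y x * ((x - 1) * g x)) (Ioo c 1) :=
    integrable_mul_of_sq hy.aesm (aesm_sub_one.mul hy.meas) hy.sq
    (hy.integrable_hardy hb)
  have hr : ∀ x, 1 * (y x * y x) + (x - 1) * (g x * y x + y x * g x)
      = y x ^ 2 + 2 * (y x * ((x - 1) * g x)) := fun x => by ring
  have hri : IntegrableOn (fun x => y x ^ 2 + 2 * (y x * ((x - 1) * g x))) (Ioo c 1) :=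
    hy.sq.add (hI.const_mul 2)
  have key := IsPrimitiveOn.integral_eq_neg hb.lt
    (G := fun x => (x - 1) * (y x * y x)) (r := fun x => y x ^ 2 + 2 * (y x * ((x - 1) * g x)))
    (fun β hβ => by
      have := (isPrimitiveOn_sub_one hβ.1).mul ((hy.prim β hβ).mul (hy.prim β hβ))
      simpa only [hr] using this) hri (by
      refine hy.sq.neg.congr ?_
      filter_upwards [ae_restrict_mem measurableSet_Ioo] with x hx
      have : 1 - x ≠ 0 := by linarith [hx.2]
      simp only [Pi.neg_apply]
      field_simp
      ring)
  rw [integral_add hy.sq (hI.const_mul 2), integral_const_mul, hy.zero] at key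
  linarith

/-- Hardy's inequality. -/
lemma IsLeftTrace.hardy (hb : IsLeftWeight c b b') (hy : IsLeftTrace c b g y) :
    ∫ x in Ioo c 1, y x ^ 2 ≤ 4 * ∫ x in Ioo c 1, ((x - 1) * g x) ^ 2 := by
  have h1 := hy.integral_mul_multiplier hb
  have h2 := sq_integral_mul_le hy.aesm (aesm_sub_one.mul hy.meas) hy.sq (hy.integrable_hardy hb)
  have h3 : 0 ≤ ∫ x in Ioo c 1, y x ^ 2 := integral_nonneg fun x => sq_nonneg _
  simp only [Pi.mul_apply] at h2
  rw [h1] at h2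
  rcases h3.eq_or_lt with h4 | h4
  · rw [← h4]
    have : 0 ≤ ∫ x in Ioo c 1, ((x - 1) * g x) ^ 2 := integral_nonneg fun x => sq_nonneg _
    linarith
  · have h5 : (∫ x in Ioo c 1, y x ^ 2) * (1 / 4 * ∫ x in Ioo c 1, y x ^ 2)
        ≤ (∫ x in Ioo c 1, y x ^ 2) * ∫ x in Ioo c 1, ((x - 1) * g x) ^ 2 := by
      refine le_trans (le_of_eq ?_) h2; ring
    have := le_of_mul_le_mul_left h5 h4
    linarith

lemma IsLeftTrace.hardy_weight (hb : IsLeftWeight c b b') (hy : IsLeftTrace c b g y) {κ : ℝ}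
    (hκ : ∀ x ∈ Ico c 1, (1 - x) ^ 2 ≤ κ * b x) :
    ∫ x in Ioo c 1, ((x - 1) * g x) ^ 2 ≤ κ * ∫ x in Ioo c 1, b x * g x ^ 2 := by
  rw [← integral_const_mul]
  refine setIntegral_mono_on (hy.integrable_hardy hb) (hy.energy.const_mul κ) measurableSet_Ioo
    fun x hx => ?_
  have h1 := hκ x ⟨hx.1.le, hx.2⟩
  calc ((x - 1) * g x) ^ 2 = (1 - x) ^ 2 * g x ^ 2 := by ring
    _ ≤ κ * b x * g x ^ 2 := by gcongr
    _ = _ := by ring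

/-- The multiplier identity for the flux: integration by parts for `((x - 1) F² / b)'`; the term
at `1` vanishes because `F² / b = b g²` is integrable. -/
lemma IsLeftFlux.integral_mul_multiplier (hb : IsLeftWeight c b b') (hy : IsLeftTrace c b g y)
    (hF : IsLeftFlux c b g F f) :
    ∫ x in Ioo c 1, f x * ((x - 1) * g x) = 1 / 2 * ((1 - c) * F c ^ 2 / b c)
      - 1 / 2 * ∫ x in Ioo c 1, (b x - (x - 1) * b' x) * g x ^ 2 := by
  have hI : IntegrableOn (fun x => f x * ((x - 1) * g x)) (Ioo c 1) :=
    integrable_mul_of_sq hF.meas (aesm_sub_one.mul hy.meas) hF.sq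
    (hy.integrable_hardy hb)
  obtain ⟨K, hK⟩ := hb.log
  have hJ : IntegrableOn (fun x => (b x - (x - 1) * b' x) * g x ^ 2) (Ioo c 1) := by
    refine Integrable.mono' (hy.energy.const_mul (1 + K))
      ((hb.aesm.sub (aesm_sub_one.mul hb.aesm')).mul (hy.meas.pow 2)) ?_
    filter_upwards [ae_restrict_mem measurableSet_Ioo] with x hx
    have hx' : x ∈ Ico c 1 := ⟨hx.1.le, hx.2⟩
    have h1 := abs_le.1 (hK x hx')
    have h2 := hb.pos x hx'
    rw [Real.norm_eq_abs, abs_mul, abs_of_nonneg (sq_nonneg (g x)), ← mul_assoc]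
    gcongr
    rw [abs_le]
    constructor <;> nlinarith
  have hri : IntegrableOn (fun x => (b x - (x - 1) * b' x) * g x ^ 2
      + 2 * (f x * ((x - 1) * g x))) (Ioo c 1) := hJ.add (hI.const_mul 2)
  have hp : ∀ β ∈ Ico c 1, IsPrimitiveOn (fun x => (x - 1) / b x)
      (fun x => (b x - (x - 1) * b' x) / b x ^ 2) c β := by
    intro β hβ
    have hsub : Icc c β ⊆ Ico c 1 := fun x hx => ⟨hx.1, hx.2.trans_lt hβ.2⟩
    refine IsPrimitiveOn.of_hasDerivWithinAt hβ.1 (fun x hx => ?_) ?_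
    · have h1 := ((hasDerivAt_id x).sub_const (1 : ℝ)).hasDerivWithinAt (s := Icc c β)
      have h2 := h1.div ((hb.deriv x (hsub hx)).mono hsub) (hb.pos x (hsub hx)).ne'
      exact h2.congr_deriv (by simp)
    · have h1 := hb.continuousOn.mono hsub
      have h2 := hb.cont'.mono hsub
      exact (h1.sub ((continuousOn_id.sub continuousOn_const).mul h2)).div (h1.pow 2)
        fun x hx => pow_ne_zero _ (hb.pos x (hsub hx)).ne'
  have hr : (fun x => (b x - (x - 1) * b' x) / b x ^ 2 * (F x * F x)
      + (x - 1) / b x * (f x * F x + F x * f x)) =ᵐ[volume.restrict (Ioo c 1)]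
      fun x => (b x - (x - 1) * b' x) * g x ^ 2 + 2 * (f x * ((x - 1) * g x)) := by
    filter_upwards [hF.eq, ae_restrict_mem measurableSet_Ioo] with x hx1 hx2
    have := (hb.pos x ⟨hx2.1.le, hx2.2⟩).ne'
    rw [hx1]
    field_simp
    ring
  have key := IsPrimitiveOn.integral_eq_neg hb.lt
    (G := fun x => (x - 1) / b x * (F x * F x))
    (r := fun x => (b x - (x - 1) * b' x) / b x ^ 2 * (F x * F x)
      + (x - 1) / b x * (f x * F x + F x * f x))
    (fun β hβ => by
      have hF' := hF.prim.mono ⟨hβ.1, hβ.2.le⟩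
      exact (hp β hβ).mul (hF'.mul hF')) (hri.congr hr.symm) (by
      refine hy.energy.neg.congr ?_
      filter_upwards [hF.eq, ae_restrict_mem measurableSet_Ioo] with x hx1 hx2
      have h1 : 1 - x ≠ 0 := by linarith [hx2.2]
      have h2 := (hb.pos x ⟨hx2.1.le, hx2.2⟩).ne'
      simp only [Pi.neg_apply]
      rw [hx1]
      field_simp
      ring)
  rw [integral_congr_ae hr, integral_add hJ (hI.const_mul 2), integral_const_mul] at key
  have h3 : (1 - c) * F c ^ 2 / b c = -((c - 1) / b c * (F c * F c)) := by ring
  rw [h3]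
  linarith

/-- Green's formula for a flux that vanishes at `1`. The term `(F v)(1)` vanishes because
`F² = O(1 - x)` and `v ∈ L²`. -/
lemma IsLeftFlux.integral_add_eq_zero (hb : IsLeftWeight c b b') (hy : IsLeftTrace c b g y)
    (hF : IsLeftFlux c b g F f) (hv : IsLeftTrace c b h v) (hF1 : F 1 = 0) :
    ∫ x in Ioo c 1, (f x * v x + F x * h x) = 0 := by
  have hI : IntegrableOn (fun x => f x * v x + F x * h x) (Ioo c 1) := by
    refine (integrable_mul_of_sq hF.meas hv.aesm hF.sq hv.sq).add ?_
    refine (hy.integrable_mul hb hv).congr ?_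
    filter_upwards [hF.eq] with x hx
    rw [hx]
  have hG : ∀ β ∈ Ico c 1, IsPrimitiveOn (fun x => F x * v x) (fun x => f x * v x + F x * h x)
      c β := fun β hβ => (hF.prim.mono ⟨hβ.1, hβ.2.le⟩).mul (hv.prim β hβ)
  have ht := IsPrimitiveOn.tendsto hb.lt hG hI
  simp only [hv.zero, mul_zero, zero_add] at ht
  have hFc : ContinuousOn F (Icc c 1) := hF.prim.continuousOn
  have hbound : ∀ x ∈ Ioo c 1, F x ^ 2 ≤ (∫ s in Ioo c 1, f s ^ 2) * (1 - x) := by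
    intro x hx
    have h1 : F x = -∫ s in Ioo x 1, f s * 1 := by
      have h2 := hF.prim.eq x (Ioo_subset_Icc_self hx)
      have h3 := hF.prim.eq 1 ⟨hb.lt.le, le_rfl⟩
      have h4 := intervalIntegral.integral_add_adjacent_intervals
        (hF.prim.mono (Ioo_subset_Icc_self hx)).intervalIntegrable
        ((intervalIntegrable_iff_integrableOn_Ioo_of_le hx.2.le).2
          (hF.prim.integrable.mono_set (Ioo_subset_Ioo_left hx.1.le)))
      rw [intervalIntegral.integral_of_le hx.2.le, integral_Ioc_eq_integral_Ioo] at h4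
      simp only [mul_one]
      linarith
    have hsub : Ioo x 1 ⊆ Ioo c 1 := Ioo_subset_Ioo_left hx.1.le
    have h5 := sq_integral_mul_le (hF.meas.mono_measure (Measure.restrict_mono hsub le_rfl))
      (aestronglyMeasurable_const (b := (1 : ℝ))) (hF.sq.mono_set hsub) (by simp)
    have h6 : ∫ s in Ioo x 1, f s ^ 2 ≤ ∫ s in Ioo c 1, f s ^ 2 :=
      setIntegral_mono_set hF.sq (ae_of_all _ fun _ => sq_nonneg _) hsub.eventuallyLE
    have h7 : ∫ s in Ioo x 1, (1 : ℝ) ^ 2 = 1 - x := by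
      simp [hx.2.le]
    rw [h1, neg_sq]
    rw [h7] at h5
    exact h5.trans (mul_le_mul_of_nonneg_right h6 (by linarith [hx.2]))
  have h0 := limit_eq_zero_of_integrableOn_div hb.lt (ht.pow 2) (by
    refine Integrable.mono' (hv.sq.const_mul (∫ s in Ioo c 1, f s ^ 2)) ?_ ?_
    · exact (((hFc.mono Ioo_subset_Icc_self).aestronglyMeasurable measurableSet_Ioo).mul
        hv.aesm).pow 2 |>.div₀ (by fun_prop)
    · filter_upwards [ae_restrict_mem measurableSet_Ioo] with x hx
      have h1 : 0 < 1 - x := by linarith [hx.2]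
      rw [Real.norm_eq_abs, abs_of_nonneg (by positivity), div_le_iff₀ h1]
      calc (F x * v x) ^ 2 = F x ^ 2 * v x ^ 2 := by ring
        _ ≤ ((∫ s in Ioo c 1, f s ^ 2) * (1 - x)) * v x ^ 2 := by gcongr; exact hbound x hx
        _ = _ := by ring)
  have h1 := pow_eq_zero_iff (two_ne_zero) |>.1 h0
  rwa [intervalIntegral.integral_of_le hb.lt.le, integral_Ioc_eq_integral_Ioo] at h1

/-- Poincaré's inequality, from `y(x)² ≤ (∫_c^x 1/b) ∫ b g²`. -/
lemma IsLeftTrace.poincare (hb : IsLeftWeight c b b') (hy : IsLeftTrace c b g y) {D : ℝ}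
    (hD : ∀ β ∈ Ico c 1, ∫ x in c..β, (1 - x) / b x ≤ D) :
    ∫ x in Ioo c 1, y x ^ 2 ≤ D * ∫ x in Ioo c 1, b x * g x ^ 2 := by
  set E := ∫ x in Ioo c 1, b x * g x ^ 2 with hE
  have hE0 : 0 ≤ E := setIntegral_nonneg measurableSet_Ioo fun x hx =>
    mul_nonneg (hb.pos x ⟨hx.1.le, hx.2⟩).le (sq_nonneg _)
  have hinv : ContinuousOn (fun x => (b x)⁻¹) (Ico c 1) :=
    hb.continuousOn.inv₀ fun x hx => (hb.pos x hx).ne'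
  have hA : ∀ β ∈ Ico c 1, IsPrimitiveOn (fun x => ∫ s in c..x, (b s)⁻¹) (fun x => (b x)⁻¹) c β := by
    intro β hβ
    have hsub : Icc c β ⊆ Ico c 1 := fun x hx => ⟨hx.1, hx.2.trans_lt hβ.2⟩
    exact ⟨hβ.1, (hinv.mono hsub).integrableOn_Icc.mono_set Ioo_subset_Icc_self, fun x hx => by simp⟩
  set A : ℝ → ℝ := fun x => ∫ s in c..x, (b s)⁻¹ with hAdef
  have hyA : ∀ x ∈ Ico c 1, y x ^ 2 ≤ E * A x := by
    intro x hx
    have hsub : Ioo c x ⊆ Ioo c 1 := Ioo_subset_Ioo_right hx.2.le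
    have hmem : ∀ s ∈ Ioo c x, s ∈ Ico c 1 := fun s hs => ⟨hs.1.le, hs.2.trans hx.2⟩
    have h1 : y x = ∫ s in Ioo c x, (√(b s) * g s) * √((b s)⁻¹) := by
      rw [(hy.prim x hx).eq x ⟨hx.1, le_rfl⟩, hy.zero, zero_add,
        intervalIntegral.integral_of_le hx.1, integral_Ioc_eq_integral_Ioo]
      refine setIntegral_congr_fun measurableSet_Ioo fun s hs => ?_
      have h2 := hb.pos s (hmem s hs)
      have h3 : √(b s) ≠ 0 := (Real.sqrt_pos.2 h2).ne'
      simp only [Real.sqrt_inv]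
      field_simp
    have hm1 : AEStronglyMeasurable b (volume.restrict (Ioo c x)) :=
      hb.aesm.mono_measure (Measure.restrict_mono hsub le_rfl)
    have hm2 : AEStronglyMeasurable (fun s => √(b s)) (volume.restrict (Ioo c x)) :=
      Real.continuous_sqrt.comp_aestronglyMeasurable hm1
    have hm3 : AEStronglyMeasurable (fun s => √((b s)⁻¹)) (volume.restrict (Ioo c x)) :=
      Real.continuous_sqrt.comp_aestronglyMeasurable
        ((hinv.mono (fun s hs => hmem s hs)).aestronglyMeasurable measurableSet_Ioo)
    have hs1 : EqOn (fun s => (√(b s) * g s) ^ 2) (fun s => b s * g s ^ 2) (Ioo c x) :=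
      fun s hs => by
        simp only [mul_pow]
        rw [Real.sq_sqrt (hb.pos s (hmem s hs)).le]
    have hs2 : EqOn (fun s => √((b s)⁻¹) ^ 2) (fun s => (b s)⁻¹) (Ioo c x) :=
      fun s hs => Real.sq_sqrt (inv_pos.2 (hb.pos s (hmem s hs))).le
    have h4 := sq_integral_mul_le (hm2.mul (hy.meas.mono_measure (Measure.restrict_mono hsub le_rfl)))
      hm3 (IntegrableOn.congr_fun (hy.energy.mono_set hsub) hs1.symm measurableSet_Ioo)
      (IntegrableOn.congr_fun (hA x hx).integrable hs2.symm measurableSet_Ioo)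
    simp only [Pi.mul_apply] at h4
    rw [← h1, setIntegral_congr_fun measurableSet_Ioo hs1,
      setIntegral_congr_fun measurableSet_Ioo hs2] at h4
    have h5 : ∫ s in Ioo c x, (b s)⁻¹ = A x := by
      rw [hAdef]; simp only
      rw [intervalIntegral.integral_of_le hx.1, integral_Ioc_eq_integral_Ioo]
    have h6 : 0 ≤ A x := by
      rw [← h5]
      exact setIntegral_nonneg measurableSet_Ioo fun s hs => (inv_pos.2 (hb.pos s (hmem s hs))).le
    rw [h5] at h4
    refine h4.trans (mul_le_mul_of_nonneg_right ?_ h6)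
    refine setIntegral_mono_set hy.energy ?_ hsub.eventuallyLE
    filter_upwards [ae_restrict_mem measurableSet_Ioo] with s hs
    exact mul_nonneg (hb.pos s ⟨hs.1.le, hs.2⟩).le (sq_nonneg _)
  have hyp : ∀ β ∈ Ico c 1, IsPrimitiveOn (fun x => ∫ s in c..x, y s ^ 2) (fun x => y x ^ 2) c β :=
    fun β hβ => ⟨hβ.1, hy.sq.mono_set (Ioo_subset_Ioo_right hβ.2.le), fun x hx => by simp⟩
  have ht := IsPrimitiveOn.tendsto hb.lt hyp hy.sq
  simp only [intervalIntegral.integral_same, zero_add] at ht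
  rw [intervalIntegral.integral_of_le hb.lt.le, integral_Ioc_eq_integral_Ioo] at ht
  refine le_of_tendsto ht ?_
  filter_upwards [Ioo_mem_nhdsLT hb.lt] with β hβ
  have hβ' : β ∈ Ico c 1 := ⟨hβ.1.le, hβ.2⟩
  have hAi := (hA β hβ').continuousOn.intervalIntegrable_of_Icc hβ'.1 (μ := volume)
  have h1 : ∫ x in c..β, y x ^ 2 ≤ ∫ x in c..β, E * A x :=
    intervalIntegral.integral_mono_on hβ'.1 ((hyp β hβ').intervalIntegrable) (hAi.const_mul E)
      fun x hx => hyA x ⟨hx.1, hx.2.trans_lt hβ.2⟩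
  have h2 := ((isPrimitiveOn_sub_one hβ'.1).mul (hA β hβ')).integral_eq
  have h3 : ∫ x in c..β, (1 * A x + (x - 1) * (b x)⁻¹)
      = (∫ x in c..β, A x) - ∫ x in c..β, (1 - x) / b x := by
    rw [← intervalIntegral.integral_sub hAi]
    · congr 1; ext x; ring
    · refine ContinuousOn.intervalIntegrable_of_Icc hβ'.1 ?_
      have hsub : Icc c β ⊆ Ico c 1 := fun x hx => ⟨hx.1, hx.2.trans_lt hβ.2⟩
      exact (continuousOn_const.sub continuousOn_id).div (hb.continuousOn.mono hsub)
        fun x hx => (hb.pos x (hsub hx)).ne'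
  have h4 : 0 ≤ A β := by
    refine intervalIntegral.integral_nonneg hβ'.1 fun s hs => ?_
    exact (inv_pos.2 (hb.pos s ⟨hs.1, hs.2.trans_lt hβ.2⟩)).le
  change ∫ x in c..β, (1 * A x + (x - 1) * (b x)⁻¹)
    = (β - 1) * A β - (c - 1) * A c at h2
  have h5 : A c = 0 := by simp [hAdef]
  rw [h3, h5] at h2
  have h6 : ∫ x in c..β, A x ≤ D := by
    have := hD β hβ'
    nlinarith [hβ.2]
  rw [intervalIntegral.integral_const_mul] at h1
  calc _ ≤ _ := h1
    _ ≤ E * D := by gcongr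
    _ = D * E := mul_comm _ _

end OneSided

/-! ### The weight on one side of the degenerate point -/

/-- The hypotheses on the weight `b` with derivative `b'` on the left of `1`, where `μ` is the
order of degeneration. The weight on the right of `1` satisfies them after the reflection
`x ↦ 2 - x`. -/
structure IsLeftDegenerate (c x₁ μ : ℝ) (b b' : ℝ → ℝ) : Prop where
  nonneg : 0 ≤ c
  mem : x₁ ∈ Ico c 1
  pos : ∀ x ∈ Ico c 1, 0 < b x
  deriv : ∀ x ∈ Ico c 1, HasDerivWithinAt b (b' x) (Ico c 1) x
  cont' : ContinuousOn b' (Ico c 1)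
  nonpos : ∀ x ∈ Ioo x₁ 1, b' x ≤ 0
  le : ∀ x ∈ Ico x₁ 1, (1 - x) * |b' x| / b x ≤ μ
  lim : Tendsto (fun x => (1 - x) * |b' x| / b x) (𝓝[<] 1) (𝓝 μ)
  mu_pos : 0 < μ
  log : ∀ x ∈ Icc c x₁, -(μ * b x) ≤ (1 - x) * b' x
  sqrt : ∃ δ, 0 < δ ∧ ∀ x ∈ Ioo c 1, δ * √(b x) ≤ |b' x|

namespace IsLeftDegenerate

variable {c x₁ μ : ℝ} {b b' : ℝ → ℝ}

lemma continuousOn (hb : IsLeftDegenerate c x₁ μ b b') : ContinuousOn b (Ico c 1) :=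
  fun x hx => (hb.deriv x hx).continuousWithinAt

lemma lt (hb : IsLeftDegenerate c x₁ μ b b') : c < 1 := hb.mem.1.trans_lt hb.mem.2

lemma le' (hb : IsLeftDegenerate c x₁ μ b b') {x : ℝ} (hx : x ∈ Ico x₁ 1) :
    |(1 - x) * b' x| ≤ μ * b x := by
  have h1 := hb.le x hx
  rw [div_le_iff₀ (hb.pos x ⟨hb.mem.1.trans hx.1, hx.2⟩)] at h1
  rwa [abs_mul, abs_of_pos (by linarith [hx.2])]

/-- `(x - 1) b' / b ≤ μ` on all of `[c, 1)`. -/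
lemma neg_le (hb : IsLeftDegenerate c x₁ μ b b') {x : ℝ} (hx : x ∈ Ico c 1) :
    -(μ * b x) ≤ (1 - x) * b' x := by
  rcases le_total x x₁ with h | h
  · exact hb.log x ⟨hx.1, h⟩
  · exact (abs_le.1 (hb.le' ⟨h, hx.2⟩)).1

/-- A continuous function on `[c, 1)` bounded by a multiple of `b` near `1` is bounded by a
multiple of `b`. -/
lemma exists_le_mul (hb : IsLeftDegenerate c x₁ μ b b') {k : ℝ → ℝ} (hk : ContinuousOn k (Ico c 1))
    {e C : ℝ} (he : e < 1) (hC : ∀ x ∈ Ico c 1, e ≤ x → k x ≤ C * b x) :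
    ∃ κ, ∀ x ∈ Ico c 1, k x ≤ κ * b x := by
  have hsub : Icc c e ⊆ Ico c 1 := fun x hx => ⟨hx.1, hx.2.trans_lt he⟩
  obtain ⟨B, hB⟩ := isCompact_Icc.exists_bound_of_continuousOn
    ((hk.mono hsub).div (hb.continuousOn.mono hsub) fun x hx => (hb.pos x (hsub hx)).ne')
  refine ⟨max B C, fun x hx => ?_⟩
  have hp := hb.pos x hx
  rcases le_total x e with h | h
  · have h1 := (le_abs_self _).trans (hB x ⟨hx.1, h⟩)
    simp only [Pi.div_apply] at h1
    rw [div_le_iff₀ hp] at h1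
    exact h1.trans (by gcongr; exact le_max_left _ _)
  · exact (hC x hx h).trans (by gcongr; exact le_max_right _ _)

lemma isLeftWeight (hb : IsLeftDegenerate c x₁ μ b b') : IsLeftWeight c b b' where
  lt := hb.lt
  pos := hb.pos
  deriv := hb.deriv
  cont' := hb.cont'
  quad := by
    obtain ⟨δ, hδ, h⟩ := hb.sqrt
    have hx1 := hb.mem
    refine hb.exists_le_mul (e := (x₁ + 1) / 2) (C := (μ / δ) ^ 2) (by fun_prop)
      (by linarith [hx1.2]) fun x hx hxe => ?_
    have hx' : x₁ < x := by linarith [hx1.2]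
    have hp := hb.pos x hx
    have h1 := h x ⟨hx1.1.trans_lt hx', hx.2⟩
    have h2 := hb.le' ⟨hx'.le, hx.2⟩
    have h3 : 0 < 1 - x := by linarith [hx.2]
    rw [abs_mul, abs_of_pos h3] at h2
    have h4 : 0 < √(b x) := Real.sqrt_pos.2 hp
    have h5 : √(b x) * √(b x) = b x := Real.mul_self_sqrt hp.le
    have h6 : (1 - x) * δ ≤ μ * √(b x) := by
      have h7 : ((1 - x) * δ) * √(b x) ≤ (μ * √(b x)) * √(b x) := by
        calc ((1 - x) * δ) * √(b x) = (1 - x) * (δ * √(b x)) := by ring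
          _ ≤ (1 - x) * |b' x| := by gcongr
          _ ≤ μ * b x := h2
          _ = _ := by rw [mul_assoc, h5]
      exact le_of_mul_le_mul_right h7 h4
    have h8 : 1 - x ≤ μ / δ * √(b x) := by
      rw [div_mul_eq_mul_div, le_div_iff₀ hδ]; exact h6
    calc (1 - x) ^ 2 ≤ (μ / δ * √(b x)) ^ 2 := by gcongr
      _ = (μ / δ) ^ 2 * (√(b x) * √(b x)) := by ring
      _ = _ := by rw [h5]
  log := hb.exists_le_mul (e := x₁) (C := μ)
    (((continuousOn_const.sub continuousOn_id).mul hb.cont').abs) hb.mem.2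
    fun x hx hxe => hb.le' ⟨hxe, hx.2⟩

lemma hasDerivAt (hb : IsLeftDegenerate c x₁ μ b b') {x : ℝ} (hx : x ∈ Ioo c 1) :
    HasDerivAt b (b' x) x :=
  (hb.deriv x (Ioo_subset_Ico_self hx)).hasDerivAt (Ico_mem_nhds hx.1 hx.2)

lemma hasDerivAt_rpow_div (hb : IsLeftDegenerate c x₁ μ b b') (p : ℝ) {x : ℝ}
    (hx : x ∈ Ioo c 1) : HasDerivAt (fun x => (1 - x) ^ p / b x)
      (-((1 - x) ^ (p - 1) * (p * b x + (1 - x) * b' x)) / b x ^ 2) x := by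
  have h3 : 0 < 1 - x := by linarith [hx.2]
  have h1 : HasDerivAt (fun x : ℝ => (1 - x) ^ p) (-1 * p * (1 - x) ^ (p - 1)) x :=
    ((hasDerivAt_id x).const_sub 1).rpow_const (Or.inl h3.ne')
  refine (h1.div (hb.hasDerivAt hx) (hb.pos x (Ioo_subset_Ico_self hx)).ne').congr_deriv ?_
  have h4 : (1 - x) ^ p = (1 - x) ^ (p - 1) * (1 - x) := by
    rw [← Real.rpow_add_one h3.ne']; ring_nf
  rw [h4]
  ring

lemma continuousOn_rpow_div (hb : IsLeftDegenerate c x₁ μ b b') (p : ℝ) :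
    ContinuousOn (fun x => (1 - x) ^ p / b x) (Ico c 1) := by
  refine ContinuousOn.div ?_ hb.continuousOn fun x hx => (hb.pos x hx).ne'
  exact (continuousOn_const.sub continuousOn_id).rpow_const
    fun x hx => Or.inl (sub_pos.2 hx.2).ne'

lemma antitoneOn (hb : IsLeftDegenerate c x₁ μ b b') :
    AntitoneOn (fun x => (1 - x) ^ μ / b x) (Ico x₁ 1) := by
  have hsub : Ico x₁ 1 ⊆ Ico c 1 := Ico_subset_Ico_left hb.mem.1
  refine antitoneOn_of_deriv_nonpos (convex_Ico _ _) ((hb.continuousOn_rpow_div μ).mono hsub)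
    ?_ ?_ <;> rw [interior_Ico] <;> intro x hx <;>
    have hx' : x ∈ Ioo c 1 := ⟨hb.mem.1.trans_lt hx.1, hx.2⟩
  · exact (hb.hasDerivAt_rpow_div μ hx').differentiableAt.differentiableWithinAt
  · rw [(hb.hasDerivAt_rpow_div μ hx').deriv]
    have h1 := hb.neg_le (Ioo_subset_Ico_self hx')
    have h2 : 0 ≤ (1 - x) ^ (μ - 1) := Real.rpow_nonneg (by linarith [hx.2]) _
    refine div_nonpos_of_nonpos_of_nonneg ?_ (sq_nonneg _)
    rw [neg_nonpos]
    exact mul_nonneg h2 (by linarith)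

/-- The order of degeneration is at most `2`: otherwise `b = O((1 - x)^p)` with `p > 2`, against
`(1 - x)² = O(b)`. -/
lemma mu_le_two (hb : IsLeftDegenerate c x₁ μ b b') : μ ≤ 2 := by
  by_contra! hμ
  set p := (μ + 2) / 2 with hp
  have h1 := hb.lim.eventually (lt_mem_nhds (show p < μ by rw [hp]; linarith))
  obtain ⟨e, he, h2⟩ := (mem_nhdsLT_iff_exists_mem_Ico_Ioo_subset hb.mem.2).1 h1
  have hmono : MonotoneOn (fun x => (1 - x) ^ p / b x) (Ioo e 1) := by
    have hsub : Ioo e 1 ⊆ Ioo c 1 := Ioo_subset_Ioo_left (hb.mem.1.trans he.1)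
    refine monotoneOn_of_deriv_nonneg (convex_Ioo _ _)
      ((hb.continuousOn_rpow_div p).mono (hsub.trans Ioo_subset_Ico_self)) ?_ ?_ <;>
      rw [interior_Ioo] <;> intro x hx
    · exact (hb.hasDerivAt_rpow_div p (hsub hx)).differentiableAt.differentiableWithinAt
    · rw [(hb.hasDerivAt_rpow_div p (hsub hx)).deriv]
      have h3 : p < (1 - x) * |b' x| / b x := h2 hx
      have h4 := hb.nonpos x ⟨he.1.trans_lt hx.1, hx.2⟩
      rw [abs_of_nonpos h4, lt_div_iff₀ (hb.pos x (Ioo_subset_Ico_self (hsub hx)))] at h3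
      have h5 : 0 ≤ (1 - x) ^ (p - 1) := Real.rpow_nonneg (by linarith [hx.2]) _
      refine div_nonneg ?_ (sq_nonneg _)
      rw [neg_nonneg]
      exact mul_nonpos_of_nonneg_of_nonpos h5 (by linarith)
  obtain ⟨κ, hκ⟩ := hb.isLeftWeight.quad
  have hx0 : (e + 1) / 2 ∈ Ioo e 1 := ⟨by linarith [he.2], by linarith [he.2]⟩
  set x0 := (e + 1) / 2
  have hec : c ≤ e := hb.mem.1.trans he.1
  have hx0' : x0 ∈ Ico c 1 := ⟨hec.trans hx0.1.le, hx0.2⟩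
  set r := (1 - x0) ^ p / b x0 with hr
  have hr0 : 0 < r := div_pos (Real.rpow_pos_of_pos (by linarith [hx0.2]) _) (hb.pos _ hx0')
  have hκ0 : 0 < κ := by
    have h3 := hκ x0 hx0'
    have h4 := hb.pos _ hx0'
    have h5 : 0 < (1 - x0) ^ 2 := by have := hx0.2; exact pow_pos (by linarith) 2
    exact pos_of_mul_pos_left (h5.trans_le h3) h4.le
  have ht : Tendsto (fun x : ℝ => (1 - x) ^ (p - 2)) (𝓝[<] 1) (𝓝 0) := by
    have h3 : Continuous fun x : ℝ => (1 - x) ^ (p - 2) :=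
      (continuous_const.sub continuous_id).rpow_const fun x => Or.inr (by rw [hp]; linarith)
    have h4 := h3.tendsto 1
    rw [sub_self, Real.zero_rpow (by rw [hp]; linarith)] at h4
    exact h4.mono_left nhdsWithin_le_nhds
  have h3 : ∀ᶠ x in 𝓝[<] (1 : ℝ), r / κ ≤ (1 - x) ^ (p - 2) := by
    filter_upwards [Ioo_mem_nhdsLT hx0.2] with x hx
    have hx' : x ∈ Ioo e 1 := ⟨hx0.1.trans hx.1, hx.2⟩
    have h4 : r ≤ (1 - x) ^ p / b x := hmono hx0 hx' hx.1.le
    have h6 : x ∈ Ico c 1 := ⟨hec.trans hx'.1.le, hx.2⟩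
    have h5 := hκ x h6
    have h7 : 0 < 1 - x := by linarith [hx.2]
    have h8 := hb.pos x h6
    rw [le_div_iff₀ h8] at h4
    rw [div_le_iff₀ hκ0]
    have h9 : (1 - x) ^ p = (1 - x) ^ (p - 2) * (1 - x) ^ 2 := by
      rw [← Real.rpow_natCast, ← Real.rpow_add h7]; norm_num
    have h10 : r * b x ≤ ((1 - x) ^ (p - 2) * κ) * b x := by
      calc r * b x ≤ _ := h4
        _ = (1 - x) ^ (p - 2) * (1 - x) ^ 2 := h9
        _ ≤ (1 - x) ^ (p - 2) * (κ * b x) := by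
          gcongr
        _ = _ := by ring
    exact le_of_mul_le_mul_right h10 h8
  have h4 := ge_of_tendsto ht h3
  have : 0 < r / κ := div_pos hr0 hκ0
  linarith

lemma sInf_pos (hb : IsLeftDegenerate c x₁ μ b b') : 0 < sInf (b '' Icc c x₁) := by
  have hsub : Icc c x₁ ⊆ Ico c 1 := fun x hx => ⟨hx.1, hx.2.trans_lt hb.mem.2⟩
  obtain ⟨x, hx, h⟩ := isCompact_Icc.exists_sInf_image_eq ⟨c, le_rfl, hb.mem.1⟩
    (hb.continuousOn.mono hsub)
  rw [h]
  exact hb.pos x (hsub hx)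

lemma sInf_le (hb : IsLeftDegenerate c x₁ μ b b') {x : ℝ} (hx : x ∈ Icc c x₁) :
    sInf (b '' Icc c x₁) ≤ b x := by
  have hsub : Icc c x₁ ⊆ Ico c 1 := fun x hx => ⟨hx.1, hx.2.trans_lt hb.mem.2⟩
  exact csInf_le (isCompact_Icc.image_of_continuousOn (hb.continuousOn.mono hsub)).bddBelow
    (mem_image_of_mem _ hx)

lemma sq_le (hb : IsLeftDegenerate c x₁ μ b b') {κ : ℝ}
    (h₁ : (1 - c) ^ μ / sInf (b '' Icc c x₁) ≤ κ) (h₂ : (1 - x₁) ^ μ / b x₁ ≤ κ) {x : ℝ}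
    (hx : x ∈ Ico c 1) : (1 - x) ^ 2 ≤ κ * b x := by
  have h3 : 0 < 1 - x := by linarith [hx.2]
  have hp := hb.pos x hx
  have h4 : (1 - x) ^ 2 ≤ (1 - x) ^ μ := by
    rw [← Real.rpow_natCast]
    exact Real.rpow_le_rpow_of_exponent_ge h3 (by linarith [hx.1, hb.nonneg])
      (by simpa using hb.mu_le_two)
  refine h4.trans ?_
  rw [← div_le_iff₀ hp]
  rcases le_total x x₁ with h | h
  · refine le_trans ?_ h₁
    have h5 := hb.sInf_pos
    have h6 := hb.sInf_le ⟨hx.1, h⟩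
    have h7 : (1 - x) ^ μ ≤ (1 - c) ^ μ :=
      Real.rpow_le_rpow h3.le (by linarith [hx.1]) hb.mu_pos.le
    exact div_le_div₀ (h3.le.trans (by linarith [hx.1]) |> fun h => Real.rpow_nonneg h _) h7 h5 h6
  · exact (hb.antitoneOn ⟨le_rfl, hb.mem.2⟩ ⟨h, hx.2⟩ h).trans h₂

/-- The bound for `∫ (1 - x) / b` that gives the Poincaré constant `D_a`. -/
lemma integral_le (hb : IsLeftDegenerate c x₁ μ b b') (hμ : μ < 2) {β : ℝ} (hβ : β ∈ Ico c 1) :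
    ∫ x in c..β, (1 - x) / b x ≤ (x₁ - c) * (2 - x₁ - c) / (2 * sInf (b '' Icc c x₁))
      + (1 - x₁) ^ 2 / (b x₁ * (2 - μ)) := by
  set m := sInf (b '' Icc c x₁) with hm
  have hm0 : 0 < m := hb.sInf_pos
  have hx1 := hb.mem
  have hbx1 := hb.pos x₁ hx1
  have hcont : ContinuousOn (fun x => (1 - x) / b x) (Ico c 1) :=
    (continuousOn_const.sub continuousOn_id).div hb.continuousOn fun x hx => (hb.pos x hx).ne'
  have hnn : ∀ x ∈ Ico c 1, 0 ≤ (1 - x) / b x := fun x hx =>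
    div_nonneg (by linarith [hx.2]) (hb.pos x hx).le
  have hI : ∀ p q, c ≤ p → p ≤ q → q < 1 →
      IntervalIntegrable (fun x => (1 - x) / b x) volume p q := fun p q h1 h2 h3 =>
    (hcont.mono fun x hx => ⟨h1.trans hx.1, hx.2.trans_lt h3⟩).intervalIntegrable_of_Icc h2
  set γ := max β x₁ with hγ
  have hγ1 : γ < 1 := max_lt hβ.2 hx1.2
  have h1 : ∫ x in c..β, (1 - x) / b x ≤ ∫ x in c..γ, (1 - x) / b x := by
    rw [← intervalIntegral.integral_add_adjacent_intervals (hI c β le_rfl hβ.1 hβ.2)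
      (hI β γ hβ.1 (le_max_left _ _) hγ1)]
    have : 0 ≤ ∫ x in β..γ, (1 - x) / b x :=
      intervalIntegral.integral_nonneg (le_max_left _ _) fun x hx =>
        hnn x ⟨hβ.1.trans hx.1, hx.2.trans_lt hγ1⟩
    linarith
  refine h1.trans ?_
  rw [← intervalIntegral.integral_add_adjacent_intervals (hI c x₁ le_rfl hx1.1 hx1.2)
    (hI x₁ γ hx1.1 (le_max_right _ _) hγ1)]
  refine add_le_add ?_ ?_
  · have h2 : IsPrimitiveOn (fun x => -(1 - x) ^ 2 / (2 * m)) (fun x => (1 - x) / m) c x₁ := by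
      refine IsPrimitiveOn.of_hasDerivWithinAt hx1.1 (fun x _ => ?_) (by fun_prop)
      have h3 := (((hasDerivAt_id x).const_sub 1).pow 2).neg.div_const (2 * m)
      refine HasDerivAt.hasDerivWithinAt (h3.congr_deriv ?_)
      simp only [id]; field_simp; norm_num; ring
    calc ∫ x in c..x₁, (1 - x) / b x ≤ ∫ x in c..x₁, (1 - x) / m := by
          refine intervalIntegral.integral_mono_on hx1.1 (hI c x₁ le_rfl hx1.1 hx1.2)
            h2.intervalIntegrable fun x hx => ?_
          exact div_le_div_of_nonneg_left (by linarith [hx.2, hx1.2]) hm0 (hb.sInf_le hx)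
      _ = _ := by rw [h2.integral_eq]; field_simp; ring
  · have h2 : IsPrimitiveOn (fun x => -(1 - x) ^ (2 - μ) / (2 - μ)) (fun x => (1 - x) ^ (1 - μ))
        x₁ γ := by
      refine IsPrimitiveOn.of_hasDerivWithinAt (le_max_right _ _) (fun x hx => ?_) ?_
      · have h4 : 0 < 1 - x := by linarith [hx.2]
        have h3 : HasDerivAt (fun x : ℝ => (1 - x) ^ (2 - μ))
            (-1 * (2 - μ) * (1 - x) ^ (2 - μ - 1)) x :=
          ((hasDerivAt_id x).const_sub 1).rpow_const (Or.inl h4.ne')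
        refine HasDerivAt.hasDerivWithinAt ((h3.neg.div_const (2 - μ)).congr_deriv ?_)
        have h5 : 2 - μ ≠ 0 := by linarith
        have h6 : 2 - μ - 1 = 1 - μ := by ring
        rw [h6]; field_simp
      · exact (continuousOn_const.sub continuousOn_id).rpow_const
          fun x hx => Or.inl (sub_pos.2 (hx.2.trans_lt hγ1)).ne'
    calc ∫ x in x₁..γ, (1 - x) / b x
        ≤ ∫ x in x₁..γ, (1 - x₁) ^ μ / b x₁ * (1 - x) ^ (1 - μ) := by
          refine intervalIntegral.integral_mono_on (le_max_right _ _)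
            (hI x₁ γ hx1.1 (le_max_right _ _) hγ1)
            (h2.intervalIntegrable.const_mul _) fun x hx => ?_
          have h4 : 0 < 1 - x := by linarith [hx.2]
          have h3 := hb.antitoneOn ⟨le_rfl, hb.mem.2⟩ ⟨hx.1, hx.2.trans_lt hγ1⟩ hx.1
          have h5 : (1 - x) / b x = (1 - x) ^ μ / b x * (1 - x) ^ (1 - μ) := by
            rw [div_mul_eq_mul_div, ← Real.rpow_add h4]; norm_num
          rw [h5]
          exact mul_le_mul_of_nonneg_right h3 (Real.rpow_nonneg h4.le _)
      _ = (1 - x₁) ^ μ / b x₁ * (((1 - x₁) ^ (2 - μ) - (1 - γ) ^ (2 - μ)) / (2 - μ)) := by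
          rw [intervalIntegral.integral_const_mul, h2.integral_eq]; ring
      _ ≤ (1 - x₁) ^ μ / b x₁ * ((1 - x₁) ^ (2 - μ) / (2 - μ)) := by
          have h4 : 0 < 1 - x₁ := by linarith [hx1.2]
          have h5 := Real.rpow_nonneg h4.le μ
          have h6 := Real.rpow_nonneg (show 0 ≤ 1 - γ by linarith) (2 - μ)
          have h7 : 0 < 2 - μ := by linarith
          gcongr
          linarith
      _ = _ := by
          have h4 : 0 < 1 - x₁ := by linarith [hx1.2]
          have h5 : (1 - x₁) ^ μ * (1 - x₁) ^ (2 - μ) = (1 - x₁) ^ 2 := by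
            rw [← Real.rpow_add h4, ← Real.rpow_natCast]; norm_num
          rw [div_mul_div_comm, h5]

end IsLeftDegenerate

namespace IsDegenerateWeight

variable {c d x₁ x₂ : ℝ} {a : ℝ → ℝ}

lemma lt_one (ha : IsDegenerateWeight c d a x₁ x₂) : c < 1 := ha.mem_left.1.trans_lt ha.mem_left.2

lemma one_lt (ha : IsDegenerateWeight c d a x₁ x₂) : 1 < d := ha.mem_right.1.trans_le ha.mem_right.2

lemma lt (ha : IsDegenerateWeight c d a x₁ x₂) : c < d := ha.lt_one.trans ha.one_lt

lemma hasDerivWithinAt (ha : IsDegenerateWeight c d a x₁ x₂) {x : ℝ} (hx : x ∈ Icc c d)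
    (h1 : x ≠ 1) : HasDerivWithinAt a (slope c d a x) (Icc c d) x := by
  have h2 : DifferentiableWithinAt ℝ a (Icc c d \ {1}) x :=
    (ha.contDiff.differentiableOn (by simp)) x ⟨hx, h1⟩
  have h3 : DifferentiableWithinAt ℝ a (Icc c d) x := by
    rwa [sdiff_eq, differentiableWithinAt_inter (isOpen_compl_singleton.mem_nhds h1)] at h2
  exact h3.hasDerivWithinAt

lemma continuousOn_slope (ha : IsDegenerateWeight c d a x₁ x₂) :
    ContinuousOn (slope c d a) (Icc c d \ {1}) := by
  have hu : UniqueDiffOn ℝ (Icc c d \ {1}) :=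
    (uniqueDiffOn_Icc ha.lt).inter isOpen_compl_singleton
  refine (ha.contDiff.continuousOn_derivWithin hu (by simp)).congr fun x hx => ?_
  exact (derivWithin_inter (isOpen_compl_singleton.mem_nhds hx.2)).symm

/-- The condition `1 / (√a)' ∈ L^∞` in pointwise form. -/
lemma exists_sqrt_le (ha : IsDegenerateWeight c d a x₁ x₂) :
    ∃ δ, 0 < δ ∧ ∀ x ∈ Ioo c d \ {1}, δ * √(a x) ≤ |slope c d a x| := by
  obtain ⟨M, hM⟩ : ∃ M, ∀ᵐ x ∂volume.restrict (Ioo c d), ‖(deriv (fun x => √(a x)) x)⁻¹‖ ≤ M := by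
    have h1 := ha.inv_sqrt_deriv_bounded.eLpNorm_lt_top
    rw [eLpNorm_exponent_top] at h1
    refine ⟨(eLpNormEssSup (fun x => (deriv (fun x => √(a x)) x)⁻¹)
      (volume.restrict (Ioo c d))).toReal, ?_⟩
    filter_upwards [ae_le_eLpNormEssSup (f := fun x => (deriv (fun x => √(a x)) x)⁻¹)
      (μ := volume.restrict (Ioo c d))] with x hx
    rw [← toReal_enorm]
    exact ENNReal.toReal_mono h1.ne hx
  have hM0 : 0 < max M 1 := lt_max_of_lt_right one_pos
  refine ⟨2 / max M 1, by positivity, ?_⟩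
  have hopen : IsOpen (Ioo c d \ {1}) := isOpen_Ioo.sdiff isClosed_singleton
  have hsub : Ioo c d \ {1} ⊆ Icc c d \ {1} := sdiff_subset_sdiff_left Ioo_subset_Icc_self
  have hae : (fun x => max (2 / max M 1 * √(a x) - |slope c d a x|) 0)
      =ᵐ[volume.restrict (Ioo c d \ {1})] fun _ => 0 := by
    have hle : volume.restrict (Ioo c d \ {1}) ≤ volume.restrict (Ioo c d) :=
      Measure.restrict_mono sdiff_subset le_rfl
    filter_upwards [ae_mono hle hM, ae_mono hle ha.sqrt_deriv_ne_zero,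
      ae_restrict_mem hopen.measurableSet] with x h1 h2 hx
    have hp := ha.pos x (hsub hx)
    have h3 : HasDerivAt (fun x => √(a x)) (slope c d a x / (2 * √(a x))) x :=
      ((ha.hasDerivWithinAt (hsub hx).1 hx.2).hasDerivAt
        (Icc_mem_nhds hx.1.1 hx.1.2)).sqrt hp.ne'
    rw [h3.deriv] at h1 h2
    have h4 : 0 < √(a x) := Real.sqrt_pos.2 hp
    have h5 : slope c d a x ≠ 0 := fun h => h2 (by simp [h])
    have h6 : 0 < |slope c d a x| := abs_pos.2 h5
    rw [norm_inv, Real.norm_eq_abs, abs_div, abs_of_pos (by positivity : 0 < 2 * √(a x)),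
      inv_div, div_le_iff₀ h6] at h1
    refine max_eq_right ?_
    have h7 : 2 * √(a x) ≤ max M 1 * |slope c d a x| :=
      h1.trans (by gcongr; exact le_max_left _ _)
    have h8 : 2 / max M 1 * √(a x) ≤ |slope c d a x| := by
      rw [div_mul_eq_mul_div, div_le_iff₀ hM0, mul_comm |slope c d a x|]; exact h7
    linarith
  have h1 := Measure.eqOn_open_of_ae_eq hae hopen (by
    have h2 := (ha.continuousOn_slope.mono hsub).abs
    have h3 := (ha.cont.mono (hsub.trans sdiff_subset)).sqrt
    exact ContinuousOn.sup ((h3.const_mul _).sub h2) continuousOn_const) continuousOn_const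
  intro x hx
  have h2 := h1 hx
  have h3 := le_max_left (2 / max M 1 * √(a x) - |slope c d a x|) 0
  simp only at h2
  rw [h2] at h3
  linarith

lemma derivWithin_log (ha : IsDegenerateWeight c d a x₁ x₂) {x : ℝ} (hx : x ∈ Icc c d)
    (h1 : x ≠ 1) :
    derivWithin (fun s => Real.log (a s)) (Icc c d) x = slope c d a x / a x :=
  ((ha.hasDerivWithinAt hx h1).log (ha.pos x ⟨hx, h1⟩).ne').derivWithin
    (uniqueDiffOn_Icc ha.lt x hx)

lemma isLeftDegenerate_left (ha : IsDegenerateWeight c d a x₁ x₂) (hc0 : 0 ≤ c)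
    (hleft : ∀ x ∈ Icc c x₁,
      derivWithin (fun s => Real.log ((1 - s) ^ mu1 c d a x₁)) (Icc c d) x
        ≤ derivWithin (fun s => Real.log (a s)) (Icc c d) x) :
    IsLeftDegenerate c x₁ (mu1 c d a x₁) a (slope c d a) := by
  have hd1 := ha.one_lt
  have hsub : ∀ x ∈ Ico c 1, x ∈ Icc c d \ {1} := fun x hx =>
    ⟨⟨hx.1, hx.2.le.trans hd1.le⟩, hx.2.ne⟩
  refine ⟨hc0, ha.mem_left, fun x hx => ha.pos x (hsub x hx), fun x hx => ?_,
    ha.continuousOn_slope.mono hsub, fun x hx => ?_, fun x hx => ?_, ha.lim_left, ha.mu1_pos,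
    fun x hx => ?_, ?_⟩
  · exact (ha.hasDerivWithinAt (hsub x hx).1 (hsub x hx).2).mono fun x hx => (hsub x hx).1
  · have hx' : x ∈ Ico c 1 := ⟨ha.mem_left.1.trans hx.1.le, hx.2⟩
    have h1 := (ha.hasDerivWithinAt (hsub x hx').1 (hsub x hx').2).hasDerivAt
      (Icc_mem_nhds (ha.mem_left.1.trans_lt hx.1) (hx.2.trans hd1))
    have h2 := ha.antitone_left.derivWithin_nonpos (x := x)
    rwa [h1.hasDerivWithinAt.derivWithin (isOpen_Ioo.uniqueDiffWithinAt hx)] at h2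
  · exact le_csSup ha.bdd_left (mem_image_of_mem _ hx)
  · have hx' : x ∈ Ico c 1 := ⟨hx.1, hx.2.trans_lt ha.mem_left.2⟩
    have h1 := hleft x hx
    have h2 := (hsub x hx').1
    have h3 : 0 < 1 - x := by linarith [hx'.2]
    have hp := ha.pos x (hsub x hx')
    have h4 : HasDerivAt (fun s : ℝ => Real.log ((1 - s) ^ mu1 c d a x₁))
        (mu1 c d a x₁ * (-1 / (1 - x))) x := by
      refine ((((hasDerivAt_id x).const_sub 1).log h3.ne').const_mul _).congr_of_eventuallyEq ?_
      filter_upwards [Iio_mem_nhds hx'.2] with s hs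
      rw [Real.log_rpow (by simp only [mem_Iio] at hs; linarith)]; rfl
    rw [ha.derivWithin_log h2 hx'.2.ne, h4.hasDerivWithinAt.derivWithin
      (uniqueDiffOn_Icc ha.lt x h2), mul_div_assoc', div_le_div_iff₀ h3 hp] at h1
    linarith
  · obtain ⟨δ, hδ, h⟩ := ha.exists_sqrt_le
    exact ⟨δ, hδ, fun x hx => h x ⟨⟨hx.1, hx.2.trans hd1⟩, hx.2.ne⟩⟩

lemma isLeftDegenerate_right (ha : IsDegenerateWeight c d a x₁ x₂) (hd2 : d ≤ 2)
    (hright : ∀ x ∈ Icc x₂ d,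
      derivWithin (fun s => Real.log (a s)) (Icc c d) x
        ≤ derivWithin (fun s => Real.log ((s - 1) ^ mu2 c d a x₂)) (Icc c d) x) :
    IsLeftDegenerate (2 - d) (2 - x₂) (mu2 c d a x₂) (fun x => a (2 - x))
      (fun x => -slope c d a (2 - x)) := by
  have hc1 := ha.lt_one
  have hsub : ∀ x ∈ Ico (2 - d) 1, 2 - x ∈ Icc c d \ {1} := fun x hx =>
    ⟨⟨by linarith [hx.2], by linarith [hx.1]⟩, fun h => by
      simp only [mem_singleton_iff] at h; linarith [hx.2]⟩
  have hx2 := ha.mem_right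
  have hrefl : ∀ x : ℝ, HasDerivAt (fun x : ℝ => 2 - x) (-1) x := fun x =>
    (hasDerivAt_id x).const_sub 2
  refine ⟨by linarith, ⟨by linarith [hx2.2], by linarith [hx2.1]⟩,
    fun x hx => ha.pos _ (hsub x hx), fun x hx => ?_, ?_, fun x hx => ?_, fun x hx => ?_, ?_,
    ha.mu2_pos, fun x hx => ?_, ?_⟩
  · refine ((ha.hasDerivWithinAt (hsub x hx).1 (hsub x hx).2).comp x
      (hrefl x).hasDerivWithinAt fun x hx => (hsub x hx).1).congr_deriv (by ring)
  · exact (ha.continuousOn_slope.comp (by fun_prop) hsub).neg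
  · have hx' : x ∈ Ico (2 - d) 1 := ⟨by linarith [hx.1, hx2.2], hx.2⟩
    have hx3 : 2 - x ∈ Ioo 1 x₂ := ⟨by linarith [hx.2], by linarith [hx.1]⟩
    have h1 := (ha.hasDerivWithinAt (hsub x hx').1 (hsub x hx').2).hasDerivAt
      (Icc_mem_nhds (hc1.trans hx3.1) (hx3.2.trans_le hx2.2))
    have h2 := ha.monotone_right.derivWithin_nonneg (x := 2 - x)
    rw [h1.hasDerivWithinAt.derivWithin (isOpen_Ioo.uniqueDiffWithinAt hx3)] at h2
    linarith
  · rw [abs_neg, show 1 - x = (2 - x) - 1 by ring]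
    exact le_csSup ha.bdd_right (mem_image_of_mem (fun x => (x - 1) * |slope c d a x| / a x)
      ⟨by linarith [hx.2], by linarith [hx.1]⟩)
  · have h1 : Tendsto (fun x : ℝ => 2 - x) (𝓝[<] 1) (𝓝[>] 1) := by
      refine tendsto_nhdsWithin_iff.2 ⟨?_, ?_⟩
      · have h2 : Continuous fun x : ℝ => 2 - x := by fun_prop
        have h3 := h2.tendsto 1
        rw [show (2 : ℝ) - 1 = 1 by norm_num] at h3
        exact h3.mono_left nhdsWithin_le_nhds
      · filter_upwards [self_mem_nhdsWithin] with x hx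
        simp only [mem_Iio] at hx
        simp only [mem_Ioi]; linarith
    refine (ha.lim_right.comp h1).congr fun x => ?_
    simp only [Function.comp, abs_neg]
    rw [show 1 - x = (2 - x) - 1 by ring]
  · have hx' : x ∈ Ico (2 - d) 1 := ⟨hx.1, by linarith [hx.2, hx2.1]⟩
    have h1 := hright (2 - x) ⟨by linarith [hx.2], by linarith [hx.1]⟩
    have h2 := (hsub x hx').1
    have h3 : 0 < (2 - x) - 1 := by linarith [hx'.2]
    have hp := ha.pos _ (hsub x hx')
    have h4 : HasDerivAt (fun s : ℝ => Real.log ((s - 1) ^ mu2 c d a x₂))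
        (mu2 c d a x₂ * (1 / ((2 - x) - 1))) (2 - x) := by
      refine ((((hasDerivAt_id (2 - x)).sub_const 1).log h3.ne').const_mul _).congr_of_eventuallyEq ?_
      filter_upwards [Ioi_mem_nhds (show 1 < 2 - x by linarith)] with s hs
      rw [Real.log_rpow (by simp only [mem_Ioi] at hs; linarith)]; rfl
    rw [ha.derivWithin_log h2 (hsub x hx').2, h4.hasDerivWithinAt.derivWithin
      (uniqueDiffOn_Icc ha.lt _ h2), mul_div_assoc', div_le_div_iff₀ hp h3] at h1
    nlinarith
  · obtain ⟨δ, hδ, h⟩ := ha.exists_sqrt_le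
    refine ⟨δ, hδ, fun x hx => ?_⟩
    rw [abs_neg]
    exact h _ ⟨⟨by linarith [hx.2], by linarith [hx.1]⟩, (hsub x (Ioo_subset_Ico_self hx)).2⟩

end IsDegenerateWeight

lemma image_reflect (a : ℝ → ℝ) (p q : ℝ) :
    (fun x => a (2 - x)) '' Icc (2 - q) (2 - p) = a '' Icc p q := by
  have : (fun x => a (2 - x)) = a ∘ (fun x => 2 - x) := rfl
  rw [this, image_comp, image_const_sub_Icc]
  simp

/-! ### Reflection in the degenerate point -/

lemma measurePreserving_reflect (α β : ℝ) :
    MeasurePreserving (fun x : ℝ => 2 - x) (volume.restrict (Ioo (2 - β) (2 - α)))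
      (volume.restrict (Ioo α β)) := by
  have h := (Measure.measurePreserving_sub_left (volume : Measure ℝ) 2).restrict_preimage
    (measurableSet_Ioo (a := α) (b := β))
  simpa using h

lemma integrableOn_reflect {f : ℝ → ℝ} {α β : ℝ} (hf : IntegrableOn f (Ioo α β)) :
    IntegrableOn (fun x => f (2 - x)) (Ioo (2 - β) (2 - α)) :=
  (measurePreserving_reflect α β).integrable_comp_of_integrable hf

lemma ae_reflect {p : ℝ → Prop} {α β : ℝ} (h : ∀ᵐ x ∂volume.restrict (Ioo α β), p x) :
    ∀ᵐ x ∂volume.restrict (Ioo (2 - β) (2 - α)), p (2 - x) :=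
  (measurePreserving_reflect α β).quasiMeasurePreserving.ae h

lemma setIntegral_reflect (f : ℝ → ℝ) (α β : ℝ) :
    ∫ x in Ioo (2 - β) (2 - α), f (2 - x) = ∫ x in Ioo α β, f x :=
  (measurePreserving_reflect α β).integral_comp
    (Homeomorph.subLeft (2 : ℝ)).measurableEmbedding f

lemma IsPrimitiveOn.reflect {F f : ℝ → ℝ} {α β : ℝ} (h : IsPrimitiveOn F f α β) :
    IsPrimitiveOn (fun x => F (2 - x)) (fun x => -f (2 - x)) (2 - β) (2 - α) where
  le := by linarith [h.le]
  integrable := (integrableOn_reflect h.integrable).neg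
  eq x hx := by
    have hx' : 2 - x ∈ Icc α β := ⟨by linarith [hx.2], by linarith [hx.1]⟩
    rw [intervalIntegral.integral_neg, intervalIntegral.integral_comp_sub_left (fun x => f x) 2,
      sub_sub_cancel, h.eq _ hx', h.eq β ⟨h.le, le_rfl⟩]
    have h1 := intervalIntegral.integral_add_adjacent_intervals
      (h.mono hx').intervalIntegrable
      (h.intervalIntegrable.mono_set (show uIcc (2 - x) β ⊆ uIcc α β by
        rw [uIcc_of_le hx'.2, uIcc_of_le h.le]; exact Icc_subset_Icc_left hx'.1))
    linarith

/-- Integrals over `Ω` as integrals over two intervals with right end `1`. -/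
lemma setIntegral_split {c d : ℝ} (hc : c < 1) (hd : 1 < d) {f : ℝ → ℝ}
    (hf : IntegrableOn f (Ioo c d)) :
    ∫ x in Ioo c d, f x = (∫ x in Ioo c 1, f x) + ∫ x in Ioo (2 - d) 1, f (2 - x) := by
  have h1 : ∫ x in Ioo (2 - d) 1, f (2 - x) = ∫ x in Ioo 1 d, f x := by
    have := setIntegral_reflect f 1 d
    rwa [show (2 : ℝ) - 1 = 1 by norm_num] at this
  rw [h1, ← integral_Ioc_eq_integral_Ioo, ← integral_Ioc_eq_integral_Ioo,
    ← integral_Ioc_eq_integral_Ioo, ← intervalIntegral.integral_of_le hc.le,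
    ← intervalIntegral.integral_of_le hd.le, ← intervalIntegral.integral_of_le (hc.trans hd).le]
  refine (intervalIntegral.integral_add_adjacent_intervals ?_ ?_).symm
  · exact (intervalIntegrable_iff_integrableOn_Ioo_of_le hc.le).2
      (hf.mono_set (Ioo_subset_Ioo_right hd.le))
  · exact (intervalIntegrable_iff_integrableOn_Ioo_of_le hd.le).2
      (hf.mono_set (Ioo_subset_Ioo_left hc.le))

/-! ### The weighted `L²` space -/

namespace IsDegenerateWeight

variable {c d x₁ x₂ : ℝ} {a : ℝ → ℝ}

lemma ae_pos (ha : IsDegenerateWeight c d a x₁ x₂) :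
    ∀ᵐ x ∂volume.restrict (Ioo c d), 0 < a x := by
  have h1 : ∀ᵐ x ∂volume.restrict (Ioo c d), x ≠ 1 :=
    ae_restrict_of_ae (by simp [ae_iff, measure_singleton])
  filter_upwards [h1, ae_restrict_mem measurableSet_Ioo] with x hx1 hx2
  exact ha.pos x ⟨Ioo_subset_Icc_self hx2, hx1⟩

lemma aesm (ha : IsDegenerateWeight c d a x₁ x₂) :
    AEStronglyMeasurable a (volume.restrict (Ioo c d)) :=
  (ha.cont.mono Ioo_subset_Icc_self).aestronglyMeasurable measurableSet_Ioo

lemma aemeasurable_ofReal (ha : IsDegenerateWeight c d a x₁ x₂) :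
    AEMeasurable (fun x => ENNReal.ofReal (a x)) (volume.restrict (Ioo c d)) :=
  ha.aesm.aemeasurable.ennreal_ofReal

lemma absolutelyContinuous (ha : IsDegenerateWeight c d a x₁ x₂) :
    volume.restrict (Ioo c d) ≪ weightMeasure c d a := by
  refine withDensity_absolutelyContinuous' ha.aemeasurable_ofReal ?_
  filter_upwards [ha.ae_pos] with x hx
  exact (ENNReal.ofReal_pos.2 hx).ne'

lemma aesm_L2w (ha : IsDegenerateWeight c d a x₁ x₂) (p : L2w c d a) :
    AEStronglyMeasurable p (volume.restrict (Ioo c d)) :=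
  (Lp.aestronglyMeasurable p).mono_ac ha.absolutelyContinuous

lemma integral_weight (ha : IsDegenerateWeight c d a x₁ x₂) (f : ℝ → ℝ) :
    ∫ x, f x ∂weightMeasure c d a = ∫ x in Ioo c d, a x * f x := by
  rw [weightMeasure, integral_withDensity_eq_integral_toReal_smul₀ ha.aemeasurable_ofReal (by simp)]
  refine integral_congr_ae ?_
  filter_upwards [ha.ae_pos] with x hx
  rw [ENNReal.toReal_ofReal hx.le, smul_eq_mul]

lemma integrable_weight (ha : IsDegenerateWeight c d a x₁ x₂) {f : ℝ → ℝ} :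
    Integrable f (weightMeasure c d a) ↔ IntegrableOn (fun x => a x * f x) (Ioo c d) := by
  rw [weightMeasure, integrable_withDensity_iff_integrable_smul₀' ha.aemeasurable_ofReal (by simp)]
  refine integrable_congr ?_
  filter_upwards [ha.ae_pos] with x hx
  rw [ENNReal.toReal_ofReal hx.le, smul_eq_mul]

lemma inner_L2w (ha : IsDegenerateWeight c d a x₁ x₂) (p q : L2w c d a) :
    inner ℝ p q = ∫ x in Ioo c d, a x * p x * q x := by
  rw [L2.inner_def, ha.integral_weight]
  congr 1; ext x
  simp only [RCLike.inner_apply, conj_trivial]; ring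

lemma integrable_L2w (ha : IsDegenerateWeight c d a x₁ x₂) (p q : L2w c d a) :
    IntegrableOn (fun x => a x * p x * q x) (Ioo c d) := by
  have h := ha.integrable_weight.1 (L2.integrable_inner (𝕜 := ℝ) p q)
  refine h.congr (ae_of_all _ fun x => ?_)
  simp only [RCLike.inner_apply, conj_trivial]; ring

lemma norm_sq_L2w (ha : IsDegenerateWeight c d a x₁ x₂) (p : L2w c d a) :
    ‖p‖ ^ 2 = ∫ x in Ioo c d, a x * p x ^ 2 := by
  rw [← real_inner_self_eq_norm_sq, ha.inner_L2w]
  congr 1; ext x; ring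

lemma integrable_sq_L2w (ha : IsDegenerateWeight c d a x₁ x₂) (p : L2w c d a) :
    IntegrableOn (fun x => a x * p x ^ 2) (Ioo c d) :=
  (ha.integrable_L2w p p).congr (ae_of_all _ fun x => by ring)

end IsDegenerateWeight

lemma inner_L2 {c d : ℝ} (p q : L2 c d) : inner ℝ p q = ∫ x in Ioo c d, p x * q x := by
  rw [L2.inner_def]
  congr 1; ext x
  simp only [RCLike.inner_apply, conj_trivial]; ring

lemma integrable_L2 {c d : ℝ} (p q : L2 c d) : IntegrableOn (fun x => p x * q x) (Ioo c d) := by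
  refine (L2.integrable_inner (𝕜 := ℝ) p q).congr (ae_of_all _ fun x => ?_)
  simp only [RCLike.inner_apply, conj_trivial]; ring

lemma norm_sq_L2 {c d : ℝ} (p : L2 c d) : ‖p‖ ^ 2 = ∫ x in Ioo c d, p x ^ 2 := by
  rw [← real_inner_self_eq_norm_sq, inner_L2]
  congr 1; ext x; ring

lemma integrable_sq_L2 {c d : ℝ} (p : L2 c d) : IntegrableOn (fun x => p x ^ 2) (Ioo c d) :=
  (integrable_L2 p p).congr (ae_of_all _ fun x => by ring)

lemma integrableOn_L2 {c d : ℝ} (p : L2 c d) : IntegrableOn p (Ioo c d) :=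
  (Lp.memLp p).integrable (by norm_num)

lemma energy_eq {c d x₁ x₂ : ℝ} {a : ℝ → ℝ} (ha : IsDegenerateWeight c d a x₁ x₂)
    (U : State c d a) : energy c d a U = 1 / 2 * (‖U.2‖ ^ 2 + ‖U.1.2‖ ^ 2) := by
  rw [energy, integral_add (integrable_sq_L2 U.2) (ha.integrable_sq_L2w U.1.2), norm_sq_L2,
    ha.norm_sq_L2w]

/-! ### Elements of the weighted Sobolev space as primitives -/

section Representation

variable {c d x₁ x₂ : ℝ} {a : ℝ → ℝ}

lemma IsDegenerateWeight.integrableOn_of_notMem (ha : IsDegenerateWeight c d a x₁ x₂)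
    (p : L2w c d a) {α β : ℝ} (hαβ : α ≤ β) (hα : c ≤ α) (hβ : β ≤ d) (h1 : (1 : ℝ) ∉ Icc α β) :
    IntegrableOn p (Ioo α β) := by
  have hsub : Ioo α β ⊆ Ioo c d := Ioo_subset_Ioo hα hβ
  have hsub' : Icc α β ⊆ Icc c d \ {1} := fun x hx =>
    ⟨⟨hα.trans hx.1, hx.2.trans hβ⟩, fun h => h1 (by rwa [mem_singleton_iff.1 h] at hx)⟩
  obtain ⟨z, hz, hmin⟩ := isCompact_Icc.exists_isMinOn ⟨α, le_rfl, hαβ⟩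
    (ha.cont.mono (hsub'.trans sdiff_subset))
  have hm : 0 < a z := ha.pos z (hsub' hz)
  have hmeas : AEStronglyMeasurable p (volume.restrict (Ioo α β)) :=
    (ha.aesm_L2w p).mono_measure (Measure.restrict_mono hsub le_rfl)
  have h2 : IntegrableOn (fun x => p x ^ 2) (Ioo α β) := by
    refine Integrable.mono' (((ha.integrable_sq_L2w p).mono_set hsub).const_mul (a z)⁻¹)
      (hmeas.pow 2) ?_
    filter_upwards [ae_restrict_mem measurableSet_Ioo] with x hx
    rw [Real.norm_eq_abs, abs_of_nonneg (sq_nonneg _), ← mul_assoc]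
    have h3 : a z ≤ a x := hmin (Ioo_subset_Icc_self hx)
    have h4 : 1 ≤ (a z)⁻¹ * a x := by
      rw [← div_eq_inv_mul, one_le_div hm]; exact h3
    exact le_mul_of_one_le_left (sq_nonneg _) h4
  have h3 := integrable_mul_of_sq hmeas (aestronglyMeasurable_const (b := (1 : ℝ))) h2 (by simp)
  simp only [mul_one] at h3
  exact h3

/-- The continuous representative of an element of `W¹_a` is a primitive of its derivative. -/
lemma exists_eq_add_integral_of_mem_W1 {q : L2 c d × L2w c d a} (hq : q ∈ W1 c d a) {y : ℝ → ℝ}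
    (hy : IsContRep c d q.1 y) {α β : ℝ} (hαβ : α < β) (hα : c ≤ α) (hβ : β ≤ d)
    (hi : IntegrableOn q.2 (Ioo α β)) (hdom : Ioo α β ⊆ distDomain c d a) :
    ∃ C, ∀ x ∈ Icc α β \ {1}, y x = C + ∫ s in α..x, q.2 s := by
  have hsub : Ioo α β ⊆ Ioo c d := Ioo_subset_Ioo hα hβ
  have hres : ∀ φ : ℝ → ℝ, tsupport φ ⊆ Ioo α β → ∀ k : ℝ → ℝ,
      ∫ x in Ioo c d, k x * φ x = ∫ x in Ioo α β, k x * φ x := by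
    intro φ hφ k
    refine setIntegral_eq_of_subset_of_forall_sdiff_eq_zero measurableSet_Ioo hsub fun x hx => ?_
    have : φ x = 0 := by
      by_contra h
      exact hx.2 (hφ (subset_tsupport _ h))
    simp [this]
  obtain ⟨C, hC⟩ := exists_ae_eq_add_integral hαβ ((integrableOn_L2 q.1).mono_set hsub) hi
    (fun φ h1 h2 h3 => by
      have h4 := hq.2 φ h1 h2 (h3.trans hdom)
      rw [hres (deriv φ) (tsupport_deriv_subset.trans h3), hres φ h3] at h4
      exact h4)
  refine ⟨C, ?_⟩
  have hP : IsPrimitiveOn (fun x => C + ∫ s in α..x, q.2 s) q.2 α β :=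
    ⟨hαβ.le, hi, fun x hx => by simp⟩
  have hopen : IsOpen (Ioo α β \ {1}) := isOpen_Ioo.sdiff isClosed_singleton
  have hIcc : Icc α β \ {1} ⊆ Icc c d \ {1} := sdiff_subset_sdiff_left (Icc_subset_Icc hα hβ)
  have hae : y =ᵐ[volume.restrict (Ioo α β \ {1})] fun x => C + ∫ s in α..x, q.2 s := by
    have h1 := ae_mono (Measure.restrict_mono (sdiff_subset (t := {1})) le_rfl) hC
    have h2 := ae_mono (Measure.restrict_mono ((sdiff_subset (t := {(1 : ℝ)})).trans hsub) le_rfl) hy.2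
    filter_upwards [h1, h2] with x hx1 hx2
    rw [← hx2, hx1]
  have hIoo : Ioo α β \ {1} ⊆ Icc α β \ {1} := sdiff_subset_sdiff_left Ioo_subset_Icc_self
  have heq := Measure.eqOn_open_of_ae_eq hae hopen (hy.1.mono (hIoo.trans hIcc))
    (hP.continuousOn.mono (hIoo.trans sdiff_subset))
  refine heq.of_subset_closure (hy.1.mono hIcc) (hP.continuousOn.mono sdiff_subset) hIoo ?_
  have h1 : Ioo α β ⊆ closure (Ioo α β \ {1}) :=
    (dense_compl_singleton (1 : ℝ)).open_subset_closure_inter isOpen_Ioo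
  have h2 := closure_minimal h1 isClosed_closure
  rw [closure_Ioo hαβ.ne] at h2
  exact sdiff_subset.trans h2

lemma Ioo_subset_distDomain {α β : ℝ} (hα : c ≤ α) (hβ : β ≤ d) (h1 : (1 : ℝ) ∉ Ioo α β) :
    Ioo α β ⊆ distDomain c d a := by
  intro x hx
  have h2 : x ∈ Ioo c d := Ioo_subset_Ioo hα hβ hx
  unfold distDomain
  split_ifs
  · exact h2
  · exact ⟨h2, fun h => h1 (by rwa [mem_singleton_iff.1 h] at hx)⟩

lemma IsDegenerateWeight.isPrimitiveOn_of_mem_W1 (ha : IsDegenerateWeight c d a x₁ x₂)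
    {q : L2 c d × L2w c d a} (hq : q ∈ W1 c d a) {y : ℝ → ℝ} (hy : IsContRep c d q.1 y) {α β : ℝ}
    (hαβ : α ≤ β) (hα : c ≤ α) (hβ : β ≤ d) (h1 : (1 : ℝ) ∉ Icc α β) :
    IsPrimitiveOn y q.2 α β := by
  have hi := ha.integrableOn_of_notMem q.2 hαβ hα hβ h1
  refine ⟨hαβ, hi, ?_⟩
  rcases hαβ.eq_or_lt with rfl | hlt
  · intro x hx
    rw [Icc_self, mem_singleton_iff] at hx
    simp [hx]
  · obtain ⟨C, hC⟩ := exists_eq_add_integral_of_mem_W1 hq hy hlt hα hβ hi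
      (Ioo_subset_distDomain hα hβ fun h => h1 (Ioo_subset_Icc_self h))
    have hmem : ∀ x ∈ Icc α β, x ∈ Icc α β \ {1} := fun x hx =>
      ⟨hx, fun h => h1 (by rwa [mem_singleton_iff.1 h] at hx)⟩
    intro x hx
    have h2 := hC α (hmem α ⟨le_rfl, hαβ⟩)
    rw [intervalIntegral.integral_same, add_zero] at h2
    rw [hC x (hmem x hx), h2]

/-- If `1/a` is integrable, an element of `W¹_a` that vanishes at the end points is a primitive of
its derivative across the degenerate point. -/
lemma IsDegenerateWeight.exists_isPrimitiveOn_of_weaklyDegenerate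
    (ha : IsDegenerateWeight c d a x₁ x₂) (hw : WeaklyDegenerate c d a)
    {q : L2 c d × L2w c d a} (hq : q ∈ W10 c d a) :
    ∃ y, q.1 =ᵐ[volume.restrict (Ioo c d)] y ∧ IsPrimitiveOn y q.2 c d ∧ y c = 0 ∧ y d = 0 := by
  obtain ⟨hq1, y, hy, hyc, hyd⟩ := hq
  have hcd := ha.lt
  have hi := hq1.1 hw
  obtain ⟨C, hC⟩ := exists_eq_add_integral_of_mem_W1 hq1 hy hcd le_rfl le_rfl hi
    (by unfold distDomain; rw [if_pos hw])
  have h2 := hC c ⟨⟨le_rfl, hcd.le⟩, ha.lt_one.ne⟩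
  rw [intervalIntegral.integral_same, add_zero, hyc] at h2
  have h3 := hC d ⟨⟨hcd.le, le_rfl⟩, ha.one_lt.ne'⟩
  rw [hyd, ← h2, zero_add] at h3
  refine ⟨fun x => ∫ s in c..x, q.2 s, ?_, ⟨hcd.le, hi, fun x hx => by simp⟩, by simp, h3.symm⟩
  have h1 : ∀ᵐ x ∂volume.restrict (Ioo c d), x ≠ 1 :=
    ae_restrict_of_ae (by simp [ae_iff, measure_singleton])
  filter_upwards [hy.2, h1, ae_restrict_mem measurableSet_Ioo] with x hx1 hx2 hx3
  rw [hx1, hC x ⟨Ioo_subset_Icc_self hx3, hx2⟩, ← h2, zero_add]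

lemma ae_restrict_left {p : ℝ → Prop} (hd : 1 < d) (h : ∀ᵐ x ∂volume.restrict (Ioo c d), p x) :
    ∀ᵐ x ∂volume.restrict (Ioo c 1), p x :=
  ae_mono (Measure.restrict_mono (Ioo_subset_Ioo_right hd.le) le_rfl) h

lemma ae_restrict_right {p : ℝ → Prop} (hc : c < 1) (h : ∀ᵐ x ∂volume.restrict (Ioo c d), p x) :
    ∀ᵐ x ∂volume.restrict (Ioo (2 - d) 1), p (2 - x) := by
  have h1 := ae_reflect (ae_mono (Measure.restrict_mono
    (Ioo_subset_Ioo_left (b := d) hc.le) le_rfl) h)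
  rwa [show (2 : ℝ) - 1 = 1 by norm_num] at h1

lemma integrableOn_right {f : ℝ → ℝ} (hc : c < 1) (hf : IntegrableOn f (Ioo c d)) :
    IntegrableOn (fun x => f (2 - x)) (Ioo (2 - d) 1) := by
  have h1 := integrableOn_reflect (hf.mono_set (Ioo_subset_Ioo_left (b := d) hc.le))
  rwa [show (2 : ℝ) - 1 = 1 by norm_num] at h1

lemma aesm_right {f : ℝ → ℝ} (hc : c < 1)
    (hf : AEStronglyMeasurable f (volume.restrict (Ioo c d))) :
    AEStronglyMeasurable (fun x => f (2 - x)) (volume.restrict (Ioo (2 - d) 1)) := by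
  have h1 := (hf.mono_measure (Measure.restrict_mono (Ioo_subset_Ioo_left (b := d) hc.le)
    le_rfl)).comp_measurePreserving (measurePreserving_reflect 1 d)
  rwa [show (2 : ℝ) - 1 = 1 by norm_num] at h1

lemma IsDegenerateWeight.isLeftTrace_left (ha : IsDegenerateWeight c d a x₁ x₂)
    {q : L2 c d × L2w c d a} (hq : q ∈ W1 c d a) {y : ℝ → ℝ} (hy : IsContRep c d q.1 y)
    (hyc : y c = 0) : IsLeftTrace c a q.2 y := by
  have hd1 := ha.one_lt
  have hsub : Ioo c 1 ⊆ Ioo c d := Ioo_subset_Ioo_right hd1.le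
  refine ⟨(ha.aesm_L2w q.2).mono_measure (Measure.restrict_mono hsub le_rfl),
    (ha.integrable_sq_L2w q.2).mono_set hsub, ?_, fun β hβ => ?_, hyc⟩
  · refine ((integrable_sq_L2 q.1).mono_set hsub).congr ?_
    filter_upwards [ae_restrict_left hd1 hy.2] with x hx
    rw [hx]
  · exact ha.isPrimitiveOn_of_mem_W1 hq hy hβ.1 le_rfl (hβ.2.le.trans hd1.le)
      fun h => hβ.2.not_ge h.2

lemma IsDegenerateWeight.isLeftTrace_right (ha : IsDegenerateWeight c d a x₁ x₂)
    {q : L2 c d × L2w c d a} (hq : q ∈ W1 c d a) {y : ℝ → ℝ} (hy : IsContRep c d q.1 y)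
    (hyd : y d = 0) :
    IsLeftTrace (2 - d) (fun x => a (2 - x)) (fun x => -q.2 (2 - x)) (fun x => y (2 - x)) := by
  have hc1 := ha.lt_one
  have hd1 := ha.one_lt
  refine ⟨(aesm_right hc1 (ha.aesm_L2w q.2)).neg, ?_, ?_, fun β hβ => ?_, ?_⟩
  · exact (integrableOn_right hc1 (ha.integrable_sq_L2w q.2)).congr
      (ae_of_all _ fun x => by ring)
  · refine (integrableOn_right hc1 (integrable_sq_L2 q.1)).congr ?_
    filter_upwards [ae_restrict_right hc1 hy.2] with x hx
    rw [hx]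
  · have h1 := (ha.isPrimitiveOn_of_mem_W1 hq hy (α := 2 - β) (β := d) (by linarith [hβ.1])
      (by linarith [hβ.2]) le_rfl fun h => by linarith [hβ.2, h.1]).reflect
    rwa [sub_sub_cancel] at h1
  · simp only [sub_sub_cancel]; exact hyd

lemma IsFlux.isPrimitiveOn {p : L2 c d × L2w c d a} {F : ℝ → ℝ} {f : L2 c d} (hcd : c ≤ d)
    (hF : IsFlux c d a p F f) : IsPrimitiveOn F f c d :=
  ⟨hcd, integrableOn_L2 f, hF.2⟩

lemma IsDegenerateWeight.isLeftFlux_left (ha : IsDegenerateWeight c d a x₁ x₂)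
    {p : L2 c d × L2w c d a} {F : ℝ → ℝ} {f : L2 c d} (hF : IsFlux c d a p F f) :
    IsLeftFlux c a p.2 F f := by
  have hd1 := ha.one_lt
  have hsub : Ioo c 1 ⊆ Ioo c d := Ioo_subset_Ioo_right hd1.le
  exact ⟨(Lp.aestronglyMeasurable f).mono_measure (Measure.restrict_mono hsub le_rfl),
    (integrable_sq_L2 f).mono_set hsub, (hF.isPrimitiveOn ha.lt.le).mono ⟨ha.lt_one.le, hd1.le⟩,
    ae_restrict_left hd1 hF.1⟩

lemma IsDegenerateWeight.isLeftFlux_right (ha : IsDegenerateWeight c d a x₁ x₂)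
    {p : L2 c d × L2w c d a} {F : ℝ → ℝ} {f : L2 c d} (hF : IsFlux c d a p F f) :
    IsLeftFlux (2 - d) (fun x => a (2 - x)) (fun x => -p.2 (2 - x)) (fun x => -F (2 - x))
      (fun x => f (2 - x)) := by
  have hc1 := ha.lt_one
  refine ⟨aesm_right hc1 (Lp.aestronglyMeasurable f), integrableOn_right hc1 (integrable_sq_L2 f),
    ?_, ?_⟩
  · have h1 := (hF.isPrimitiveOn ha.lt.le).reflect.neg.mono (x := 1)
      ⟨by linarith [ha.one_lt], by linarith [ha.lt_one]⟩
    simpa only [neg_neg] using h1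
  · filter_upwards [ae_restrict_right hc1 hF.1] with x hx
    rw [hx]; ring

end Representation

/-! ### Integral identities on the whole interval -/

section Static

variable {c d x₁ x₂ μ₁ μ₂ : ℝ} {a : ℝ → ℝ}

/-- The bound `(x - 1)² ≤ κ a` on each side of `1`, the right-hand side being reflected. -/
def IsQuadBound (c d : ℝ) (a : ℝ → ℝ) (κ : ℝ) : Prop :=
  (∀ x ∈ Ico c 1, (1 - x) ^ 2 ≤ κ * a x) ∧ ∀ x ∈ Ico (2 - d) 1, (1 - x) ^ 2 ≤ κ * a (2 - x)

lemma IsQuadBound.ae {κ : ℝ} (hκ : IsQuadBound c d a κ) :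
    ∀ᵐ x ∂volume.restrict (Ioo c d), (x - 1) ^ 2 ≤ κ * a x := by
  have h1 : ∀ᵐ x ∂volume.restrict (Ioo c d), x ≠ 1 :=
    ae_restrict_of_ae (by simp [ae_iff, measure_singleton])
  filter_upwards [h1, ae_restrict_mem measurableSet_Ioo] with x hx1 hx2
  rcases lt_or_gt_of_ne hx1 with h | h
  · have := hκ.1 x ⟨hx2.1.le, h⟩
    rwa [show (x - 1) ^ 2 = (1 - x) ^ 2 by ring]
  · have := hκ.2 (2 - x) ⟨by linarith [hx2.2], by linarith⟩
    rwa [sub_sub_cancel, show (1 - (2 - x)) ^ 2 = (x - 1) ^ 2 by ring] at this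

/-- Multiplication by `x - 1`, as an operator from `L²(Ω, a dx)` to `L²(Ω)`. -/
lemma IsDegenerateWeight.exists_multiplier (ha : IsDegenerateWeight c d a x₁ x₂) {κ : ℝ}
    (hκ0 : 0 ≤ κ) (hκ : IsQuadBound c d a κ) :
    ∃ T : L2w c d a →L[ℝ] L2 c d,
      (∀ p, T p =ᵐ[volume.restrict (Ioo c d)] fun x => (x - 1) * p x) ∧
      ∀ p, ‖T p‖ ≤ √κ * ‖p‖ := by
  have hle : ∀ p : L2w c d a, ∀ᵐ x ∂volume.restrict (Ioo c d),
      ((x - 1) * p x) ^ 2 ≤ κ * (a x * p x ^ 2) := by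
    intro p
    filter_upwards [hκ.ae] with x hx
    calc ((x - 1) * p x) ^ 2 = (x - 1) ^ 2 * p x ^ 2 := by ring
      _ ≤ κ * a x * p x ^ 2 := by gcongr
      _ = _ := by ring
  have hmeas : ∀ p : L2w c d a, AEStronglyMeasurable (fun x => (x - 1) * p x)
      (volume.restrict (Ioo c d)) := fun p => aesm_sub_one.mul (ha.aesm_L2w p)
  have hint : ∀ p : L2w c d a, Integrable (fun x => ((x - 1) * p x) ^ 2)
      (volume.restrict (Ioo c d)) := by
    intro p
    refine Integrable.mono' ((ha.integrable_sq_L2w p).const_mul κ) ((hmeas p).pow 2) ?_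
    filter_upwards [hle p] with x hx
    rwa [Real.norm_eq_abs, abs_of_nonneg (sq_nonneg _)]
  have hmem : ∀ p : L2w c d a, MemLp (fun x => (x - 1) * p x) 2 (volume.restrict (Ioo c d)) :=
    fun p => (memLp_two_iff_integrable_sq (hmeas p)).2 (hint p)
  let T₀ : L2w c d a →ₗ[ℝ] L2 c d :=
    { toFun := fun p => (hmem p).toLp _
      map_add' := fun p q => by
        apply Lp.ext
        filter_upwards [(hmem (p + q)).coeFn_toLp, Lp.coeFn_add ((hmem p).toLp _)
          ((hmem q).toLp _), (hmem p).coeFn_toLp, (hmem q).coeFn_toLp,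
          ha.absolutelyContinuous.ae_le (Lp.coeFn_add p q)] with x h1 h2 h3 h4 h5
        rw [h1, h2, Pi.add_apply, h3, h4, h5, Pi.add_apply]; ring
      map_smul' := fun r p => by
        apply Lp.ext
        filter_upwards [(hmem (r • p)).coeFn_toLp, Lp.coeFn_smul r ((hmem p).toLp _),
          (hmem p).coeFn_toLp, ha.absolutelyContinuous.ae_le (Lp.coeFn_smul r p)]
          with x h1 h2 h3 h4
        rw [h1, RingHom.id_apply, h2, Pi.smul_apply, h3, h4, Pi.smul_apply, smul_eq_mul,
          smul_eq_mul]; ring }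
  have hT : ∀ p, T₀ p =ᵐ[volume.restrict (Ioo c d)] fun x => (x - 1) * p x := fun p =>
    (hmem p).coeFn_toLp
  have hbound : ∀ p, ‖T₀ p‖ ≤ √κ * ‖p‖ := by
    intro p
    refine abs_le_of_sq_le_sq' ?_ (by positivity) |>.2
    rw [mul_pow, Real.sq_sqrt hκ0, norm_sq_L2, ha.norm_sq_L2w, ← integral_const_mul]
    refine integral_mono_ae (integrable_sq_L2 _) ((ha.integrable_sq_L2w p).const_mul κ) ?_
    filter_upwards [hle p, hT p] with x h1 h2
    rw [h2]; exact h1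
  exact ⟨T₀.mkContinuous (√κ) hbound, hT, hbound⟩

lemma IsDegenerateWeight.norm_sq_split (ha : IsDegenerateWeight c d a x₁ x₂) (p : L2w c d a) :
    ‖p‖ ^ 2 = (∫ x in Ioo c 1, a x * p x ^ 2)
      + ∫ x in Ioo (2 - d) 1, a (2 - x) * (-p (2 - x)) ^ 2 := by
  rw [ha.norm_sq_L2w, setIntegral_split ha.lt_one ha.one_lt (ha.integrable_sq_L2w p)]
  simp only [neg_sq]

lemma IsDegenerateWeight.norm_sq_rep_split (ha : IsDegenerateWeight c d a x₁ x₂) {u : L2 c d}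
    {y : ℝ → ℝ} (hy : u =ᵐ[volume.restrict (Ioo c d)] y) :
    ‖u‖ ^ 2 = (∫ x in Ioo c 1, y x ^ 2) + ∫ x in Ioo (2 - d) 1, y (2 - x) ^ 2 := by
  rw [norm_sq_L2, setIntegral_split ha.lt_one ha.one_lt (integrable_sq_L2 u)]
  congr 1
  · refine integral_congr_ae ?_
    filter_upwards [ae_restrict_left ha.one_lt hy] with x hx
    rw [hx]
  · refine integral_congr_ae ?_
    filter_upwards [ae_restrict_right ha.lt_one hy] with x hx
    rw [hx]

/-- The Hardy inequality on `Ω`. -/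
lemma IsDegenerateWeight.norm_sq_le_hardy (ha : IsDegenerateWeight c d a x₁ x₂)
    (h1 : IsLeftDegenerate c x₁ μ₁ a (slope c d a))
    (h2 : IsLeftDegenerate (2 - d) (2 - x₂) μ₂ (fun x => a (2 - x)) fun x => -slope c d a (2 - x))
    {κ : ℝ} (hκ : IsQuadBound c d a κ) {q : L2 c d × L2w c d a} (hq : q ∈ W10 c d a) :
    ‖q.1‖ ^ 2 ≤ 4 * κ * ‖q.2‖ ^ 2 := by
  obtain ⟨hq1, y, hy, hyc, hyd⟩ := hq
  have hl := ha.isLeftTrace_left hq1 hy hyc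
  have hr := ha.isLeftTrace_right hq1 hy hyd
  have e1 := hl.hardy h1.isLeftWeight
  have e2 := hr.hardy h2.isLeftWeight
  have e3 := hl.hardy_weight h1.isLeftWeight hκ.1
  have e4 := hr.hardy_weight h2.isLeftWeight hκ.2
  rw [ha.norm_sq_rep_split hy.2, ha.norm_sq_split]
  linarith

/-- The Poincaré inequality on `Ω`. -/
lemma IsDegenerateWeight.norm_sq_le_poincare (ha : IsDegenerateWeight c d a x₁ x₂)
    (h1 : IsLeftDegenerate c x₁ μ₁ a (slope c d a))
    (h2 : IsLeftDegenerate (2 - d) (2 - x₂) μ₂ (fun x => a (2 - x)) fun x => -slope c d a (2 - x))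
    {D : ℝ} (hD1 : ∀ β ∈ Ico c 1, ∫ x in c..β, (1 - x) / a x ≤ D)
    (hD2 : ∀ β ∈ Ico (2 - d) 1, ∫ x in (2 - d)..β, (1 - x) / a (2 - x) ≤ D)
    {q : L2 c d × L2w c d a} (hq : q ∈ W10 c d a) :
    ‖q.1‖ ^ 2 ≤ D * ‖q.2‖ ^ 2 := by
  obtain ⟨hq1, y, hy, hyc, hyd⟩ := hq
  have e1 := (ha.isLeftTrace_left hq1 hy hyc).poincare h1.isLeftWeight hD1
  have e2 := (ha.isLeftTrace_right hq1 hy hyd).poincare h2.isLeftWeight hD2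
  rw [ha.norm_sq_rep_split hy.2, ha.norm_sq_split]
  linarith

/-- Green's formula. If `1/a` is integrable then the elements of `W¹_{a,0}` are continuous
across `1`; otherwise the flux vanishes there. -/
lemma IsDegenerateWeight.inner_add_inner_eq_zero (ha : IsDegenerateWeight c d a x₁ x₂)
    (h1 : IsLeftDegenerate c x₁ μ₁ a (slope c d a))
    (h2 : IsLeftDegenerate (2 - d) (2 - x₂) μ₂ (fun x => a (2 - x)) fun x => -slope c d a (2 - x))
    {p q : L2 c d × L2w c d a} (hp : p ∈ W10 c d a) (hq : q ∈ W10 c d a) {F : ℝ → ℝ} {f : L2 c d}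
    (hF : IsFlux c d a p F f) (hw : WeaklyDegenerate c d a ∨ F 1 = 0) :
    inner ℝ f q.1 + inner ℝ p.2 q.2 = 0 := by
  have hI1 := integrable_L2 f q.1
  have hI2 := ha.integrable_L2w p.2 q.2
  rw [inner_L2, ha.inner_L2w, ← integral_add hI1 hI2]
  rcases hw with hw | hF1
  · obtain ⟨y, hy, hyp, hyc, hyd⟩ := ha.exists_isPrimitiveOn_of_weaklyDegenerate hw hq
    have key := ((hF.isPrimitiveOn ha.lt.le).mul hyp).integral_eq
    rw [hyc, hyd, mul_zero, mul_zero, sub_zero, intervalIntegral.integral_of_le ha.lt.le,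
      integral_Ioc_eq_integral_Ioo] at key
    rw [← key]
    refine integral_congr_ae ?_
    filter_upwards [hy, hF.1] with x hx1 hx2
    rw [hx1, hx2]
  · obtain ⟨hp1, z, hz, hzc, hzd⟩ := hp
    obtain ⟨hq1, y, hy, hyc, hyd⟩ := hq
    have e1 := (ha.isLeftFlux_left hF).integral_add_eq_zero h1.isLeftWeight
      (ha.isLeftTrace_left hp1 hz hzc) (ha.isLeftTrace_left hq1 hy hyc) hF1
    have e2 := (ha.isLeftFlux_right hF).integral_add_eq_zero h2.isLeftWeight
      (ha.isLeftTrace_right hp1 hz hzd) (ha.isLeftTrace_right hq1 hy hyd)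
      (by rw [show (2 : ℝ) - 1 = 1 by norm_num, hF1, neg_zero])
    have hI : IntegrableOn (fun x => f x * q.1 x + a x * p.2 x * q.2 x) (Ioo c d) := hI1.add hI2
    rw [setIntegral_split ha.lt_one ha.one_lt hI]
    have e3 : ∫ x in Ioo c 1, (f x * q.1 x + a x * p.2 x * q.2 x)
        = ∫ x in Ioo c 1, (f x * y x + F x * q.2 x) := by
      refine integral_congr_ae ?_
      filter_upwards [ae_restrict_left ha.one_lt hF.1, ae_restrict_left ha.one_lt hy.2]
        with x hx1 hx2
      rw [hx1, hx2]
    have e4 : ∫ x in Ioo (2 - d) 1, (f (2 - x) * q.1 (2 - x) + a (2 - x) * p.2 (2 - x) * q.2 (2 - x))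
        = ∫ x in Ioo (2 - d) 1, (f (2 - x) * y (2 - x) + -F (2 - x) * -q.2 (2 - x)) := by
      refine integral_congr_ae ?_
      filter_upwards [ae_restrict_right ha.lt_one hF.1, ae_restrict_right ha.lt_one hy.2]
        with x hx1 hx2
      rw [hx1, hx2]; ring
    rw [e3, e4, e1, e2, add_zero]

/-- The flux of a state in the domain of the operator vanishes at `1` unless `1/a` is integrable. -/
lemma Transmission.weaklyDegenerate_or {p : L2 c d × L2w c d a} {y F : ℝ → ℝ} {f : L2 c d}
    (hc : c < 1) (hd : 1 < d) (hF : IsFlux c d a p F f) (h : Transmission c d a y F) :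
    WeaklyDegenerate c d a ∨ F 1 = 0 := by
  by_cases hw : WeaklyDegenerate c d a
  · exact Or.inl hw
  · right
    have h1 := (h.2 hw).2.1
    have h2 := ((hF.isPrimitiveOn (hc.trans hd).le).continuousOn.continuousAt
      (Icc_mem_nhds hc hd)).tendsto
    exact tendsto_nhds_unique (h2.mono_left nhdsWithin_le_nhds) h1

/-- The boundary form `(1 - c) a(c) y_x(c)² + (d - 1) a(d) y_x(d)²` in terms of the flux. -/
noncomputable def boundaryForm (c d : ℝ) (a F : ℝ → ℝ) : ℝ :=
  (1 - c) * F c ^ 2 / a c + (d - 1) * F d ^ 2 / a d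

lemma IsLeftTrace.quad_bounds {c x₁ μ m K : ℝ} {b b' g y : ℝ → ℝ}
    (hb : IsLeftDegenerate c x₁ μ b b') (hy : IsLeftTrace c b g y) (hm : μ ≤ m)
    (hK : ∀ x ∈ Ico c 1, |(1 - x) * b' x| ≤ K * b x) :
    (1 - m) * (∫ x in Ioo c 1, b x * g x ^ 2) ≤ ∫ x in Ioo c 1, (b x - (x - 1) * b' x) * g x ^ 2 ∧
    (∫ x in Ioo c 1, (b x - (x - 1) * b' x) * g x ^ 2)
      ≤ (1 + K) * ∫ x in Ioo c 1, b x * g x ^ 2 := by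
  have hw := hb.isLeftWeight
  have hlow : ∀ x ∈ Ioo c 1, (1 - m) * (b x * g x ^ 2) ≤ (b x - (x - 1) * b' x) * g x ^ 2 := by
    intro x hx
    have h1 := hb.neg_le (Ioo_subset_Ico_self hx)
    have h2 := hb.pos x (Ioo_subset_Ico_self hx)
    rw [← mul_assoc]
    gcongr
    nlinarith
  have hup : ∀ x ∈ Ioo c 1, (b x - (x - 1) * b' x) * g x ^ 2 ≤ (1 + K) * (b x * g x ^ 2) := by
    intro x hx
    have h1 := (abs_le.1 (hK x (Ioo_subset_Ico_self hx))).2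
    rw [← mul_assoc]
    gcongr
    nlinarith
  have hJ : IntegrableOn (fun x => (b x - (x - 1) * b' x) * g x ^ 2) (Ioo c 1) := by
    refine Integrable.mono' (hy.energy.const_mul (1 + |K| + |m|))
      ((hw.aesm.sub (aesm_sub_one.mul hw.aesm')).mul (hy.meas.pow 2)) ?_
    filter_upwards [ae_restrict_mem measurableSet_Ioo] with x hx
    have h1 := hlow x hx
    have h2 := hup x hx
    have h3 : 0 ≤ b x * g x ^ 2 :=
      mul_nonneg (hb.pos x (Ioo_subset_Ico_self hx)).le (sq_nonneg _)
    have h4 := mul_le_mul_of_nonneg_right (le_abs_self m) h3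
    have h5 := mul_le_mul_of_nonneg_right (le_abs_self K) h3
    have h6 := mul_nonneg (abs_nonneg m) h3
    have h7 := mul_nonneg (abs_nonneg K) h3
    rw [Real.norm_eq_abs, abs_le]
    constructor <;> nlinarith
  rw [← integral_const_mul, ← integral_const_mul]
  exact ⟨setIntegral_mono_on (hy.energy.const_mul _) hJ measurableSet_Ioo hlow,
    setIntegral_mono_on hJ (hy.energy.const_mul _) measurableSet_Ioo hup⟩

/-- The multiplier identity with `(x - 1) y_x`, in the form of two inequalities. -/
lemma IsDegenerateWeight.exists_multiplier_bounds (ha : IsDegenerateWeight c d a x₁ x₂)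
    (h1 : IsLeftDegenerate c x₁ μ₁ a (slope c d a))
    (h2 : IsLeftDegenerate (2 - d) (2 - x₂) μ₂ (fun x => a (2 - x)) fun x => -slope c d a (2 - x))
    {T : L2w c d a →L[ℝ] L2 c d}
    (hT : ∀ p, T p =ᵐ[volume.restrict (Ioo c d)] fun x => (x - 1) * p x) :
    ∃ K, 0 ≤ K ∧ ∀ p v : L2 c d × L2w c d a, p ∈ W10 c d a → v ∈ W10 c d a → ∀ F f,
      IsFlux c d a p F f →
      (1 - max μ₁ μ₂) * ‖p.2‖ ^ 2 ≤ boundaryForm c d a F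
          - 2 * (inner ℝ f (T p.2) + inner ℝ v.1 (T v.2)) - ‖v.1‖ ^ 2 ∧
      boundaryForm c d a F - 2 * (inner ℝ f (T p.2) + inner ℝ v.1 (T v.2)) - ‖v.1‖ ^ 2
          ≤ K * ‖p.2‖ ^ 2 := by
  obtain ⟨K₁, hK₁⟩ := h1.isLeftWeight.log
  obtain ⟨K₂, hK₂⟩ := h2.isLeftWeight.log
  have hc1 := ha.lt_one
  have hd1 := ha.one_lt
  set K := max (max K₁ K₂) 0
  have hK₁' : ∀ x ∈ Ico c 1, |(1 - x) * slope c d a x| ≤ K * a x := fun x hx =>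
    (hK₁ x hx).trans (mul_le_mul_of_nonneg_right ((le_max_left _ _).trans (le_max_left _ _))
      (h1.pos x hx).le)
  have hK₂' : ∀ x ∈ Ico (2 - d) 1, |(1 - x) * -slope c d a (2 - x)| ≤ K * a (2 - x) := fun x hx =>
    (hK₂ x hx).trans (mul_le_mul_of_nonneg_right ((le_max_right _ _).trans (le_max_left _ _))
      (h2.pos x hx).le)
  have hK0 : 0 ≤ K := le_max_right _ _
  refine ⟨1 + K, by linarith, ?_⟩
  rintro p v ⟨hp1, z, hz, hzc, hzd⟩ ⟨hv1, y, hy, hyc, hyd⟩ F f hF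
  have zl := ha.isLeftTrace_left hp1 hz hzc
  have zr := ha.isLeftTrace_right hp1 hz hzd
  have yl := ha.isLeftTrace_left hv1 hy hyc
  have yr := ha.isLeftTrace_right hv1 hy hyd
  have e1 := (ha.isLeftFlux_left hF).integral_mul_multiplier h1.isLeftWeight zl
  have e2 := (ha.isLeftFlux_right hF).integral_mul_multiplier h2.isLeftWeight zr
  have e3 := yl.integral_mul_multiplier h1.isLeftWeight
  have e4 := yr.integral_mul_multiplier h2.isLeftWeight
  have i1 : inner ℝ f (T p.2) = (∫ x in Ioo c 1, f x * ((x - 1) * p.2 x))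
      + ∫ x in Ioo (2 - d) 1, f (2 - x) * ((x - 1) * -p.2 (2 - x)) := by
    rw [inner_L2, setIntegral_split hc1 hd1 (integrable_L2 f (T p.2))]
    congr 1
    · refine integral_congr_ae ?_
      filter_upwards [ae_restrict_left hd1 (hT p.2)] with x hx
      rw [hx]
    · refine integral_congr_ae ?_
      filter_upwards [ae_restrict_right hc1 (hT p.2)] with x hx
      rw [hx]; ring
  have i2 : inner ℝ v.1 (T v.2) = (∫ x in Ioo c 1, y x * ((x - 1) * v.2 x))
      + ∫ x in Ioo (2 - d) 1, y (2 - x) * ((x - 1) * -v.2 (2 - x)) := by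
    rw [inner_L2, setIntegral_split hc1 hd1 (integrable_L2 v.1 (T v.2))]
    congr 1
    · refine integral_congr_ae ?_
      filter_upwards [ae_restrict_left hd1 (hT v.2), ae_restrict_left hd1 hy.2] with x hx hx'
      rw [hx, hx']
    · refine integral_congr_ae ?_
      filter_upwards [ae_restrict_right hc1 (hT v.2), ae_restrict_right hc1 hy.2] with x hx hx'
      rw [hx, hx']; ring
  obtain ⟨l1, u1⟩ := zl.quad_bounds h1 (le_max_left μ₁ μ₂) hK₁'
  obtain ⟨l2, u2⟩ := zr.quad_bounds h2 (le_max_right μ₁ μ₂) hK₂'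
  simp only [sub_sub_cancel] at e2
  rw [show (1 - (2 - d)) * (-F d) ^ 2 / a d = (d - 1) * F d ^ 2 / a d by ring] at e2
  rw [i1, i2, e1, e2, e3, e4, ha.norm_sq_rep_split hy.2, ha.norm_sq_split, boundaryForm]
  constructor <;> linarith

end Static

/-! ### Normal derivatives at the end points -/

section Slopes

variable {c d x₁ x₂ μ₁ μ₂ : ℝ} {a : ℝ → ℝ}

lemma IsContRep.sub {u v : L2 c d} {y z : ℝ → ℝ} (hy : IsContRep c d u y)
    (hz : IsContRep c d v z) : IsContRep c d (u - v) (fun x => y x - z x) := by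
  refine ⟨hy.1.sub hz.1, ?_⟩
  filter_upwards [Lp.coeFn_sub u v, hy.2, hz.2] with x h1 h2 h3
  rw [h1, Pi.sub_apply, h2, h3]

lemma IsContRep.smul {u : L2 c d} {y : ℝ → ℝ} (r : ℝ) (hy : IsContRep c d u y) :
    IsContRep c d (r • u) (fun x => r * y x) := by
  refine ⟨hy.1.const_mul r, ?_⟩
  filter_upwards [Lp.coeFn_smul r u, hy.2] with x h1 h2
  rw [h1, Pi.smul_apply, h2, smul_eq_mul]

lemma IsContRep.eqOn {u : L2 c d} {y z : ℝ → ℝ} (hcd : c < d) (hy : IsContRep c d u y)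
    (hz : IsContRep c d u z) : EqOn y z (Icc c d \ {1}) := by
  have hopen : IsOpen (Ioo c d \ {1}) := isOpen_Ioo.sdiff isClosed_singleton
  have hsub : Ioo c d \ {1} ⊆ Icc c d \ {1} := sdiff_subset_sdiff_left Ioo_subset_Icc_self
  have hae : y =ᵐ[volume.restrict (Ioo c d \ {1})] z :=
    ae_mono (Measure.restrict_mono (sdiff_subset (t := {(1 : ℝ)})) le_rfl)
      (hy.2.symm.trans hz.2)
  have heq := Measure.eqOn_open_of_ae_eq hae hopen (hy.1.mono hsub) (hz.1.mono hsub)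
  refine heq.of_subset_closure hy.1 hz.1 hsub ?_
  have h1 := closure_minimal ((dense_compl_singleton (1 : ℝ)).open_subset_closure_inter
    (isOpen_Ioo (a := c) (b := d))) isClosed_closure
  rw [closure_Ioo hcd.ne] at h1
  exact sdiff_subset.trans h1

lemma HasSlopeAt.sub {z m n : ℝ} {u v : L2 c d} (hu : HasSlopeAt c d z u m)
    (hv : HasSlopeAt c d z v n) : HasSlopeAt c d z (u - v) (m - n) := by
  obtain ⟨y, hy, hy'⟩ := hu
  obtain ⟨w, hw, hw'⟩ := hv
  exact ⟨_, hy.sub hw, hy'.sub hw'⟩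

lemma HasSlopeAt.unique {z m n : ℝ} {u : L2 c d} (hcd : c < d) (hz : z ∈ Icc c d) (hz1 : z ≠ 1)
    (hm : HasSlopeAt c d z u m) (hn : HasSlopeAt c d z u n) : m = n := by
  obtain ⟨y, hy, hy'⟩ := hm
  obtain ⟨w, hw, hw'⟩ := hn
  have h1 := hy.eqOn hcd hw
  have h2 : y =ᶠ[𝓝[Icc c d] z] w := by
    filter_upwards [self_mem_nhdsWithin,
      mem_nhdsWithin_of_mem_nhds (isOpen_compl_singleton.mem_nhds hz1)] with x hx hx'
    exact h1 ⟨hx, hx'⟩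
  exact (uniqueDiffOn_Icc hcd z hz).eq_deriv _ hy' (hw'.congr_of_eventuallyEq h2 (h1 ⟨hz, hz1⟩))

lemma IsPrimitiveOn.hasDerivWithinAt {F f k : ℝ → ℝ} {α β : ℝ} (h : IsPrimitiveOn F f α β)
    (hk : ContinuousOn k (Icc α β)) (hfk : f =ᵐ[volume.restrict (Ioo α β)] k) {z : ℝ}
    (hz : z ∈ Icc α β) : HasDerivWithinAt F (k z) (Icc α β) z := by
  set κ : ℝ → ℝ := IccExtend h.le ((Icc α β).domRestrict k) with hκ
  have hκc : Continuous κ := (continuousOn_iff_continuous_domRestrict.1 hk).Icc_extend'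
  have hκk : ∀ x ∈ Icc α β, κ x = k x := fun x hx => by
    rw [hκ, IccExtend_of_mem _ _ hx]; rfl
  have h1 : HasDerivAt (fun x => F α + ∫ s in α..x, κ s) (κ z) z :=
    ((hκc.integral_hasStrictDerivAt α z).hasDerivAt).const_add _
  rw [hκk z hz] at h1
  have h2 : ∀ x ∈ Icc α β, F x = F α + ∫ s in α..x, κ s := by
    intro x hx
    rw [h.eq x hx, intervalIntegral.integral_of_le hx.1, intervalIntegral.integral_of_le hx.1,
      integral_Ioc_eq_integral_Ioo, integral_Ioc_eq_integral_Ioo]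
    congr 1
    refine integral_congr_ae ?_
    filter_upwards [ae_mono (Measure.restrict_mono (Ioo_subset_Ioo_right hx.2) le_rfl) hfk,
      ae_restrict_mem measurableSet_Ioo] with s hs1 hs2
    rw [hs1, hκk s ⟨hs2.1.le, hs2.2.le.trans hx.2⟩]
  exact h1.hasDerivWithinAt.congr h2 (h2 z hz)

/-- The normal derivatives of an element of `W¹_a` with flux `F` are the values of `F / a`. -/
lemma IsDegenerateWeight.hasSlopeAt (ha : IsDegenerateWeight c d a x₁ x₂)
    {p : L2 c d × L2w c d a} (hp : p ∈ W10 c d a) {F : ℝ → ℝ} {f : L2 c d}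
    (hF : IsFlux c d a p F f) :
    HasSlopeAt c d c p.1 (F c / a c) ∧ HasSlopeAt c d d p.1 (F d / a d) := by
  obtain ⟨hp1, y, hy, hyc, hyd⟩ := hp
  have hc1 := ha.lt_one
  have hd1 := ha.one_lt
  have key : ∀ α β : ℝ, α ≤ β → c ≤ α → β ≤ d → (1 : ℝ) ∉ Icc α β → ∀ z ∈ Icc α β,
      HasDerivWithinAt y (F z / a z) (Icc α β) z := by
    intro α β hαβ hα hβ h1 z hz
    have hsub : Icc α β ⊆ Icc c d := Icc_subset_Icc hα hβ
    have hne : ∀ x ∈ Icc α β, x ∉ ({1} : Set ℝ) := fun x hx h =>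
      h1 (by rwa [mem_singleton_iff.1 h] at hx)
    refine (ha.isPrimitiveOn_of_mem_W1 hp1 hy hαβ hα hβ h1).hasDerivWithinAt
      (k := fun x => F x / a x) ?_ ?_ hz
    · exact ((hF.isPrimitiveOn ha.lt.le).continuousOn.mono hsub).div (ha.cont.mono hsub)
        fun x hx => (ha.pos x ⟨hsub hx, hne x hx⟩).ne'
    · filter_upwards [ae_mono (Measure.restrict_mono (Ioo_subset_Ioo hα hβ) le_rfl) hF.1,
        ae_restrict_mem measurableSet_Ioo] with x hx1 hx2
      have hx3 := Ioo_subset_Icc_self hx2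
      rw [hx1, mul_div_cancel_left₀ _ (ha.pos x ⟨hsub hx3, hne x hx3⟩).ne']
  refine ⟨⟨y, hy, ?_⟩, ⟨y, hy, ?_⟩⟩
  · refine (key c ((c + 1) / 2) (by linarith) le_rfl (by linarith)
      (fun h => by linarith [h.2]) c ⟨le_rfl, by linarith⟩).mono_of_mem_nhdsWithin ?_
    filter_upwards [self_mem_nhdsWithin, mem_nhdsWithin_of_mem_nhds
      (Iio_mem_nhds (show c < (c + 1) / 2 by linarith))] with x hx hx'
    exact ⟨hx.1, le_of_lt hx'⟩
  · refine (key ((d + 1) / 2) d (by linarith) (by linarith) le_rfl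
      (fun h => by linarith [h.1]) d ⟨by linarith, le_rfl⟩).mono_of_mem_nhdsWithin ?_
    filter_upwards [self_mem_nhdsWithin, mem_nhdsWithin_of_mem_nhds
      (Ioi_mem_nhds (show (d + 1) / 2 < d by linarith))] with x hx hx'
    exact ⟨le_of_lt hx', hx.2⟩

end Slopes

/-! ### Linearity of the operator -/

namespace IsPrimitiveOn

variable {F f G g : ℝ → ℝ} {α β : ℝ}

lemma sub (hF : IsPrimitiveOn F f α β) (hG : IsPrimitiveOn G g α β) :
    IsPrimitiveOn (fun x => F x - G x) (fun x => f x - g x) α β where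
  le := hF.le
  integrable := hF.integrable.sub hG.integrable
  eq x hx := by
    rw [intervalIntegral.integral_sub (hF.mono hx).intervalIntegrable
      (hG.mono hx).intervalIntegrable, hF.eq x hx, hG.eq x hx]; ring

lemma const_mul (r : ℝ) (hF : IsPrimitiveOn F f α β) :
    IsPrimitiveOn (fun x => r * F x) (fun x => r * f x) α β where
  le := hF.le
  integrable := hF.integrable.const_mul r
  eq x hx := by
    rw [intervalIntegral.integral_const_mul, hF.eq x hx]; ring

lemma congr (hF : IsPrimitiveOn F f α β) (h : f =ᵐ[volume.restrict (Ioo α β)] g) :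
    IsPrimitiveOn F g α β where
  le := hF.le
  integrable := hF.integrable.congr h
  eq x hx := by
    rw [hF.eq x hx, intervalIntegral.integral_of_le hx.1, intervalIntegral.integral_of_le hx.1,
      integral_Ioc_eq_integral_Ioo, integral_Ioc_eq_integral_Ioo]
    congr 1
    exact integral_congr_ae (ae_mono (Measure.restrict_mono (Ioo_subset_Ioo_right hx.2) le_rfl) h)

end IsPrimitiveOn

section Linear

variable {c d x₁ x₂ : ℝ} {a : ℝ → ℝ} {V : Submodule ℝ (L2 c d × L2w c d a)}

lemma IsDegenerateWeight.isFlux_sub (ha : IsDegenerateWeight c d a x₁ x₂)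
    {p q : L2 c d × L2w c d a} {F G : ℝ → ℝ} {f g : L2 c d} (hF : IsFlux c d a p F f)
    (hG : IsFlux c d a q G g) : IsFlux c d a (p - q) (fun x => F x - G x) (f - g) := by
  refine ⟨?_, (((hF.isPrimitiveOn ha.lt.le).sub (hG.isPrimitiveOn ha.lt.le)).congr
    (Lp.coeFn_sub f g).symm).eq⟩
  filter_upwards [hF.1, hG.1, ha.absolutelyContinuous.ae_le (Lp.coeFn_sub p.2 q.2)]
    with x h1 h2 h3
  rw [h1, h2, Prod.snd_sub, h3, Pi.sub_apply]; ring

lemma IsDegenerateWeight.isFlux_smul (ha : IsDegenerateWeight c d a x₁ x₂) (r : ℝ)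
    {p : L2 c d × L2w c d a} {F : ℝ → ℝ} {f : L2 c d} (hF : IsFlux c d a p F f) :
    IsFlux c d a (r • p) (fun x => r * F x) (r • f) := by
  refine ⟨?_, (((hF.isPrimitiveOn ha.lt.le).const_mul r).congr (Lp.coeFn_smul r f).symm).eq⟩
  filter_upwards [hF.1, ha.absolutelyContinuous.ae_le (Lp.coeFn_smul r p.2)] with x h1 h2
  rw [h1, Prod.smul_snd, h2, Pi.smul_apply, smul_eq_mul]; ring

lemma Transmission.sub {y z F G : ℝ → ℝ} (h : Transmission c d a y F)
    (h' : Transmission c d a z G) :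
    Transmission c d a (fun x => y x - z x) (fun x => F x - G x) := by
  refine ⟨fun hw => ?_, fun hw => ⟨fun q hq H k hk => ?_, ?_, ?_⟩⟩
  · obtain ⟨⟨L, h1, h2⟩, M, h3, h4⟩ := h.1 hw
    obtain ⟨⟨L', h1', h2'⟩, M', h3', h4'⟩ := h'.1 hw
    exact ⟨⟨_, h1.sub h1', h2.sub h2'⟩, _, h3.sub h3', h4.sub h4'⟩
  · obtain ⟨h1, h2⟩ := (h.2 hw).1 q hq H k hk
    obtain ⟨h1', h2'⟩ := (h'.2 hw).1 q hq H k hk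
    simp only [mul_sub]
    exact ⟨by simpa using h1.sub h1', by simpa using h2.sub h2'⟩
  · simpa using (h.2 hw).2.1.sub (h'.2 hw).2.1
  · simpa using (h.2 hw).2.2.sub (h'.2 hw).2.2

lemma Transmission.smul {y F : ℝ → ℝ} (r : ℝ) (h : Transmission c d a y F) :
    Transmission c d a (fun x => r * y x) (fun x => r * F x) := by
  refine ⟨fun hw => ?_, fun hw => ⟨fun q hq H k hk => ?_, ?_, ?_⟩⟩
  · obtain ⟨⟨L, h1, h2⟩, M, h3, h4⟩ := h.1 hw
    exact ⟨⟨_, h1.const_mul r, h2.const_mul r⟩, _, h3.const_mul r, h4.const_mul r⟩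
  · obtain ⟨h1, h2⟩ := (h.2 hw).1 q hq H k hk
    simp only [mul_left_comm _ r]
    exact ⟨by simpa using h1.const_mul r, by simpa using h2.const_mul r⟩
  · simpa using (h.2 hw).2.1.const_mul r
  · simpa using (h.2 hw).2.2.const_mul r

lemma IsDegenerateWeight.opGraph_sub (ha : IsDegenerateWeight c d a x₁ x₂) {U Z U' Z' : State c d a}
    (h : OpGraph c d a V U Z) (h' : OpGraph c d a V U' Z') :
    OpGraph c d a V (U - U') (Z - Z') := by
  obtain ⟨h1, h2, h3, y, F, h4, h5, h6⟩ := h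
  obtain ⟨h1', h2', h3', y', F', h4', h5', h6'⟩ := h'
  refine ⟨V.sub_mem h1 h1', V.sub_mem h2 h2', ?_, _, _, h4.sub h4', ha.isFlux_sub h5 h5',
    h6.sub h6'⟩
  rw [Prod.fst_sub, Prod.fst_sub, h3, h3', Prod.snd_sub]

lemma IsDegenerateWeight.opGraph_smul (ha : IsDegenerateWeight c d a x₁ x₂) (r : ℝ)
    {U Z : State c d a} (h : OpGraph c d a V U Z) : OpGraph c d a V (r • U) (r • Z) := by
  obtain ⟨h1, h2, h3, y, F, h4, h5, h6⟩ := h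
  refine ⟨V.smul_mem r h1, V.smul_mem r h2, ?_, _, _, h4.smul r, ha.isFlux_smul r h5, h6.smul r⟩
  rw [Prod.smul_fst, Prod.smul_fst, h3, Prod.smul_snd]

lemma IsDegenerateWeight.isClassicalSolution_sub (ha : IsDegenerateWeight c d a x₁ x₂)
    {U W : ℝ → State c d a} (hU : IsClassicalSolution c d a V U)
    (hW : IsClassicalSolution c d a V W) : IsClassicalSolution c d a V (fun t => U t - W t) := by
  obtain ⟨U', hU', h⟩ := hU
  obtain ⟨W', hW', h'⟩ := hW
  exact ⟨fun t => U' t - W' t, hU'.sub hW', fun t ht =>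
    ⟨(h t ht).1.sub (h' t ht).1, ha.opGraph_sub (h t ht).2 (h' t ht).2⟩⟩

/-- The means `ε⁻¹ ∫_t^{t+ε} U` of a mild solution are classical solutions. -/
lemma IsDegenerateWeight.exists_classical_approx (ha : IsDegenerateWeight c d a x₁ x₂)
    {U : ℝ → State c d a} (hU : IsMildSolution c d a V U) :
    ∃ Y : ℕ → ℝ → State c d a, (∀ k, IsClassicalSolution c d a V (Y k)) ∧
      Tendsto (fun k => Y k 0) atTop (𝓝 (U 0)) := by
  set W : ℝ → State c d a := fun s => U (max s 0) with hW
  have hWc : Continuous W := by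
    have h1 : Continuous fun s : ℝ => max s 0 := by fun_prop
    exact hU.cont.comp_continuous h1 fun s => le_max_right s 0
  have hWU : ∀ t, 0 ≤ t → W t = U t := fun t ht => by rw [hW]; simp only [max_eq_left ht]
  set P : ℝ → State c d a := fun t => ∫ s in (0 : ℝ)..t, W s with hP
  have hPd : ∀ t, HasDerivAt P (W t) t := fun t =>
    (hWc.integral_hasStrictDerivAt 0 t).hasDerivAt
  have hPU : ∀ t, 0 ≤ t → P t = ∫ s in (0 : ℝ)..t, U s := by
    intro t ht
    refine intervalIntegral.integral_congr fun s hs => ?_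
    rw [uIcc_of_le ht] at hs
    exact hWU s hs.1
  have hop : ∀ t, 0 ≤ t → OpGraph c d a V (P t) (W t - U 0) := by
    intro t ht
    rw [hPU t ht, hWU t ht]
    exact hU.eq t ht
  refine ⟨fun k t => ((1 : ℝ) / (k + 1))⁻¹ • (P (t + 1 / (k + 1)) - P t), fun k => ?_, ?_⟩
  · set ε : ℝ := 1 / (k + 1) with hε
    have hε0 : 0 < ε := by positivity
    refine ⟨fun t => ε⁻¹ • (W (t + ε) - W t), ?_, fun t ht => ⟨?_, ?_⟩⟩
    · have : Continuous fun t => ε⁻¹ • (W (t + ε) - W t) := by fun_prop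
      exact this.continuousOn
    · exact ((((hPd (t + ε)).comp_add_const t ε).sub (hPd t)).const_smul ε⁻¹).hasDerivWithinAt
    · have h1 := ha.opGraph_smul ε⁻¹ (ha.opGraph_sub (hop (t + ε) (by linarith)) (hop t ht))
      rwa [sub_sub_sub_cancel_right] at h1
  · have h1 := hasDerivAt_iff_tendsto_slope_zero.1 (hPd 0)
    rw [hWU 0 le_rfl] at h1
    have h2 : Tendsto (fun k : ℕ => (1 : ℝ) / (k + 1)) atTop (𝓝[≠] 0) :=
      tendsto_nhdsWithin_iff.2 ⟨tendsto_one_div_add_atTop_nhds_zero_nat,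
        Eventually.of_forall fun k => by
          simp only [mem_compl_iff, mem_singleton_iff]; positivity⟩
    exact h1.comp h2

end Linear

/-! ### Energy and multiplier estimates for classical solutions -/

lemma continuousWithinAt_of_sq_sub_le {f R : ℝ → ℝ} {S : Set ℝ} {s : ℝ}
    (hR : Tendsto R (𝓝[S] s) (𝓝 0)) (h : ∀ t ∈ S, (f t - f s) ^ 2 ≤ R t) :
    ContinuousWithinAt f S s := by
  have h1 : Tendsto (fun t => (f t - f s) ^ 2) (𝓝[S] s) (𝓝 0) :=
    squeeze_zero' (Eventually.of_forall fun t => sq_nonneg _)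
      (eventually_nhdsWithin_of_forall h) hR
  have h2 := (Real.continuous_sqrt.tendsto 0).comp h1
  rw [Real.sqrt_zero] at h2
  refine tendsto_iff_dist_tendsto_zero.2 (h2.congr fun t => ?_)
  simp only [Function.comp, Real.sqrt_sq_eq_abs, Real.dist_eq]

section Classical

variable {c d x₁ x₂ μ₁ μ₂ : ℝ} {a : ℝ → ℝ} {V : Submodule ℝ (L2 c d × L2w c d a)}

lemma mem_W10_of_mem (hV : IsIntermediate c d a V) {p : L2 c d × L2w c d a} (hp : p ∈ V) :
    p ∈ W10 c d a := hV.2 hp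

/-- The flux of a state in the domain of the operator. -/
lemma OpGraph.exists_isFlux (hc : c < 1) (hd : 1 < d) {U Z : State c d a}
    (h : OpGraph c d a V U Z) :
    ∃ F, IsFlux c d a U.1 F Z.2 ∧ (WeaklyDegenerate c d a ∨ F 1 = 0) := by
  obtain ⟨-, -, -, y, F, -, hF, ht⟩ := h
  exact ⟨F, hF, ht.weaklyDegenerate_or hc hd hF⟩

lemma le_boundaryForm (ha : IsDegenerateWeight c d a x₁ x₂) (F : ℝ → ℝ) :
    (1 - c) / a c * F c ^ 2 ≤ boundaryForm c d a F ∧ (d - 1) / a d * F d ^ 2 ≤ boundaryForm c d a F := by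
  have hc1 := ha.lt_one
  have hd1 := ha.one_lt
  have h1 := ha.pos c ⟨⟨le_rfl, ha.lt.le⟩, hc1.ne⟩
  have h2 := ha.pos d ⟨⟨ha.lt.le, le_rfl⟩, hd1.ne'⟩
  have h3 : 0 ≤ (1 - c) * F c ^ 2 / a c :=
    div_nonneg (mul_nonneg (by linarith) (sq_nonneg _)) h1.le
  have h4 : 0 ≤ (d - 1) * F d ^ 2 / a d :=
    div_nonneg (mul_nonneg (by linarith) (sq_nonneg _)) h2.le
  rw [boundaryForm, div_mul_eq_mul_div, div_mul_eq_mul_div]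
  constructor <;> linarith

/-- The values of the flux at the end points of `Ω` depend continuously on time. -/
lemma continuousOn_flux (ha : IsDegenerateWeight c d a x₁ x₂)
    {K : ℝ} {T : L2w c d a →L[ℝ] L2 c d}
    (hK : ∀ p ∈ W10 c d a, ∀ F f, IsFlux c d a p F f →
      boundaryForm c d a F ≤ 2 * inner ℝ f (T p.2) + K * ‖p.2‖ ^ 2)
    (hV : IsIntermediate c d a V) {U U' : ℝ → State c d a} (hU : ContinuousOn U (Ici 0))
    (hU' : ContinuousOn U' (Ici 0)) (hUV : ∀ t, 0 ≤ t → (U t).1 ∈ V) {F : ℝ → ℝ → ℝ}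
    (hF : ∀ t, 0 ≤ t → IsFlux c d a (U t).1 (F t) (U' t).2) :
    ContinuousOn (fun t => F t c) (Ici 0) ∧ ContinuousOn (fun t => F t d) (Ici 0) := by
  have hc1 := ha.lt_one
  have hd1 := ha.one_lt
  have hac := ha.pos c ⟨⟨le_rfl, ha.lt.le⟩, hc1.ne⟩
  have had := ha.pos d ⟨⟨ha.lt.le, le_rfl⟩, hd1.ne'⟩
  set R : ℝ → ℝ → ℝ := fun s t => 2 * inner ℝ ((U' t).2 - (U' s).2) (T ((U t).1.2 - (U s).1.2))
    + K * ‖(U t).1.2 - (U s).1.2‖ ^ 2 with hR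
  have hb : ∀ s, 0 ≤ s → ∀ t, 0 ≤ t →
      boundaryForm c d a (fun x => F t x - F s x) ≤ R s t := fun s hs t ht =>
    hK _ (mem_W10_of_mem hV (V.sub_mem (hUV t ht) (hUV s hs))) _ _
      (ha.isFlux_sub (hF t ht) (hF s hs))
  have hlim : ∀ s, 0 ≤ s → ∀ r : ℝ, Tendsto (fun t => r * R s t) (𝓝[Ici 0] s) (𝓝 0) := by
    intro s hs r
    have h1 : ContinuousWithinAt (fun t => (U t).1.2 - (U s).1.2) (Ici 0) s :=
      (continuous_snd.comp continuous_fst).continuousAt.comp_continuousWithinAt (hU s hs)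
        |>.sub continuousWithinAt_const
    have h2 : ContinuousWithinAt (fun t => (U' t).2 - (U' s).2) (Ici 0) s :=
      continuous_snd.continuousAt.comp_continuousWithinAt (hU' s hs)
        |>.sub continuousWithinAt_const
    have h3 : ContinuousWithinAt (fun t => T ((U t).1.2 - (U s).1.2)) (Ici 0) s :=
      T.continuous.continuousAt.comp_continuousWithinAt h1
    have h4 : ContinuousWithinAt (fun t => r * R s t) (Ici 0) s :=
      (((h2.inner (𝕜 := ℝ) h3).const_mul 2).add ((h1.norm.pow 2).const_mul K)).const_mul r
    have h5 := h4.tendsto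
    simpa [hR] using h5
  refine ⟨fun s hs => ?_, fun s hs => ?_⟩
  · refine continuousWithinAt_of_sq_sub_le (hlim s hs ((1 - c) / a c)⁻¹) fun t ht => ?_
    have h1 := (le_boundaryForm ha (fun x => F t x - F s x)).1.trans (hb s hs t ht)
    have h2 : 0 < (1 - c) / a c := div_pos (by linarith) hac
    rw [← div_eq_inv_mul, le_div_iff₀ h2]
    linarith
  · refine continuousWithinAt_of_sq_sub_le (hlim s hs ((d - 1) / a d)⁻¹) fun t ht => ?_
    have h1 := (le_boundaryForm ha (fun x => F t x - F s x)).2.trans (hb s hs t ht)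
    have h2 : 0 < (d - 1) / a d := div_pos (by linarith) had
    rw [← div_eq_inv_mul, le_div_iff₀ h2]
    linarith

/-- The multiplier estimates in integrated form. The lower one comes from
`Φ = 2 ⟪y_t, (x - 1) y_x⟫ + (m / 2) ⟪y_t, y⟫ + (2 - m) E t`, where `m` is the larger order of
degeneration: `Φ'` is at most the boundary form. -/
lemma IsDegenerateWeight.exists_classical_estimates (ha : IsDegenerateWeight c d a x₁ x₂)
    (h1 : IsLeftDegenerate c x₁ μ₁ a (slope c d a))
    (h2 : IsLeftDegenerate (2 - d) (2 - x₂) μ₂ (fun x => a (2 - x)) fun x => -slope c d a (2 - x))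
    (hV : IsIntermediate c d a V) {κ P : ℝ} (hκ0 : 0 ≤ κ) (hκ : IsQuadBound c d a κ)
    (hP0 : 0 ≤ P) (hP : ∀ q ∈ W10 c d a, ‖q.1‖ ^ 2 ≤ P ^ 2 * ‖q.2‖ ^ 2) :
    ∃ K, 0 ≤ K ∧ ∀ Y : ℝ → State c d a, IsClassicalSolution c d a V Y →
      ∃ hc hd : ℝ → ℝ, ContinuousOn hc (Ici 0) ∧ ContinuousOn hd (Ici 0) ∧
        (∀ t, 0 ≤ t → HasSlopeAt c d c (Y t).1.1 (hc t) ∧ HasSlopeAt c d d (Y t).1.1 (hd t)) ∧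
        ∀ S, 0 ≤ S →
          ((2 - max μ₁ μ₂) * S - 4 * √κ - P * max μ₁ μ₂) * energy c d a (Y 0)
            ≤ (1 - c) * a c * (∫ t in (0 : ℝ)..S, hc t ^ 2)
              + (d - 1) * a d * (∫ t in (0 : ℝ)..S, hd t ^ 2) ∧
          (1 - c) * a c * (∫ t in (0 : ℝ)..S, hc t ^ 2)
              + (d - 1) * a d * (∫ t in (0 : ℝ)..S, hd t ^ 2)
            ≤ (4 * √κ + K * S) * energy c d a (Y 0) := by
  obtain ⟨T, hT, hTκ⟩ := ha.exists_multiplier hκ0 hκ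
  obtain ⟨K, hK0, hK⟩ := ha.exists_multiplier_bounds h1 h2 hT
  have hc1 := ha.lt_one
  have hd1 := ha.one_lt
  have hac := ha.pos c ⟨⟨le_rfl, ha.lt.le⟩, hc1.ne⟩
  have had := ha.pos d ⟨⟨ha.lt.le, le_rfl⟩, hd1.ne'⟩
  refine ⟨2 * (1 + K), by positivity, ?_⟩
  rintro Y ⟨Y', hY', hY⟩
  set m := max μ₁ μ₂ with hm
  have hm0 : 0 ≤ m := h1.mu_pos.le.trans (le_max_left _ _)
  have hYc : ContinuousOn Y (Ici 0) := fun t ht => (hY t ht).1.continuousWithinAt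
  have hflux : ∀ t, 0 ≤ t → ∃ F, IsFlux c d a (Y t).1 F (Y' t).2 ∧
      (WeaklyDegenerate c d a ∨ F 1 = 0) := fun t ht => (hY t ht).2.exists_isFlux hc1 hd1
  choose! F hF hFw using hflux
  have hYV : ∀ t, 0 ≤ t → (Y t).1 ∈ W10 c d a := fun t ht => mem_W10_of_mem hV (hY t ht).2.1
  have hYV' : ∀ t, 0 ≤ t → (Y' t).1 ∈ W10 c d a := fun t ht => mem_W10_of_mem hV (hY t ht).2.2.1
  have hYY' : ∀ t, 0 ≤ t → (Y' t).1.1 = (Y t).2 := fun t ht => (hY t ht).2.2.2.1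
  obtain ⟨hFc, hFd⟩ := continuousOn_flux ha (K := K) (T := T) (fun p hp F f hF => by
    have := (hK p 0 hp (mem_W10_of_mem hV V.zero_mem) F f hF).2
    simp only [Prod.fst_zero, Prod.snd_zero, inner_zero_left, norm_zero] at this
    linarith) hV hYc hY' (fun t ht => (hY t ht).2.1) hF
  refine ⟨fun t => F t c / a c, fun t => F t d / a d, hFc.div_const _, hFd.div_const _,
    fun t ht => ha.hasSlopeAt (hYV t ht) (hF t ht), fun S hS => ?_⟩
  have hsub : Icc 0 S ⊆ Ici (0 : ℝ) := Icc_subset_Ici_self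
  have hB : (1 - c) * a c * (∫ t in (0 : ℝ)..S, (F t c / a c) ^ 2)
      + (d - 1) * a d * (∫ t in (0 : ℝ)..S, (F t d / a d) ^ 2)
      = ∫ t in (0 : ℝ)..S, boundaryForm c d a (F t) := by
    rw [← intervalIntegral.integral_const_mul, ← intervalIntegral.integral_const_mul,
      ← intervalIntegral.integral_add]
    · congr 1; ext t
      rw [boundaryForm]
      field_simp
    · exact ((((hFc.div_const _).pow 2).const_mul _).mono hsub).intervalIntegrable_of_Icc hS
    · exact ((((hFd.div_const _).pow 2).const_mul _).mono hsub).intervalIntegrable_of_Icc hS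
  have hBint : IntegrableOn (fun t => boundaryForm c d a (F t)) (Icc 0 S) := by
    refine ContinuousOn.integrableOn_Icc ?_
    exact ((((hFc.pow 2).const_mul _).div_const _).add
      (((hFd.pow 2).const_mul _).div_const _)).mono hsub
  rw [hB]
  have dv : ∀ t, 0 ≤ t → HasDerivWithinAt (fun t => (Y t).2) (Y' t).2 (Ici 0) t := fun t ht =>
    (ContinuousLinearMap.snd ℝ (L2 c d × L2w c d a) (L2 c d)).hasFDerivAt.comp_hasDerivWithinAt t (hY t ht).1
  have du : ∀ t, 0 ≤ t → HasDerivWithinAt (fun t => (Y t).1.1) (Y' t).1.1 (Ici 0) t := fun t ht =>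
    ((ContinuousLinearMap.fst ℝ (L2 c d) (L2w c d a)).comp
      (ContinuousLinearMap.fst ℝ (L2 c d × L2w c d a) (L2 c d))).hasFDerivAt.comp_hasDerivWithinAt t (hY t ht).1
  have dp : ∀ t, 0 ≤ t → HasDerivWithinAt (fun t => (Y t).1.2) (Y' t).1.2 (Ici 0) t := fun t ht =>
    ((ContinuousLinearMap.snd ℝ (L2 c d) (L2w c d a)).comp
      (ContinuousLinearMap.fst ℝ (L2 c d × L2w c d a) (L2 c d))).hasFDerivAt.comp_hasDerivWithinAt t (hY t ht).1
  have dT : ∀ t, 0 ≤ t → HasDerivWithinAt (fun t => T (Y t).1.2) (T (Y' t).1.2) (Ici 0) t :=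
    fun t ht => T.hasFDerivAt.comp_hasDerivWithinAt t (dp t ht)
  have dE : ∀ t, 0 ≤ t → HasDerivWithinAt (fun t => energy c d a (Y t)) 0 (Ici 0) t := by
    intro t ht
    have e1 := (((dv t ht).inner ℝ (dv t ht)).add ((dp t ht).inner ℝ (dp t ht))).const_mul (1 / 2)
    have e2 := ha.inner_add_inner_eq_zero h1 h2 (hYV t ht) (hYV' t ht) (hF t ht) (hFw t ht)
    rw [hYY' t ht] at e2
    have e3 : HasDerivWithinAt (fun t => energy c d a (Y t))
        (1 / 2 * (inner ℝ (Y t).2 (Y' t).2 + inner ℝ (Y' t).2 (Y t).2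
          + (inner ℝ (Y t).1.2 (Y' t).1.2 + inner ℝ (Y' t).1.2 (Y t).1.2))) (Ici 0) t := by
      refine e1.congr (fun s _ => ?_) ?_ <;>
      · rw [energy_eq ha]
        simp only [Pi.add_apply, real_inner_self_eq_norm_sq]
    refine e3.congr_deriv ?_
    rw [real_inner_comm (Y' t).2 (Y t).2, real_inner_comm (Y' t).1.2 (Y t).1.2] at *
    linarith
  have hE : ∀ t ∈ Icc 0 S, energy c d a (Y t) = energy c d a (Y 0) :=
    constant_of_has_deriv_right_zero
      (fun t ht => ((dE t ht.1).continuousWithinAt).mono hsub)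
      fun t ht => (dE t ht.1).mono (Ici_subset_Ici.2 ht.1)
  set E := energy c d a (Y 0) with hEdef
  have hE' : ∀ t ∈ Icc 0 S, ‖(Y t).2‖ ^ 2 + ‖(Y t).1.2‖ ^ 2 = 2 * E := by
    intro t ht
    have := hE t ht
    rw [energy_eq ha] at this
    linarith
  have dM : ∀ t, 0 ≤ t → HasDerivWithinAt (fun t => inner ℝ (Y t).2 (T (Y t).1.2))
      (inner ℝ (Y' t).2 (T (Y t).1.2) + inner ℝ (Y' t).1.1 (T (Y' t).1.2)) (Ici 0) t := by
    intro t ht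
    refine ((dv t ht).inner ℝ (dT t ht)).congr_deriv ?_
    rw [hYY' t ht, add_comm]
  have dN : ∀ t, 0 ≤ t → HasDerivWithinAt (fun t => inner ℝ (Y t).2 (Y t).1.1)
      (‖(Y t).2‖ ^ 2 - ‖(Y t).1.2‖ ^ 2) (Ici 0) t := by
    intro t ht
    refine ((dv t ht).inner ℝ (du t ht)).congr_deriv ?_
    have e2 := ha.inner_add_inner_eq_zero h1 h2 (hYV t ht) (hYV t ht) (hF t ht) (hFw t ht)
    rw [hYY' t ht, real_inner_self_eq_norm_sq]
    rw [real_inner_self_eq_norm_sq] at e2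
    linarith
  have hM : ∀ t ∈ Icc 0 S, |inner ℝ (Y t).2 (T (Y t).1.2)| ≤ √κ * E := by
    intro t ht
    have e1 := (abs_real_inner_le_norm (Y t).2 (T (Y t).1.2)).trans
      (mul_le_mul_of_nonneg_left (hTκ (Y t).1.2) (norm_nonneg _))
    have e2 := hE' t ht
    have e3 : ‖(Y t).2‖ * ‖(Y t).1.2‖ ≤ E := by nlinarith [sq_nonneg (‖(Y t).2‖ - ‖(Y t).1.2‖)]
    calc _ ≤ _ := e1
      _ = √κ * (‖(Y t).2‖ * ‖(Y t).1.2‖) := by ring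
      _ ≤ √κ * E := by gcongr
  have hN : ∀ t ∈ Icc 0 S, |inner ℝ (Y t).2 (Y t).1.1| ≤ P * E := by
    intro t ht
    have e4 : ‖(Y t).1.1‖ ≤ P * ‖(Y t).1.2‖ := by
      refine abs_le_of_sq_le_sq' ?_ (by positivity) |>.2
      rw [mul_pow]; exact hP _ (hYV t ht.1)
    have e1 := (abs_real_inner_le_norm (Y t).2 (Y t).1.1).trans
      (mul_le_mul_of_nonneg_left e4 (norm_nonneg _))
    have e2 := hE' t ht
    have e3 : ‖(Y t).2‖ * ‖(Y t).1.2‖ ≤ E := by nlinarith [sq_nonneg (‖(Y t).2‖ - ‖(Y t).1.2‖)]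
    calc _ ≤ _ := e1
      _ = P * (‖(Y t).2‖ * ‖(Y t).1.2‖) := by ring
      _ ≤ P * E := by gcongr
  have hS0 : (0 : ℝ) ∈ Icc 0 S := ⟨le_rfl, hS⟩
  have hSS : S ∈ Icc 0 S := ⟨hS, le_rfl⟩
  have M0 := abs_le.1 (hM 0 hS0)
  have MS := abs_le.1 (hM S hSS)
  have N0 := abs_le.1 (hN 0 hS0)
  have NS := abs_le.1 (hN S hSS)
  have hcont : ∀ {f f' : ℝ → ℝ}, (∀ t, 0 ≤ t → HasDerivWithinAt f (f' t) (Ici 0) t) →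
      ContinuousOn f (Icc 0 S) ∧ ∀ t ∈ Ioo 0 S, HasDerivWithinAt f (f' t) (Ioi t) t :=
    fun h => ⟨fun t ht => (h t ht.1).continuousWithinAt.mono hsub,
      fun t ht => (h t ht.1.le).mono (Ioi_subset_Ici ht.1.le)⟩
  constructor
  · have dΦ : ∀ t, 0 ≤ t → HasDerivWithinAt (fun t => 2 * inner ℝ (Y t).2 (T (Y t).1.2)
        + m / 2 * inner ℝ (Y t).2 (Y t).1.1 + (2 - m) * E * t)
        (2 * (inner ℝ (Y' t).2 (T (Y t).1.2) + inner ℝ (Y' t).1.1 (T (Y' t).1.2))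
          + m / 2 * (‖(Y t).2‖ ^ 2 - ‖(Y t).1.2‖ ^ 2) + (2 - m) * E * 1) (Ici 0) t :=
      fun t ht => (((dM t ht).const_mul 2).add ((dN t ht).const_mul (m / 2))).add
        ((hasDerivWithinAt_id t _).const_mul _)
    obtain ⟨k1, k2⟩ := hcont dΦ
    have key := intervalIntegral.sub_le_integral_of_hasDeriv_right_of_le hS k1 k2 hBint
      fun t ht => by
        have e1 := (hK _ _ (hYV t ht.1.le) (hYV' t ht.1.le) _ _ (hF t ht.1.le)).1
        have e2 := hE' t (Ioo_subset_Icc_self ht)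
        rw [hYY' t ht.1.le] at *
        linear_combination e1 - (1 - m / 2) * e2
    have hm2 : 0 ≤ m / 2 := by positivity
    have n0 := mul_le_mul_of_nonneg_left N0.2 hm2
    have nS := mul_le_mul_of_nonneg_left NS.1 hm2
    linarith
  · have dΦ : ∀ t, 0 ≤ t → HasDerivWithinAt (fun t => 2 * inner ℝ (Y t).2 (T (Y t).1.2)
        + 2 * (1 + K) * E * t)
        (2 * (inner ℝ (Y' t).2 (T (Y t).1.2) + inner ℝ (Y' t).1.1 (T (Y' t).1.2))
          + 2 * (1 + K) * E * 1) (Ici 0) t :=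
      fun t ht => ((dM t ht).const_mul 2).add ((hasDerivWithinAt_id t _).const_mul _)
    obtain ⟨k1, k2⟩ := hcont dΦ
    have key := intervalIntegral.integral_le_sub_of_hasDeriv_right_of_le hS k1 k2 hBint
      fun t ht => by
        have e1 := (hK _ _ (hYV t ht.1.le) (hYV' t ht.1.le) _ _ (hF t ht.1.le)).2
        have e2 := hE' t (Ioo_subset_Icc_self ht)
        rw [hYY' t ht.1.le] at *
        have e3 : 0 ≤ ‖(Y t).1.2‖ ^ 2 := sq_nonneg _
        have e4 := mul_nonneg hK0 (sq_nonneg ‖(Y t).2‖)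
        linear_combination e1 + e3 + e4 + (1 + K) * e2
    linarith

end Classical

/-! ### Normal derivatives of mild solutions -/

section Mild

variable {c d x₁ x₂ μ₁ μ₂ : ℝ} {a : ℝ → ℝ} {V : Submodule ℝ (L2 c d × L2w c d a)}

lemma energy_le (ha : IsDegenerateWeight c d a x₁ x₂) (U : State c d a) :
    energy c d a U ≤ ‖U‖ ^ 2 := by
  have h1 : ‖U.2‖ ≤ ‖U‖ := norm_snd_le U
  have h2 : ‖U.1.2‖ ≤ ‖U‖ := (norm_snd_le U.1).trans (norm_fst_le U)
  rw [energy_eq ha]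
  have h3 := pow_le_pow_left₀ (norm_nonneg _) h1 2
  have h4 := pow_le_pow_left₀ (norm_nonneg _) h2 2
  linarith

lemma energy_nonneg (ha : IsDegenerateWeight c d a x₁ x₂) (U : State c d a) :
    0 ≤ energy c d a U := by
  rw [energy_eq ha]; positivity

lemma continuous_energy (ha : IsDegenerateWeight c d a x₁ x₂) :
    Continuous (fun U : State c d a => energy c d a U) := by
  simp only [energy_eq ha]
  fun_prop

/-- The normal derivative of classical solutions as an element of `L²(0, S)`. By the estimate for
its norm it is Lipschitz in the initial data. -/
lemma IsDegenerateWeight.exists_trace (ha : IsDegenerateWeight c d a x₁ x₂) {z S C : ℝ}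
    (hz : z ∈ Icc c d) (hz1 : z ≠ 1) (hS : 0 ≤ S) (hC : 0 ≤ C)
    (h : ∀ Y : ℝ → State c d a, IsClassicalSolution c d a V Y →
      ∃ k : ℝ → ℝ, ContinuousOn k (Ici 0) ∧ (∀ t, 0 ≤ t → HasSlopeAt c d z (Y t).1.1 (k t)) ∧
        ∫ t in (0 : ℝ)..S, k t ^ 2 ≤ C * energy c d a (Y 0)) :
    ∃ τ : (ℝ → State c d a) → Lp ℝ 2 (volume.restrict (Ioo 0 S)),
      (∀ Y, IsClassicalSolution c d a V Y → ∀ k : ℝ → ℝ,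
        (∀ t ∈ Icc 0 S, HasSlopeAt c d z (Y t).1.1 (k t)) → k =ᵐ[volume.restrict (Ioo 0 S)] τ Y) ∧
      ∀ Y W, IsClassicalSolution c d a V Y → IsClassicalSolution c d a V W →
        ‖τ Y - τ W‖ ≤ √C * ‖Y 0 - W 0‖ := by
  classical
  choose k hk1 hk2 hk3 using h
  have hmem : ∀ Y hY, MemLp (k Y hY) 2 (volume.restrict (Ioo 0 S)) := by
    intro Y hY
    have h1 : ContinuousOn (k Y hY) (Icc 0 S) := (hk1 Y hY).mono Icc_subset_Ici_self
    exact (memLp_two_iff_integrable_sq ((h1.mono Ioo_subset_Icc_self).aestronglyMeasurable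
      measurableSet_Ioo)).2 ((h1.pow 2).integrableOn_Icc.mono_set Ioo_subset_Icc_self)
  set τ : (ℝ → State c d a) → Lp ℝ 2 (volume.restrict (Ioo 0 S)) := fun Y =>
    if hY : IsClassicalSolution c d a V Y then (hmem Y hY).toLp _ else 0 with hτ
  have hae : ∀ Y, IsClassicalSolution c d a V Y → ∀ k' : ℝ → ℝ,
      (∀ t ∈ Icc 0 S, HasSlopeAt c d z (Y t).1.1 (k' t)) →
      k' =ᵐ[volume.restrict (Ioo 0 S)] τ Y := by
    intro Y hY k' hk'
    have h1 : τ Y = (hmem Y hY).toLp _ := by rw [hτ]; simp only [dif_pos hY]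
    rw [h1]
    filter_upwards [(hmem Y hY).coeFn_toLp, ae_restrict_mem measurableSet_Ioo] with t ht1 ht2
    rw [ht1]
    exact (hk' t (Ioo_subset_Icc_self ht2)).unique ha.lt hz hz1 (hk2 Y hY t ht2.1.le)
  refine ⟨τ, hae, fun Y W hY hW => ?_⟩
  have hYW := ha.isClassicalSolution_sub hY hW
  have h1 : τ Y - τ W =ᵐ[volume.restrict (Ioo 0 S)] k _ hYW := by
    filter_upwards [Lp.coeFn_sub (τ Y) (τ W),
      hae Y hY _ fun t ht => hk2 Y hY t ht.1, hae W hW _ fun t ht => hk2 W hW t ht.1,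
      ae_restrict_mem measurableSet_Ioo] with t h1 h2 h3 h4
    rw [h1, Pi.sub_apply, ← h2, ← h3]
    exact ((hk2 Y hY t h4.1.le).sub (hk2 W hW t h4.1.le)).unique ha.lt hz hz1
      (hk2 _ hYW t h4.1.le)
  refine abs_le_of_sq_le_sq' ?_ (by positivity) |>.2
  have h2 : ‖τ Y - τ W‖ ^ 2 = ∫ t in (0 : ℝ)..S, k _ hYW t ^ 2 := by
    rw [norm_sq_L2, intervalIntegral.integral_of_le hS, integral_Ioc_eq_integral_Ioo]
    refine integral_congr_ae ?_
    filter_upwards [h1] with t ht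
    rw [ht]
  rw [h2, mul_pow, Real.sq_sqrt hC]
  refine (hk3 _ hYW).trans ?_
  gcongr
  exact energy_le ha _

/-- Normal derivatives of mild solutions exist, and their norms are the limits of those of
approximating classical solutions. -/
lemma IsDegenerateWeight.exists_normalDerivative (ha : IsDegenerateWeight c d a x₁ x₂) {z S C : ℝ}
    (hz : z ∈ Icc c d) (hz1 : z ≠ 1) (hS : 0 ≤ S) (hC : 0 ≤ C)
    (h : ∀ Y : ℝ → State c d a, IsClassicalSolution c d a V Y →
      ∃ k : ℝ → ℝ, ContinuousOn k (Ici 0) ∧ (∀ t, 0 ≤ t → HasSlopeAt c d z (Y t).1.1 (k t)) ∧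
        ∫ t in (0 : ℝ)..S, k t ^ 2 ≤ C * energy c d a (Y 0))
    {U : ℝ → State c d a} {Y : ℕ → ℝ → State c d a} (hY : ∀ k, IsClassicalSolution c d a V (Y k))
    (hYU : Tendsto (fun k => Y k 0) atTop (𝓝 (U 0))) :
    ∃ g, IsNormalDerivative c d a V z S U g ∧ ∀ k : ℕ → ℝ → ℝ,
      (∀ j, ∀ t ∈ Icc 0 S, HasSlopeAt c d z (Y j t).1.1 (k j t)) →
      Tendsto (fun j => ∫ t in (0 : ℝ)..S, k j t ^ 2) atTop (𝓝 (∫ t in (0 : ℝ)..S, g t ^ 2)) := by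
  obtain ⟨τ, hτ1, hτ2⟩ := ha.exists_trace hz hz1 hS hC h
  have hcau : CauchySeq fun j => τ (Y j) := by
    rw [Metric.cauchySeq_iff]
    intro ε hε
    obtain ⟨N, hN⟩ := Metric.cauchySeq_iff.1 hYU.cauchySeq (ε / (√C + 1)) (by positivity)
    refine ⟨N, fun m hm n hn => ?_⟩
    have h1 := hN m hm n hn
    rw [dist_eq_norm] at h1 ⊢
    rw [lt_div_iff₀ (by positivity)] at h1
    have h2 := hτ2 _ _ (hY m) (hY n)
    nlinarith [norm_nonneg (Y m 0 - Y n 0)]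
  obtain ⟨g, hg⟩ := cauchySeq_tendsto_of_complete hcau
  refine ⟨g, ⟨Lp.memLp g, ?_, ?_⟩, ?_⟩
  · choose k hk1 hk2 hk3 using h
    exact ⟨fun j => k (Y j) (hY j), Y, hY, hYU, fun j t ht => hk2 _ (hY j) t ht.1⟩
  · rintro k ⟨W, hW, hWU, hk⟩
    have h1 : Tendsto (fun j => τ (W j)) atTop (𝓝 g) := by
      have h2 : Tendsto (fun j => τ (W j) - τ (Y j)) atTop (𝓝 0) := by
        have h3 : Tendsto (fun j => √C * ‖W j 0 - Y j 0‖) atTop (𝓝 0) := by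
          have h4 := ((hWU.sub hYU).norm).const_mul √C
          simpa using h4
        exact squeeze_zero_norm (fun j => hτ2 _ _ (hW j) (hY j)) h3
      simpa using h2.add hg
    have h2 : ∀ j, eLpNorm (k j - (g : ℝ → ℝ)) 2 (volume.restrict (Ioo 0 S)) = ‖τ (W j) - g‖ₑ := by
      intro j
      rw [Lp.enorm_def]
      refine eLpNorm_congr_ae ?_
      filter_upwards [hτ1 _ (hW j) _ (hk j), Lp.coeFn_sub (τ (W j)) g] with t h3 h4
      rw [h4, Pi.sub_apply, Pi.sub_apply, h3]
    simp only [h2]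
    have h3 := (h1.sub_const g).enorm
    simpa using h3
  · intro k hk
    have h1 : ∀ p : Lp ℝ 2 (volume.restrict (Ioo 0 S)),
        ∫ t in (0 : ℝ)..S, p t ^ 2 = ‖p‖ ^ 2 := by
      intro p
      rw [norm_sq_L2, intervalIntegral.integral_of_le hS, integral_Ioc_eq_integral_Ioo]
    have h2 : ∀ j, ∫ t in (0 : ℝ)..S, k j t ^ 2 = ‖τ (Y j)‖ ^ 2 := by
      intro j
      rw [← h1, intervalIntegral.integral_of_le hS, integral_Ioc_eq_integral_Ioo,
        intervalIntegral.integral_of_le hS, integral_Ioc_eq_integral_Ioo]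
      refine integral_congr_ae ?_
      filter_upwards [hτ1 _ (hY j) _ (hk j)] with t ht
      rw [ht]
    simp only [h1, h2]
    exact hg.norm.pow 2

/-- The observability inequality in terms of a constant `κ` with `(x - 1)² ≤ κ a` and a Poincaré
constant `P`. -/
lemma IsDegenerateWeight.exists_normalDerivatives (ha : IsDegenerateWeight c d a x₁ x₂)
    (h1 : IsLeftDegenerate c x₁ μ₁ a (slope c d a))
    (h2 : IsLeftDegenerate (2 - d) (2 - x₂) μ₂ (fun x => a (2 - x)) fun x => -slope c d a (2 - x))
    (hV : IsIntermediate c d a V) {κ P : ℝ} (hκ0 : 0 ≤ κ) (hκ : IsQuadBound c d a κ)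
    (hP0 : 0 ≤ P) (hP : ∀ q ∈ W10 c d a, ‖q.1‖ ^ 2 ≤ P ^ 2 * ‖q.2‖ ^ 2)
    {U : ℝ → State c d a} (hU : IsMildSolution c d a V U) {S : ℝ} (hS : 0 ≤ S) :
    ∃ gc gd, IsNormalDerivative c d a V c S U gc ∧ IsNormalDerivative c d a V d S U gd ∧
      ((2 - max μ₁ μ₂) * S - 4 * √κ - P * max μ₁ μ₂) * energy c d a (U 0)
        ≤ (1 - c) * a c * (∫ t in (0 : ℝ)..S, gc t ^ 2)
          + (d - 1) * a d * (∫ t in (0 : ℝ)..S, gd t ^ 2) := by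
  obtain ⟨K, hK0, hK⟩ := ha.exists_classical_estimates h1 h2 hV hκ0 hκ hP0 hP
  have hc1 := ha.lt_one
  have hd1 := ha.one_lt
  have hcm : c ∈ Icc c d := ⟨le_rfl, ha.lt.le⟩
  have hdm : d ∈ Icc c d := ⟨ha.lt.le, le_rfl⟩
  have hαc : 0 < (1 - c) * a c := mul_pos (by linarith) (ha.pos c ⟨hcm, hc1.ne⟩)
  have hαd : 0 < (d - 1) * a d := mul_pos (by linarith) (ha.pos d ⟨hdm, hd1.ne'⟩)
  have hnn : ∀ k : ℝ → ℝ, 0 ≤ ∫ t in (0 : ℝ)..S, k t ^ 2 := fun k =>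
    intervalIntegral.integral_nonneg hS fun t _ => sq_nonneg _
  obtain ⟨Y, hY, hYU⟩ := ha.exists_classical_approx hU
  have hC0 : 0 ≤ 4 * √κ + K * S := by positivity
  obtain ⟨gc, hgc, hgc'⟩ := ha.exists_normalDerivative (V := V) (z := c) (S := S)
    (C := (4 * √κ + K * S) / ((1 - c) * a c)) hcm hc1.ne hS (by positivity) (fun W hW => by
      obtain ⟨kc, kd, q1, -, q3, q4⟩ := hK W hW
      refine ⟨kc, q1, fun t ht => (q3 t ht).1, ?_⟩
      have q5 := (q4 S hS).2
      have q6 := mul_nonneg hαd.le (hnn kd)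
      rw [div_mul_eq_mul_div, le_div_iff₀ hαc]
      linarith) hY hYU
  obtain ⟨gd, hgd, hgd'⟩ := ha.exists_normalDerivative (V := V) (z := d) (S := S)
    (C := (4 * √κ + K * S) / ((d - 1) * a d)) hdm hd1.ne' hS (by positivity) (fun W hW => by
      obtain ⟨kc, kd, -, q2, q3, q4⟩ := hK W hW
      refine ⟨kd, q2, fun t ht => (q3 t ht).2, ?_⟩
      have q5 := (q4 S hS).2
      have q6 := mul_nonneg hαc.le (hnn kc)
      rw [div_mul_eq_mul_div, le_div_iff₀ hαd]
      linarith) hY hYU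
  refine ⟨gc, gd, hgc, hgd, ?_⟩
  choose kc kd q1 q2 q3 q4 using fun j => hK (Y j) (hY j)
  have l1 := (hgc' kc fun j t ht => (q3 j t ht.1).1).const_mul ((1 - c) * a c)
  have l2 := (hgd' kd fun j t ht => (q3 j t ht.1).2).const_mul ((d - 1) * a d)
  have l3 := (((continuous_energy ha).tendsto (U 0)).comp hYU).const_mul
    ((2 - max μ₁ μ₂) * S - 4 * √κ - P * max μ₁ μ₂)
  exact le_of_tendsto_of_tendsto' l3 (l1.add l2) fun j => (q4 j S hS).1

end Mild

/-! ### The constants of the theorem -/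

section Constants

variable {c d x₁ x₂ : ℝ} {a : ℝ → ℝ}

lemma isQuadBound_CconstSq
    (h1 : IsLeftDegenerate c x₁ (mu1 c d a x₁) a (slope c d a))
    (h2 : IsLeftDegenerate (2 - d) (2 - x₂) (mu2 c d a x₂) (fun x => a (2 - x))
      fun x => -slope c d a (2 - x)) :
    IsQuadBound c d a (CconstSq c d a x₁ x₂ / 4) := by
  rw [CconstSq, mul_div_cancel_left₀ _ (four_ne_zero)]
  refine ⟨fun x hx => h1.sq_le ?_ ?_ hx, fun x hx => h2.sq_le ?_ ?_ hx⟩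
  · exact (le_max_left _ _).trans (le_max_left _ _)
  · exact (le_max_right _ _).trans (le_max_left _ _)
  · rw [image_reflect, show 1 - (2 - d) = d - 1 by ring]
    exact (le_max_left _ _).trans (le_max_right _ _)
  · rw [show 1 - (2 - x₂) = x₂ - 1 by ring, sub_sub_cancel]
    exact (le_max_right _ _).trans (le_max_right _ _)

lemma CconstSq_nonneg (h1 : IsLeftDegenerate c x₁ (mu1 c d a x₁) a (slope c d a)) :
    0 ≤ CconstSq c d a x₁ x₂ := by
  have h2 : 0 ≤ (1 - x₁) ^ mu1 c d a x₁ / a x₁ :=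
    div_nonneg (Real.rpow_nonneg (by linarith [h1.mem.2]) _) (h1.pos _ h1.mem).le
  exact mul_nonneg four_pos.le (h2.trans ((le_max_right _ _).trans (le_max_left _ _)))

lemma integral_le_Dconst_sq
    (h1 : IsLeftDegenerate c x₁ (mu1 c d a x₁) a (slope c d a))
    (h2 : IsLeftDegenerate (2 - d) (2 - x₂) (mu2 c d a x₂) (fun x => a (2 - x))
      fun x => -slope c d a (2 - x)) (hμ : muMax c d a x₁ x₂ < 2) :
    (∀ β ∈ Ico c 1, ∫ x in c..β, (1 - x) / a x ≤ Dconst c d a x₁ x₂ ^ 2) ∧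
    ∀ β ∈ Ico (2 - d) 1, ∫ x in (2 - d)..β, (1 - x) / a (2 - x) ≤ Dconst c d a x₁ x₂ ^ 2 := by
  have e1 : ∀ β ∈ Ico c 1, ∫ x in c..β, (1 - x) / a x ≤ D1 c d a x₁ := fun β hβ =>
    h1.integral_le ((le_max_left _ _).trans_lt hμ) hβ
  have e2 : ∀ β ∈ Ico (2 - d) 1, ∫ x in (2 - d)..β, (1 - x) / a (2 - x) ≤ D2 c d a x₂ := by
    intro β hβ
    have := h2.integral_le ((le_max_right _ _).trans_lt hμ) hβ
    rw [image_reflect, sub_sub_cancel] at this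
    refine this.trans (le_of_eq ?_)
    rw [D2]
    ring_nf
  have e3 : 0 ≤ max (D1 c d a x₁) (D2 c d a x₂) := by
    have := e1 c ⟨le_rfl, h1.lt⟩
    rw [intervalIntegral.integral_same] at this
    exact this.trans (le_max_left _ _)
  rw [Dconst, Real.sq_sqrt e3]
  exact ⟨fun β hβ => (e1 β hβ).trans (le_max_left _ _),
    fun β hβ => (e2 β hβ).trans (le_max_right _ _)⟩

end Constants

end DegenerateWave

open DegenerateWave in
theorem theorem4p1p1 (c d : ℝ) (hc0 : 0 ≤ c) (hc1 : c < 1) (hd1 : 1 < d) (hd2 : d ≤ 2)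
    (a : ℝ → ℝ) (x₁ x₂ : ℝ) (ha : IsDegenerateWeight c d a x₁ x₂)
    (hleft : ∀ x ∈ Icc c x₁,
      derivWithin (fun s => Real.log ((1 - s) ^ mu1 c d a x₁)) (Icc c d) x
        ≤ derivWithin (fun s => Real.log (a s)) (Icc c d) x)
    (hright : ∀ x ∈ Icc x₂ d,
      derivWithin (fun s => Real.log (a s)) (Icc c d) x
        ≤ derivWithin (fun s => Real.log ((s - 1) ^ mu2 c d a x₂)) (Icc c d) x)
    (V : Submodule ℝ (L2 c d × L2w c d a)) (hV : IsIntermediate c d a V) :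
    (∀ U, IsMildSolution c d a V U → ∀ T : ℝ, 0 < T →
      ∃ gc gd, IsNormalDerivative c d a V c T U gc ∧ IsNormalDerivative c d a V d T U gd ∧
        ((2 - muMax c d a x₁ x₂) * T - max 4 (CconstSq c d a x₁ x₂)
            - min (Dconst c d a x₁ x₂) (Cconst c d a x₁ x₂) * muMax c d a x₁ x₂)
              * energy c d a (U 0)
          ≤ (1 - c) * a c * (∫ t in (0 : ℝ)..T, gc t ^ 2)
            + (d - 1) * a d * ∫ t in (0 : ℝ)..T, gd t ^ 2) ∧
    (muMax c d a x₁ x₂ < 2 → ∀ T : ℝ, Tobs c d a x₁ x₂ < T → IsObservable c d a V T) := by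
  have h1 := ha.isLeftDegenerate_left hc0 hleft
  have h2 := ha.isLeftDegenerate_right hd2 hright
  have hCsq : 0 ≤ CconstSq c d a x₁ x₂ := CconstSq_nonneg h1
  have hC0 : 0 ≤ Cconst c d a x₁ x₂ := Real.sqrt_nonneg _
  have hD0 : 0 ≤ Dconst c d a x₁ x₂ := Real.sqrt_nonneg _
  have hCC : Cconst c d a x₁ x₂ ^ 2 = CconstSq c d a x₁ x₂ := Real.sq_sqrt hCsq
  have hquad := isQuadBound_CconstSq h1 h2
  have hsqrt : 4 * √(CconstSq c d a x₁ x₂ / 4) = 2 * Cconst c d a x₁ x₂ := by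
    rw [Real.sqrt_div hCsq, show (4 : ℝ) = 2 ^ 2 by norm_num, Real.sqrt_sq (by norm_num), Cconst]
    ring
  have h2C : 2 * Cconst c d a x₁ x₂ ≤ max 4 (CconstSq c d a x₁ x₂) := by
    rcases le_total (Cconst c d a x₁ x₂) 2 with h | h
    · exact le_max_of_le_left (by linarith)
    · exact le_max_of_le_right (by rw [← hCC]; nlinarith)
  have hmu : 0 < muMax c d a x₁ x₂ := h1.mu_pos.trans_le (le_max_left _ _)
  have hαc : 0 < (1 - c) * a c :=
    mul_pos (by linarith) (ha.pos c ⟨⟨le_rfl, ha.lt.le⟩, hc1.ne⟩)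
  have hαd : 0 < (d - 1) * a d :=
    mul_pos (by linarith) (ha.pos d ⟨⟨ha.lt.le, le_rfl⟩, hd1.ne'⟩)
  have hardy : ∀ q ∈ W10 c d a, ‖q.1‖ ^ 2 ≤ Cconst c d a x₁ x₂ ^ 2 * ‖q.2‖ ^ 2 := by
    intro q hq
    have := ha.norm_sq_le_hardy h1 h2 hquad hq
    rw [hCC]
    linarith
  have main : ∀ U, IsMildSolution c d a V U → ∀ T : ℝ, 0 < T →
      ∃ gc gd, IsNormalDerivative c d a V c T U gc ∧ IsNormalDerivative c d a V d T U gd ∧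
        ((2 - muMax c d a x₁ x₂) * T - max 4 (CconstSq c d a x₁ x₂)
            - min (Dconst c d a x₁ x₂) (Cconst c d a x₁ x₂) * muMax c d a x₁ x₂)
              * energy c d a (U 0)
          ≤ (1 - c) * a c * (∫ t in (0 : ℝ)..T, gc t ^ 2)
            + (d - 1) * a d * ∫ t in (0 : ℝ)..T, gd t ^ 2 := by
    intro U hU T hT
    have hE := energy_nonneg ha (U 0)
    rcases lt_or_ge (muMax c d a x₁ x₂) 2 with hμ | hμ
    · obtain ⟨hI1, hI2⟩ := integral_le_Dconst_sq h1 h2 hμ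
      obtain ⟨gc, gd, hgc, hgd, h⟩ := ha.exists_normalDerivatives h1 h2 hV
        (div_nonneg hCsq four_pos.le) hquad (le_min hD0 hC0) (fun q hq => by
          rcases le_total (Dconst c d a x₁ x₂) (Cconst c d a x₁ x₂) with h | h
          · rw [min_eq_left h]
            exact ha.norm_sq_le_poincare h1 h2 hI1 hI2 hq
          · rw [min_eq_right h]
            exact hardy q hq) hU hT.le
      refine ⟨gc, gd, hgc, hgd, le_trans (mul_le_mul_of_nonneg_right ?_ hE) h⟩
      rw [hsqrt]
      simp only [muMax] at *
      linarith
    · obtain ⟨gc, gd, hgc, hgd, -⟩ := ha.exists_normalDerivatives h1 h2 hV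
        (div_nonneg hCsq four_pos.le) hquad hC0 hardy hU hT.le
      refine ⟨gc, gd, hgc, hgd, ?_⟩
      have e1 : 0 ≤ ∫ t in (0 : ℝ)..T, gc t ^ 2 :=
        intervalIntegral.integral_nonneg hT.le fun t _ => sq_nonneg _
      have e2 : 0 ≤ ∫ t in (0 : ℝ)..T, gd t ^ 2 :=
        intervalIntegral.integral_nonneg hT.le fun t _ => sq_nonneg _
      refine le_trans (mul_nonpos_of_nonpos_of_nonneg ?_ hE)
        (add_nonneg (mul_nonneg hαc.le e1) (mul_nonneg hαd.le e2))
      have e3 : (2 - muMax c d a x₁ x₂) * T ≤ 0 :=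
        mul_nonpos_of_nonpos_of_nonneg (by linarith) hT.le
      have e4 : (4 : ℝ) ≤ max 4 (CconstSq c d a x₁ x₂) := le_max_left _ _
      have e5 := mul_nonneg (le_min hD0 hC0) hmu.le
      linarith
  refine ⟨main, fun hμ T hT => ?_⟩
  have hμ' : 0 < 2 - muMax c d a x₁ x₂ := by linarith
  have hnum : 0 < max 4 (CconstSq c d a x₁ x₂)
      + min (Dconst c d a x₁ x₂) (Cconst c d a x₁ x₂) * muMax c d a x₁ x₂ :=
    add_pos_of_pos_of_nonneg (lt_max_of_lt_left four_pos) (mul_nonneg (le_min hD0 hC0) hmu.le)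
  have hT0 : 0 < T := lt_trans (mul_pos (one_div_pos.2 hμ') hnum) hT
  have hL : 0 < (2 - muMax c d a x₁ x₂) * T - max 4 (CconstSq c d a x₁ x₂)
      - min (Dconst c d a x₁ x₂) (Cconst c d a x₁ x₂) * muMax c d a x₁ x₂ := by
    rw [Tobs, one_div_mul_eq_div, div_lt_iff₀ hμ'] at hT
    linarith
  set L := (2 - muMax c d a x₁ x₂) * T - max 4 (CconstSq c d a x₁ x₂)
      - min (Dconst c d a x₁ x₂) (Cconst c d a x₁ x₂) * muMax c d a x₁ x₂
  have hα : 0 < max ((1 - c) * a c) ((d - 1) * a d) := lt_max_of_lt_left hαc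
  refine ⟨L / max ((1 - c) * a c) ((d - 1) * a d), div_pos hL hα, fun U hU => ?_⟩
  obtain ⟨gc, gd, hgc, hgd, h⟩ := main U hU T hT0
  refine ⟨gc, gd, hgc, hgd, ?_⟩
  have e1 : 0 ≤ ∫ t in (0 : ℝ)..T, gc t ^ 2 :=
    intervalIntegral.integral_nonneg hT0.le fun t _ => sq_nonneg _
  have e2 : 0 ≤ ∫ t in (0 : ℝ)..T, gd t ^ 2 :=
    intervalIntegral.integral_nonneg hT0.le fun t _ => sq_nonneg _
  rw [div_mul_eq_mul_div, div_le_iff₀ hα]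
  refine h.trans ?_
  have e3 := mul_le_mul_of_nonneg_right (le_max_left ((1 - c) * a c) ((d - 1) * a d)) e1
  have e4 := mul_le_mul_of_nonneg_right (le_max_right ((1 - c) * a c) ((d - 1) * a d)) e2
  linarith
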